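/- **Setting.** A control problem has state space $S\subseteq\mathbb R^{d_S}$, actions $A=\mathbb R^{d_A}$, horizon $T$, dynamics $s_{t+1}=f(s_t,a_t)+\zeta_t$ from a fixed $s_0\in S$ with independent noise $\zeta_t$, rewards $R(s_t,a_t)$ and policies $\pi_\theta:S\to A$, $\theta\in\Theta\subseteq\mathbb R^{d_\Theta}$ open; $f$, $R$ and the law of $\zeta_t$ may vary with $t$ (Lipschitz bounds are then uniform in $t<T$). Actions are perturbed: $a_t=\pi_\theta(s_t)+\xi_t$, with $\xi_t$ i.i.d. of density $p_\xi$, independent of the $\zeta_t$. Put $\tilde\pi_\theta(a\mid s)=p_\xi(a-\pi_\theta(s))$, $f_\theta(s)=f(s,\pi_\theta(s))$, $R_\theta(s)=R(s,\pi_\theta(s))$, $\tilde f_\theta(s,\xi)=f(s,\pi_\theta(s)+\xi)$, $\tilde R_\theta(s)=\mathbb E_\xi[R(s,\pi_\theta(s)+\xi)]$. It is assumed that $f,R,\pi_\theta,f_\theta,\tilde f_\theta,R_\theta,\tilde R_\theta$ are Lipschitz and $C^2$ with Lipschitz first derivative. $L_h$ denotes the Lipschitz constant of $h$ and $\bar L_h=\max\{L_{\nabla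 h},L_h,1\}$. Let $J(\theta)=\mathbb E[\sum_{t<T}R(s_t,a_t)]$ be the expected cumulative reward under the perturbed actions, $\tilde V_\theta^{(t)}$ the corresponding value functions (with $\tilde V_\theta^{(T)}=0$), and $$\hat D_{PG}(\theta)=\sum_{t=0}^{T-1}\Big(\sum_{i=t}^{T-1}R(s_i,a_i)-\tilde V_\theta^{(t)}(s_t)\Big)\nabla_\theta\log\tilde\pi_\theta(a_t\mid s_t)$$ the estimate of $\nabla_\theta J(\theta)$ from one rollout. The sample complexity $n_X(\epsilon,\delta)$ of a random vector $X$ is the least $n\ge1$ such that the mean of $n$ i.i.d. copies of $X$ has norm $\ge\epsilon$ with probability at most $\delta$ ($+\infty$ if there is none), and $n_{PG}$ is the sample complexity of $\hat D_{PG}(\theta)-\nabla_\theta J(\theta)$. In all cases below $J$ is differentiable at $\theta$. **Theorem 4.** (1) There is an absolute constant $C$ such that the following holds for every such problem in which the coordinates of every $\zeta_t$ are centred and $\sigma_\zeta$-sub-Gaussian, $\sigma_\zeta>0$, with action noise $p_\xi=\mathcal N(0,\sigma_\zeta^2I_{d_A})$. Put $d=\max\{d_S,d_A\}$ and $K=T^6(L_R+L_{\tilde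 R_\theta})\bar L_fL_\pi\bar L_{\tilde f_\theta}^Td^4$. For all $\theta\in\Theta$, $0<\delta<1$ and $0<\epsilon\le K$, $$\sqrt{n_{PG}(\epsilon,\delta)}\le C\,\frac{K}{\epsilon}\,(1+\log T)(1+\log d)^{3/2}(1+\log(1/\delta))^{1/2}.$$ In particular there is no dependence on $\sigma_\zeta$. Any valid upper bounds of the Lipschitz constants may be used in $K$; for $\tilde R_\theta$ and $\tilde f_\theta$, as functions of $s$ and of $(s,\xi)$, at the given $\theta$ only. There is an absolute constant $c>0$ such that for all $T\ge2$ and $L\ge1$ there are a control problem of horizon $T$ with $S=A=\Theta=\mathbb R$ and zero dynamics noise (with time-varying dynamics and rewards), and a parameter $\theta$, such that $\bar L_{f_\theta}=L$ (for $f_\theta(s)$ as a function of $(\theta,s)$), $\bar L_f\le L$, $L_R\le1$, $L_\pi\le1$, and, for this problem and this $\theta$: (2) for every probability density $p_\xi$ on $\mathbb R$ that is everywhere differentiable with $\lim_{\xi\to\pm\infty}\xi\,p_\xi(\xi)=0$, has mean zero, and for which $\mathbb E|\xi|$ and $\mathbb E|\xi\,\nabla\log p_\xi(\xi)|$ are finite,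 the regularity assumptions hold and for all $\epsilon>0$, $0<\delta<1$ $$\sqrt{n_{PG}(\epsilon,\delta)}\ \ge\ \sqrt{n_\xi\big(\epsilon/\bar L_{f_\theta}^{T-2},\delta\big)},$$ where $n_\xi$ is the sample complexity of $\xi\,\nabla\log p_\xi(\xi)-\mathbb E[\xi\,\nabla\log p_\xi(\xi)]$, $\xi\sim p_\xi$; (3) for $p_\xi=\mathcal N(0,\sigma_\xi^2)$ with any $\sigma_\xi>0$, the regularity assumptions hold and for all $0<\epsilon\le\bar L_{f_\theta}^{T-2}$ (so for all $0<\epsilon\le1$) and $0<\delta<1$ $$\sqrt{n_{PG}(\epsilon,\delta)}\ \ge\ c\,\min\Big\{\frac{\bar L_{f_\theta}^{T/2}}{\epsilon^{1/2}},\frac1{\delta^{1/2}}\Big\}.$$ -/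

import Mathlib

open MeasureTheory ProbabilityTheory Filter Topology
open scoped NNReal ENNReal

noncomputable section

/-- `h` is Lipschitz and twice continuously differentiable on `D`, with Lipschitz first
derivative. -/
def SmoothLipschitzOn {X Y : Type*} [NormedAddCommGroup X] [NormedSpace ℝ X]
    [NormedAddCommGroup Y] [NormedSpace ℝ Y] (h : X → Y) (D : Set X) : Prop :=
  (∃ L : ℝ≥0, LipschitzOnWith L h D) ∧ ContDiffOn ℝ 2 h D ∧
    ∃ L : ℝ≥0, LipschitzOnWith L (fderivWithin ℝ h D) D

/-- `L` is an upper bound of `max {L_{∇h}, L_h, 1}`; the least such `L` is that maximum. -/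
def BarLipschitzOn {X Y : Type*} [NormedAddCommGroup X] [NormedSpace ℝ X]
    [NormedAddCommGroup Y] [NormedSpace ℝ Y] (L : ℝ≥0) (h : X → Y) (D : Set X) : Prop :=
  LipschitzOnWith L (fderivWithin ℝ h D) D ∧ LipschitzOnWith L h D ∧ 1 ≤ L

/-- The sample complexity of a random vector `X` on the probability space `(Ω, μ)`: the least
`n ≥ 1` such that the mean of `n` i.i.d. copies of `X` has norm at least `ε` with probability at
most `δ` (and `⊤` if there is no such `n`). -/
def sampleComplexity {Ω E : Type*} [MeasurableSpace Ω] [NormedAddCommGroup E] [NormedSpace ℝ E]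
    (μ : Measure Ω) (X : Ω → E) (ε δ : ℝ) : ℕ∞ :=
  ⨅ n ∈ {n : ℕ | 1 ≤ n ∧ (Measure.pi fun _ : Fin n => μ)
      {x | ε ≤ ‖(n : ℝ)⁻¹ • ∑ i, X (x i)‖} ≤ ENNReal.ofReal δ}, (n : ℕ∞)

/-- Square root of an extended natural number. -/
def sqrtENat (n : ℕ∞) : ℝ≥0∞ := (n : ℝ≥0∞) ^ (1 / 2 : ℝ)

/-- The random vector with law `ν` has `σ`-sub-Gaussian coordinates of mean zero. -/
def IsSubGaussianVector {d : ℕ} (σ : ℝ≥0) (ν : Measure (EuclideanSpace ℝ (Fin d))) : Prop :=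
  ∀ i, ∫ z, z i ∂ν = 0 ∧ HasSubgaussianMGF (fun z => z i) (σ ^ 2) ν

/-- The density of the centred Gaussian with covariance `σ² I` on a Euclidean space. -/
def gaussianDensity (A : Type*) [NormedAddCommGroup A] [InnerProductSpace ℝ A] (σ : ℝ) (ξ : A) :
    ℝ :=
  (2 * Real.pi * σ ^ 2) ^ (-(Module.finrank ℝ A : ℝ) / 2) * Real.exp (-‖ξ‖ ^ 2 / (2 * σ ^ 2))

/-- The law with Lebesgue density `p`. -/
def densityLaw {A : Type*} [MeasureSpace A] (p : A → ℝ) : Measure A :=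
  (volume : Measure A).withDensity fun ξ => ENNReal.ofReal (p ξ)

/-- A finite-horizon control problem `s_{t+1} = f_t(s_t, a_t) + ζ_t`, `ζ_t ∼ noise t`, with rewards
`R_t(s_t, a_t)` and deterministic policies `pol θ`, where `θ` ranges over `params` and states range
over `states`. Dynamics, rewards and noise may vary with time. -/
structure ControlProblem (S A Θ : Type*) [MeasurableSpace S] where
  /-- the horizon -/
  T : ℕ
  /-- the state space -/
  states : Set S
  /-- the parameter space -/
  params : Set Θ
  /-- the deterministic part of the transitions -/
  f : ℕ → S → A → S
  /-- the rewards -/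
  R : ℕ → S → A → ℝ
  /-- the law of the dynamics noise -/
  noise : ℕ → Measure S
  /-- the policy class -/
  pol : Θ → S → A
  /-- the initial state -/
  s₀ : S

namespace ControlProblem

section Basic

variable {S A Θ : Type*} [NormedAddCommGroup S] [InnerProductSpace ℝ S] [MeasurableSpace S]
  [NormedAddCommGroup A] [InnerProductSpace ℝ A] [MeasureSpace A]
  [NormedAddCommGroup Θ] [InnerProductSpace ℝ Θ] (P : ControlProblem S A Θ)

/-- `S × A` (all products carry the Euclidean norm). -/
def stateAction : Set (WithLp 2 (S × A)) := {x | x.fst ∈ P.states}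

/-- `Θ × S`. -/
def paramState : Set (WithLp 2 (Θ × S)) := {x | x.fst ∈ P.params ∧ x.snd ∈ P.states}

/-- `Θ × (S × A)`. -/
def paramStateAction : Set (WithLp 2 (Θ × WithLp 2 (S × A))) :=
  {x | x.fst ∈ P.params ∧ x.snd ∈ P.stateAction}

/-- `f` as a function on `S × A`. -/
def fJoint (t : ℕ) (x : WithLp 2 (S × A)) : S := P.f t x.fst x.snd

/-- `R` as a function on `S × A`. -/
def RJoint (t : ℕ) (x : WithLp 2 (S × A)) : ℝ := P.R t x.fst x.snd

/-- `π` as a function on `Θ × S`. -/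
def polJoint (x : WithLp 2 (Θ × S)) : A := P.pol x.fst x.snd

/-- `f_θ(s) = f(s, π_θ(s))` as a function on `Θ × S`. -/
def fPol (t : ℕ) (x : WithLp 2 (Θ × S)) : S := P.f t x.snd (P.pol x.fst x.snd)

/-- `R_θ(s) = R(s, π_θ(s))` as a function on `Θ × S`. -/
def RPol (t : ℕ) (x : WithLp 2 (Θ × S)) : ℝ := P.R t x.snd (P.pol x.fst x.snd)

/-- `f̃_θ(s, ξ) = f(s, π_θ(s) + ξ)` as a function of `(s, ξ)`. -/
def fTilde (t : ℕ) (θ : Θ) (x : WithLp 2 (S × A)) : S := P.f t x.fst (P.pol θ x.fst + x.snd)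

/-- `R̃_θ(s) = 𝔼[R(s, π_θ(s) + ξ)]`, where `ξ` has density `p`. -/
def RTilde (p : A → ℝ) (t : ℕ) (θ : Θ) (s : S) : ℝ :=
  ∫ ξ, P.R t s (P.pol θ s + ξ) ∂(densityLaw p)

/-- The standing assumptions, for action noise of density `p`: the data are well formed and
`f`, `R`, `π_θ`, `f_θ`, `f̃_θ`, `R_θ`, `R̃_θ` are Lipschitz and `C²` with Lipschitz derivative. -/
structure Regular (p : A → ℝ) : Prop where
  measurableSet_states : MeasurableSet P.states
  uniqueDiff_states : UniqueDiffOn ℝ P.states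
  isOpen_params : IsOpen P.params
  s₀_mem : P.s₀ ∈ P.states
  isProbabilityMeasure_noise : ∀ t < P.T, IsProbabilityMeasure (P.noise t)
  /-- transitions stay in the state space -/
  step_mem : ∀ t < P.T, ∀ s ∈ P.states, ∀ a, ∀ᵐ z ∂(P.noise t), P.f t s a + z ∈ P.states
  measurable_f : ∀ t < P.T, Measurable (Function.uncurry (P.f t))
  measurable_R : ∀ t < P.T, Measurable (Function.uncurry (P.R t))
  measurable_pol : ∀ θ ∈ P.params, Measurable (P.pol θ)
  smooth_f : ∀ t < P.T, SmoothLipschitzOn (P.fJoint t) P.stateAction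
  smooth_R : ∀ t < P.T, SmoothLipschitzOn (P.RJoint t) P.stateAction
  smooth_pol : SmoothLipschitzOn P.polJoint P.paramState
  smooth_fPol : ∀ t < P.T, SmoothLipschitzOn (P.fPol t) P.paramState
  smooth_RPol : ∀ t < P.T, SmoothLipschitzOn (P.RPol t) P.paramState
  smooth_fTilde : ∀ t < P.T,
    SmoothLipschitzOn (fun x : WithLp 2 (Θ × WithLp 2 (S × A)) => P.fTilde t x.fst x.snd)
      P.paramStateAction
  smooth_RTilde : ∀ t < P.T,
    SmoothLipschitzOn (fun x : WithLp 2 (Θ × S) => P.RTilde p t x.fst x.snd) P.paramState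

/-- The noise of one rollout: the pairs `(ξ_t, ζ_t)`, `t < T`. -/
abbrev RolloutNoise : Type _ := Fin P.T → A × S

/-- All `ξ_t`, `ζ_t` are independent, `ξ_t` has density `p` and `ζ_t` has law `noise t`. -/
def rolloutLaw (p : A → ℝ) : Measure P.RolloutNoise :=
  Measure.pi fun t : Fin P.T => (densityLaw p).prod (P.noise t)

/-- The pair `(ξ_t, ζ_t)`, with the value zero after the horizon. -/
def noiseAt (ω : P.RolloutNoise) (t : ℕ) : A × S := if h : t < P.T then ω ⟨t, h⟩ else 0

/-- The state `s_t` of a rollout with actions `a_t = π_θ(s_t) + ξ_t`. -/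
def state (θ : Θ) (ω : P.RolloutNoise) : ℕ → S
  | 0 => P.s₀
  | t + 1 => P.f t (state θ ω t) (P.pol θ (state θ ω t) + (P.noiseAt ω t).1) + (P.noiseAt ω t).2

/-- The action `a_t = π_θ(s_t) + ξ_t` of a rollout. -/
def action (θ : Θ) (ω : P.RolloutNoise) (t : ℕ) : A :=
  P.pol θ (P.state θ ω t) + (P.noiseAt ω t).1

/-- The expected cumulative reward when actions are perturbed by noise of density `p`. -/
def J (p : A → ℝ) (θ : Θ) : ℝ :=
  ∫ ω, ∑ t ∈ Finset.range P.T, P.R t (P.state θ ω t) (P.action θ ω t) ∂(P.rolloutLaw p)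

/-- The one-step look-ahead `R_t(s, a) + 𝔼[V(f_t(s, a) + ζ)]`. -/
def qStep (V : S → ℝ) (t : ℕ) (s : S) (a : A) : ℝ :=
  P.R t s a + ∫ z, V (P.f t s a + z) ∂(P.noise t)

/-- The value of state `s` at time `t` with `k` steps to go, under perturbed actions. -/
def valueToGo (p : A → ℝ) (θ : Θ) : ℕ → ℕ → S → ℝ
  | 0, _, _ => 0
  | k + 1, t, s =>
    ∫ ξ, P.qStep (valueToGo p θ k (t + 1)) t s (P.pol θ s + ξ) ∂(densityLaw p)

/-- The value function `Ṽ_θ^{(t)}`. -/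
def value (p : A → ℝ) (θ : Θ) (t : ℕ) (s : S) : ℝ := P.valueToGo p θ (P.T - t) t s

/-- The single-rollout estimate `Q̂_θ^{(t)} = ∑_{i = t}^{T - 1} R_i(s_i, a_i)`. -/
def qHat (θ : Θ) (ω : P.RolloutNoise) (t : ℕ) : ℝ :=
  ∑ i ∈ Finset.Ico t P.T, P.R i (P.state θ ω i) (P.action θ ω i)

variable [CompleteSpace Θ]

/-- `∇_θ log π̃_θ(a | s)`, where `π̃_θ(a | s) = p(a - π_θ(s))`. -/
def score (p : A → ℝ) (θ : Θ) (s : S) (a : A) : Θ :=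
  gradient (fun θ' => Real.log (p (a - P.pol θ' s))) θ

/-- The policy gradient estimate from a single rollout. -/
def pgEstimate (p : A → ℝ) (θ : Θ) (ω : P.RolloutNoise) : Θ :=
  ∑ t ∈ Finset.range P.T, (P.qHat θ ω t - P.value p θ t (P.state θ ω t)) •
    P.score p θ (P.state θ ω t) (P.action θ ω t)

/-- The sample complexity of the single-rollout error of the policy gradient estimate. -/
def nPG (p : A → ℝ) (θ : Θ) (ε δ : ℝ) : ℕ∞ :=
  sampleComplexity (P.rolloutLaw p) (fun ω => P.pgEstimate p θ ω - gradient (P.J p) θ) ε δ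

end Basic

end ControlProblem

/-- `ξ ∇ log p(ξ)`. -/
def noiseScore (p : ℝ → ℝ) (ξ : ℝ) : ℝ := ξ * deriv (fun x => Real.log (p x)) ξ

/-- The sample complexity of estimating `𝔼[ξ ∇ log p(ξ)]` from samples of the law of density
`p`. -/
def nNoise (p : ℝ → ℝ) (ε δ : ℝ) : ℕ∞ :=
  sampleComplexity (densityLaw p) (fun ξ => noiseScore p ξ - ∫ x, noiseScore p x ∂(densityLaw p))
    ε δ

end

/-!
**Upper bound.** Subtracting the value function from the rewards to go leaves a telescoping sum
(`qHat_sub_value`): the estimate is `∑_{t ≤ i} g_i S_t`, where `g_i` is the temporal-difference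
error of step `i` and `S_t` the score of step `t`. Given the state, `g_i` is centred, and it is
Lipschitz in the noise `(ξ_i, ζ_i)` with constant `tdBound`, of order `T (L_R + L_R̃) L_f̃ ^ T`
(`abs_tdError_le`): the policy Lipschitz constant does not enter the recursion for the values,
because `R̃_θ` and `f̃_θ` already contain the policy. Hence `|g_i|` is at most
`tdBound · (‖ξ_i‖ + ‖ζ_i‖ + O(σ √d))`, while the Gaussian score is at most `L_π ‖ξ_t‖ / σ²`. The
estimate is thus bounded by a quadratic form in the noise divided by `σ²`; both noises have scale
`σ`, so `σ` cancels, and the estimate is sub-exponential of size `M` of order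
`T² d L_π · tdBound ≤ K` (`integral_exp_norm_pgEstimate_le`). Bernstein's inequality in a Hilbert
space, in the form of Pinelis (`sampleComplexity_le_of_integral_exp_norm_le`), has no dependence
on `d_Θ` and gives a sample size of order `(M / ε)² log (2 / δ)`.

That the centring is the gradient of `J` is proved without differentiating under any integral. The
performance difference `J θ' - J θ` is the expected sum of the temporal-difference errors of `θ`
along a rollout of `θ'` (`J_sub_J`). Averaged over its own noise, such an error is a Gaussian
smoothing of the advantage at the shift `π_θ'(s) - π_θ(s)`, which has a second-order expansion
uniformly in `s` (`abs_integral_add_sub_inner_le`); its linear term is Lipschitz in `s`, and the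
states of the two rollouts differ by `O(‖θ' - θ‖)`. So `J` is differentiable with gradient
`policyGrad` (`hasGradientAt_J`), and this is also the mean of the estimate, in which the terms
with `i > t` vanish (`integral_pgEstimate`).

**Lower bounds.** In `chainProblem` the first action is multiplied by `L` in each of the `T - 1`
transitions, and the last state is the reward. All temporal-difference errors but the first vanish,
and the estimate is `-L ^ (T - 1) ξ₀ (log p)'(ξ₀)`. Hence `n_PG(ε) = n_ξ(ε / L ^ (T - 1))`
(`chainProblem.nPG_eq`), which is one factor of `L` better than required. The mean of `ξ (log p)'`
is `-1` by parts. For Gaussian noise the centred noise score is `1 - ξ² / σ²`; the first two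
moments of `exp (S / √n)`, with `S` a sum of `n` copies, show that `|S| ≥ √n / 6` with probability
bounded below (`le_measureReal_gaussian_noiseScore`). So a sample size `n` is inadmissible unless
`n ≥ c / η²` with `η = ε / L ^ (T - 1)` or `δ` exceeds a constant. The range of `ε` says
`1 / η ≥ L`, so that `1 / η² ≥ L ^ T / ε`.
-/

/-! ### Concentration of sums of independent vectors in a Hilbert space -/

/-- `cosh √·` has a power series with nonnegative coefficients, hence is convex on `[0, ∞)`; `h ^ 2`
is a convex combination of `(a + b) ^ 2` and `(a - b) ^ 2`. -/
theorem cosh_sqrt_convex {a b c : ℝ} (hc : |c| ≤ 1) (h : ℝ)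
    (hh : h ^ 2 = a ^ 2 + b ^ 2 + 2 * a * b * c) :
    Real.cosh h ≤ Real.cosh a * Real.cosh b + c * (Real.sinh a * Real.sinh b) := by
  obtain ⟨hc1, hc2⟩ := abs_le.1 hc
  have key : Real.cosh h ≤
      (1 + c) / 2 * Real.cosh (a + b) + (1 - c) / 2 * Real.cosh (a - b) := by
    refine hasSum_le (fun n => ?_) (Real.hasSum_cosh h)
      (((Real.hasSum_cosh (a + b)).mul_left ((1 + c) / 2)).add
        ((Real.hasSum_cosh (a - b)).mul_left ((1 - c) / 2)))
    have w1 : 0 ≤ (1 + c) / 2 := by linarith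
    have w2 : 0 ≤ (1 - c) / 2 := by linarith
    have hp := (convexOn_pow (𝕜 := ℝ) n).2 (Set.mem_Ici.2 (sq_nonneg (a + b)))
      (Set.mem_Ici.2 (sq_nonneg (a - b))) w1 w2 (by ring)
    have e : (1 + c) / 2 * (a + b) ^ 2 + (1 - c) / 2 * (a - b) ^ 2 = h ^ 2 := by
      rw [hh]; ring
    simp only [smul_eq_mul] at hp
    rw [e] at hp
    rw [pow_mul, pow_mul, pow_mul, mul_div_assoc', mul_div_assoc', ← add_div]
    gcongr
  rw [Real.cosh_add, Real.cosh_sub] at key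
  linarith

section Hilbert

variable {H : Type*} [NormedAddCommGroup H] [InnerProductSpace ℝ H]

/-- The comparison of a Euclidean triangle with the hyperbolic triangle having the same angle and
adjacent sides: the third side of the Euclidean one is the shorter. -/
theorem cosh_norm_add_le (x y : H) :
    Real.cosh ‖x + y‖ ≤ Real.cosh ‖x‖ * Real.cosh ‖y‖ +
      inner ℝ x y / (‖x‖ * ‖y‖) * (Real.sinh ‖x‖ * Real.sinh ‖y‖) := by
  refine cosh_sqrt_convex (abs_real_inner_div_norm_mul_norm_le_one x y) _ ?_
  rw [norm_add_sq_real]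
  rcases eq_or_ne x 0 with rfl | hx
  · simp
  rcases eq_or_ne y 0 with rfl | hy
  · simp
  have := norm_pos_iff.2 hx
  have := norm_pos_iff.2 hy
  field_simp
  ring

/-- A form of `cosh_norm_add_le` whose second term is linear in `y`, so that it averages to zero
over a centred `y`. -/
theorem cosh_norm_add_le_linear (x y : H) :
    Real.cosh ‖x + y‖ ≤ Real.cosh ‖x‖ * (Real.exp ‖y‖ - ‖y‖) +
      inner ℝ x y * (Real.sinh ‖x‖ / ‖x‖) := by
  have h := cosh_norm_add_le x y
  rcases eq_or_ne x 0 with rfl | hx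
  · have h1 : Real.cosh ‖y‖ + Real.sinh ‖y‖ = Real.exp ‖y‖ := Real.cosh_add_sinh _
    have h2 := Real.self_le_sinh_iff.2 (norm_nonneg y)
    simp; linarith
  rcases eq_or_ne y 0 with rfl | hy
  · simp
  have px := norm_pos_iff.2 hx
  have py := norm_pos_iff.2 hy
  have h1 : Real.cosh ‖y‖ + Real.sinh ‖y‖ = Real.exp ‖y‖ := Real.cosh_add_sinh _
  have h2 := Real.self_le_sinh_iff.2 (norm_nonneg y)
  have h3 : Real.sinh ‖x‖ ≤ Real.cosh ‖x‖ := (Real.sinh_lt_cosh _).le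
  have h4 : 0 ≤ Real.sinh ‖x‖ := Real.sinh_nonneg_iff.2 px.le
  have h5 := real_inner_le_norm x y
  have e : inner ℝ x y / (‖x‖ * ‖y‖) * (Real.sinh ‖x‖ * Real.sinh ‖y‖) =
      inner ℝ x y * (Real.sinh ‖x‖ / ‖x‖) +
        inner ℝ x y / (‖x‖ * ‖y‖) * (Real.sinh ‖x‖ * (Real.sinh ‖y‖ - ‖y‖)) := by
    field_simp; ring
  have h6 : inner ℝ x y / (‖x‖ * ‖y‖) ≤ 1 := (div_le_one (by positivity)).2 h5
  have h7 : 0 ≤ Real.sinh ‖x‖ * (Real.sinh ‖y‖ - ‖y‖) := mul_nonneg h4 (by linarith)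
  have h8 := mul_le_mul_of_nonneg_right h6 h7
  have h9 := mul_le_mul_of_nonneg_right h3 (sub_nonneg.2 h2)
  rw [← h1]
  nlinarith

end Hilbert

section Concentration

variable {H : Type*} [NormedAddCommGroup H] {Ω : Type*} [MeasurableSpace Ω] {μ : Measure Ω}

theorem integrable_of_integrable_exp_norm {X : Ω → H} (hX : AEStronglyMeasurable X μ) {M : ℝ}
    (hM : 0 < M) (he : Integrable (fun ω => Real.exp (‖X ω‖ / M)) μ) : Integrable X μ :=
  (he.const_mul M).mono' hX (ae_of_all _ fun ω => by
    have := Real.add_one_le_exp (‖X ω‖ / M)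
    have h2 : ‖X ω‖ = M * (‖X ω‖ / M) := by field_simp
    nlinarith)

/-- For `u ≥ 0` and `0 ≤ r ≤ 1`, all Taylor terms of `exp (r u)` of order at least two gain the
factor `r ^ 2`. -/
theorem exp_mul_sub_le {r u : ℝ} (hr0 : 0 ≤ r) (hr : r ≤ 1) (hu : 0 ≤ u) :
    Real.exp (r * u) - r * u ≤ 1 + r ^ 2 * Real.exp u := by
  have hs : ∀ v : ℝ, HasSum (fun n : ℕ => v ^ n / n.factorial) (Real.exp v) := fun v => by
    rw [Real.exp_eq_exp_ℝ]; exact NormedSpace.expSeries_div_hasSum_exp v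
  have h1 := (hasSum_nat_add_iff' 2).2 (hs (r * u))
  have h2 := ((hasSum_nat_add_iff' 2).2 (hs u)).mul_left (r ^ 2)
  have h3 := hasSum_le (fun n => ?_) h1 h2
  · simp [Finset.sum_range_succ] at h3
    nlinarith [sq_nonneg r]
  · rw [mul_pow, mul_div_assoc]
    have : r ^ (n + 2) ≤ r ^ 2 := pow_le_pow_of_le_one hr0 hr (by omega)
    gcongr

/-- One step of Pinelis' argument: adding an independent centred vector `Y` multiplies the
expectation of `cosh ‖·‖` at most by `𝔼[exp ‖Y‖ - ‖Y‖]`. -/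
theorem lintegral_cosh_norm_add_le [InnerProductSpace ℝ H] [CompleteSpace H] {Y : Ω → H}
    (hY : Integrable Y μ) (h0 : ∫ ω, Y ω ∂μ = 0)
    (he : Integrable (fun ω => Real.exp ‖Y ω‖) μ) (x : H) :
    ∫⁻ ω, ENNReal.ofReal (Real.cosh ‖x + Y ω‖) ∂μ ≤
      ENNReal.ofReal (Real.cosh ‖x‖) *
        ENNReal.ofReal (∫ ω, (Real.exp ‖Y ω‖ - ‖Y ω‖) ∂μ) := by
  have i1 : Integrable (fun ω => Real.cosh ‖x‖ * (Real.exp ‖Y ω‖ - ‖Y ω‖)) μ :=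
    (he.sub hY.norm).const_mul _
  have i2 : Integrable (fun ω => inner ℝ x (Y ω) * (Real.sinh ‖x‖ / ‖x‖)) μ :=
    (hY.const_inner x).mul_const _
  have hle : ∀ ω, Real.cosh ‖x + Y ω‖ ≤ Real.cosh ‖x‖ * (Real.exp ‖Y ω‖ - ‖Y ω‖) +
      inner ℝ x (Y ω) * (Real.sinh ‖x‖ / ‖x‖) := fun ω => cosh_norm_add_le_linear _ _
  calc ∫⁻ ω, ENNReal.ofReal (Real.cosh ‖x + Y ω‖) ∂μ
      ≤ ∫⁻ ω, ENNReal.ofReal (Real.cosh ‖x‖ * (Real.exp ‖Y ω‖ - ‖Y ω‖) +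
          inner ℝ x (Y ω) * (Real.sinh ‖x‖ / ‖x‖)) ∂μ :=
        lintegral_mono fun ω => ENNReal.ofReal_le_ofReal (hle ω)
    _ = ENNReal.ofReal (∫ ω, (Real.cosh ‖x‖ * (Real.exp ‖Y ω‖ - ‖Y ω‖) +
          inner ℝ x (Y ω) * (Real.sinh ‖x‖ / ‖x‖)) ∂μ) :=
        (ofReal_integral_eq_lintegral_ofReal (i1.add i2)
          (ae_of_all _ fun ω => (Real.cosh_pos _).le.trans (hle ω))).symm
    _ = _ := by
        rw [integral_add i1 i2, integral_mul_const, integral_inner hY, h0, inner_zero_right,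
          zero_mul, add_zero, integral_const_mul, ENNReal.ofReal_mul (Real.cosh_pos _).le]

theorem lintegral_cosh_norm_sum_le [IsProbabilityMeasure μ] [InnerProductSpace ℝ H]
    [CompleteSpace H] [MeasurableSpace H] [BorelSpace H] [SecondCountableTopology H] {Y : Ω → H}
    (hY : Integrable Y μ) (h0 : ∫ ω, Y ω ∂μ = 0)
    (he : Integrable (fun ω => Real.exp ‖Y ω‖) μ) (n : ℕ) :
    ∫⁻ x, ENNReal.ofReal (Real.cosh ‖∑ i, Y (x i)‖) ∂(Measure.pi fun _ : Fin n => μ) ≤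
        ENNReal.ofReal (∫ ω, (Real.exp ‖Y ω‖ - ‖Y ω‖) ∂μ) ^ n := by
  induction n with
  | zero => simp
  | succ n ih =>
    have hmp := (measurePreserving_piFinSuccAbove (fun _ : Fin (n + 1) => μ) 0).symm
    have hmeas : ∀ m : ℕ, AEMeasurable (fun x : Fin m → Ω => ∑ i, Y (x i))
        (Measure.pi fun _ : Fin m => μ) := fun m => by
      have := Finset.aemeasurable_sum (μ := Measure.pi fun _ : Fin m => μ) Finset.univ
        (f := fun i (x : Fin m → Ω) => Y (x i)) fun i _ =>
          hY.1.aemeasurable.comp_quasiMeasurePreserving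
            (measurePreserving_eval (fun _ : Fin m => μ) i).quasiMeasurePreserving
      convert this using 1
      ext x; simp
    have hm2 : ∀ m : ℕ, AEMeasurable (fun x : Fin m → Ω =>
        ENNReal.ofReal (Real.cosh ‖∑ i, Y (x i)‖)) (Measure.pi fun _ : Fin m => μ) := fun m =>
      ((Real.continuous_cosh.measurable.comp measurable_norm).ennreal_ofReal).comp_aemeasurable
        (hmeas m)
    rw [← hmp.lintegral_comp_emb (MeasurableEquiv.measurableEmbedding _)]
    rw [lintegral_prod_symm]
    · simp only [MeasurableEquiv.piFinSuccAbove_symm_apply, Fin.sum_univ_succ,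
        Fin.insertNthEquiv_zero, Fin.consEquiv_apply, Fin.cons_zero, Fin.cons_succ]
      calc _ ≤ ∫⁻ x, ENNReal.ofReal (Real.cosh ‖∑ i, Y (x i)‖) *
            ENNReal.ofReal (∫ ω, (Real.exp ‖Y ω‖ - ‖Y ω‖) ∂μ) ∂(Measure.pi fun _ : Fin n => μ) := by
            refine lintegral_mono fun x => ?_
            have := lintegral_cosh_norm_add_le hY h0 he (∑ i, Y (x i))
            simpa only [add_comm] using this
        _ ≤ _ := by
            rw [lintegral_mul_const'' _ (hm2 n), pow_succ]
            gcongr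
    · exact (hm2 (n + 1)).comp_quasiMeasurePreserving hmp.quasiMeasurePreserving

/-- Bernstein's inequality in a Hilbert space, as a bound of the sample complexity: there is no
dependence on the dimension. -/
theorem sampleComplexity_le_of_integral_exp_norm_le [IsProbabilityMeasure μ]
    [InnerProductSpace ℝ H] [CompleteSpace H] [MeasurableSpace H] [BorelSpace H]
    [SecondCountableTopology H] {X : Ω → H} (hX : AEStronglyMeasurable X μ)
    (h0 : ∫ ω, X ω ∂μ = 0) {M A : ℝ} (hM : 0 < M)
    (he : Integrable (fun ω => Real.exp (‖X ω‖ / M)) μ)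
    (hA : ∫ ω, Real.exp (‖X ω‖ / M) ∂μ ≤ A) {ε δ : ℝ} (hε : 0 < ε) (hεA : ε ≤ 2 * A * M)
    (hδ : 0 < δ) {n : ℕ} (hn1 : 1 ≤ n) (hn : 4 * A * M ^ 2 / ε ^ 2 * Real.log (2 / δ) ≤ n) :
    sampleComplexity μ X ε δ ≤ n := by
  have hA0 : 0 < A := by
    by_contra h
    nlinarith [mul_nonneg hM.le (neg_nonneg.2 (not_lt.1 h))]
  -- `l` minimizes `n A M ^ 2 l ^ 2 - n ε l`
  set l : ℝ := ε / (2 * A * M ^ 2) with hl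
  have hl0 : 0 < l := by positivity
  have hr1 : l * M ≤ 1 := by
    rw [hl, div_mul_eq_mul_div, div_le_one (by positivity)]; nlinarith
  have hXi := integrable_of_integrable_exp_norm hX hM he
  have hnorm : ∀ ω, ‖l • X ω‖ = l * M * (‖X ω‖ / M) := fun ω => by
    rw [norm_smul, Real.norm_of_nonneg hl0.le]; field_simp
  have hu : ∀ ω, 0 ≤ ‖X ω‖ / M := fun ω => by positivity
  have hYe : Integrable (fun ω => Real.exp ‖l • X ω‖) μ := by
    refine he.mono' (Real.continuous_exp.comp_aestronglyMeasurable
      (hX.const_smul l).norm) (ae_of_all _ fun ω => ?_)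
    rw [hnorm, Real.norm_of_nonneg (Real.exp_pos _).le]
    exact Real.exp_le_exp.2 (mul_le_of_le_one_left (hu ω) hr1)
  have hκ : ∫ ω, (Real.exp ‖l • X ω‖ - ‖l • X ω‖) ∂μ ≤ Real.exp ((l * M) ^ 2 * A) := by
    calc ∫ ω, (Real.exp ‖l • X ω‖ - ‖l • X ω‖) ∂μ
        ≤ ∫ ω, (1 + (l * M) ^ 2 * Real.exp (‖X ω‖ / M)) ∂μ := by
          refine integral_mono (hYe.sub (hXi.smul l).norm)
            ((integrable_const _).add (he.const_mul _)) fun ω => ?_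
          simp only [hnorm]
          exact exp_mul_sub_le (by positivity) hr1 (hu ω)
      _ ≤ 1 + (l * M) ^ 2 * A := by
          rw [integral_add (integrable_const _) (he.const_mul _), integral_const_mul]
          simp only [integral_const, probReal_univ, smul_eq_mul, mul_one]
          gcongr
      _ ≤ _ := by rw [add_comm]; exact Real.add_one_le_exp _
  have hY0 : ∫ ω, l • X ω ∂μ = 0 := by rw [integral_smul, h0, smul_zero]
  have hsum := lintegral_cosh_norm_sum_le (hXi.smul l) hY0 hYe n
  have hn0 : (0 : ℝ) < n := by exact_mod_cast hn1
  refine iInf₂_le n ⟨hn1, ?_⟩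
  have hmeas : AEMeasurable (fun x : Fin n → Ω =>
      ENNReal.ofReal (Real.cosh ‖∑ i, l • X (x i)‖)) (Measure.pi fun _ : Fin n => μ) := by
    have := Finset.aemeasurable_sum (μ := Measure.pi fun _ : Fin n => μ) Finset.univ
      (f := fun i (x : Fin n → Ω) => l • X (x i)) fun i _ =>
        (hX.const_smul l).aemeasurable.comp_quasiMeasurePreserving
          (measurePreserving_eval (fun _ : Fin n => μ) i).quasiMeasurePreserving
    refine ((Real.continuous_cosh.measurable.comp measurable_norm).ennreal_ofReal).comp_aemeasurable
      (?_ : AEMeasurable (fun x : Fin n → Ω => ∑ i, l • X (x i)) _)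
    convert this using 1
    ext x; simp
  have hmk := meas_ge_le_lintegral_div hmeas (ε := ENNReal.ofReal (Real.cosh (n * l * ε)))
    (by simpa using Real.cosh_pos _) ENNReal.ofReal_ne_top
  refine (measure_mono fun x hx => ?_).trans (hmk.trans ?_)
  · simp only [Set.mem_ofPred_eq] at hx ⊢
    refine ENNReal.ofReal_le_ofReal (Real.cosh_le_cosh.2 ?_)
    rw [abs_of_nonneg (by positivity), abs_of_nonneg (norm_nonneg _), ← Finset.smul_sum, norm_smul,
      Real.norm_of_nonneg hl0.le]
    rw [norm_smul, norm_inv, Real.norm_of_nonneg hn0.le, le_inv_mul_iff₀ hn0] at hx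
    nlinarith
  · refine ENNReal.div_le_of_le_mul (hsum.trans ?_)
    rw [← ENNReal.ofReal_mul hδ.le]
    refine (pow_le_pow_left' (ENNReal.ofReal_le_ofReal hκ) n).trans ?_
    rw [← ENNReal.ofReal_pow (Real.exp_pos _).le, ← Real.exp_nat_mul]
    refine ENNReal.ofReal_le_ofReal ?_
    have h1 : Real.exp (n * l * ε) / 2 ≤ Real.cosh (n * l * ε) := by
      rw [Real.cosh_eq]; have := Real.exp_pos (-(n * l * ε)); linarith
    have h2 : Real.log (2 / δ) + n * ((l * M) ^ 2 * A) ≤ n * l * ε := by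
      have e1 : n * l * ε - n * ((l * M) ^ 2 * A) = n * (ε ^ 2 / (4 * A * M ^ 2)) := by
        rw [hl]; field_simp; ring
      have e2 : 4 * A * M ^ 2 / ε ^ 2 * Real.log (2 / δ) * (ε ^ 2 / (4 * A * M ^ 2)) =
          Real.log (2 / δ) := by field_simp
      have := mul_le_mul_of_nonneg_right hn
        (by positivity : (0 : ℝ) ≤ ε ^ 2 / (4 * A * M ^ 2))
      rw [e2] at this
      linarith
    have h3 := Real.exp_le_exp.2 h2
    rw [Real.exp_add, Real.exp_log (by positivity)] at h3
    have h4 : δ * (2 / δ * Real.exp (n * ((l * M) ^ 2 * A))) =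
      2 * Real.exp (n * ((l * M) ^ 2 * A)) := by field_simp
    nlinarith [mul_le_mul_of_nonneg_left h3 hδ.le, mul_le_mul_of_nonneg_left h1 hδ.le]

end Concentration

/-! ### Measures with sub-Gaussian norm -/

/-- The norm has `ψ₂`-size at most `τ` under the probability measure `ν`:
`𝔼[exp (‖x‖² / τ²)] ≤ 2`. -/
structure HasSubgaussianNorm {V : Type*} [NormedAddCommGroup V] [MeasurableSpace V] (τ : ℝ)
    (ν : Measure V) : Prop where
  isProbabilityMeasure : IsProbabilityMeasure ν
  pos : 0 < τ
  integrable_exp_sq : Integrable (fun x => Real.exp (‖x‖ ^ 2 / τ ^ 2)) ν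
  integral_exp_sq_le : ∫ x, Real.exp (‖x‖ ^ 2 / τ ^ 2) ∂ν ≤ 2

namespace HasSubgaussianNorm

variable {V : Type*} [NormedAddCommGroup V] [MeasurableSpace V] {τ : ℝ} {ν : Measure V}

theorem of_lintegral_le [OpensMeasurableSpace V] (hν : IsProbabilityMeasure ν) (hτ : 0 < τ)
    (h : ∫⁻ x, ENNReal.ofReal (Real.exp (‖x‖ ^ 2 / τ ^ 2)) ∂ν ≤ 2) :
    HasSubgaussianNorm τ ν := by
  have hm : AEStronglyMeasurable (fun x : V => Real.exp (‖x‖ ^ 2 / τ ^ 2)) ν :=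
    (Real.measurable_exp.comp ((measurable_norm.pow_const 2).div_const _)).aestronglyMeasurable
  have h0 : 0 ≤ᵐ[ν] fun x : V => Real.exp (‖x‖ ^ 2 / τ ^ 2) :=
    ae_of_all _ fun x => (Real.exp_pos _).le
  have hi : Integrable (fun x : V => Real.exp (‖x‖ ^ 2 / τ ^ 2)) ν :=
    ⟨hm, (hasFiniteIntegral_iff_ofReal h0).2 (h.trans_lt (by norm_num))⟩
  refine ⟨hν, hτ, hi, ?_⟩
  rw [integral_eq_lintegral_of_nonneg_ae h0 hm]
  exact ENNReal.toReal_le_of_le_ofReal (by norm_num) (by simpa using h)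

theorem integrable_exp_mul_norm [OpensMeasurableSpace V] (h : HasSubgaussianNorm τ ν) (c : ℝ) :
    Integrable (fun x => Real.exp (c * ‖x‖)) ν := by
  have hτ := h.pos
  refine (h.integrable_exp_sq.const_mul (Real.exp ((c * τ) ^ 2 / 4))).mono'
    (Real.measurable_exp.comp (measurable_norm.const_mul _)).aestronglyMeasurable
    (ae_of_all _ fun x => ?_)
  rw [Real.norm_of_nonneg (Real.exp_pos _).le, ← Real.exp_add]
  refine Real.exp_le_exp.2 ?_
  have : c * ‖x‖ = (c * τ) * (‖x‖ / τ) := by field_simp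
  rw [this, ← div_pow]
  nlinarith [sq_nonneg (c * τ / 2 - ‖x‖ / τ)]

theorem integrable_pow_mul_exp [OpensMeasurableSpace V] (h : HasSubgaussianNorm τ ν) (k : ℕ)
    (c : ℝ) : Integrable (fun x => ‖x‖ ^ k * Real.exp (c * ‖x‖)) ν := by
  refine ((h.integrable_exp_mul_norm (c + 1)).const_mul k.factorial).mono'
    ((measurable_norm.pow_const k).mul
      (Real.measurable_exp.comp (measurable_norm.const_mul _))).aestronglyMeasurable
    (ae_of_all _ fun x => ?_)
  rw [Real.norm_of_nonneg (by positivity), add_mul, Real.exp_add, one_mul]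
  have := Real.pow_div_factorial_le_exp ‖x‖ (norm_nonneg x) k
  rw [div_le_iff₀ (by positivity)] at this
  nlinarith [mul_le_mul_of_nonneg_right this (Real.exp_pos (c * ‖x‖)).le]

theorem integrable_norm_pow [OpensMeasurableSpace V] (h : HasSubgaussianNorm τ ν) (k : ℕ) :
    Integrable (fun x => ‖x‖ ^ k) ν := by
  simpa using h.integrable_pow_mul_exp k 0

theorem integrable_norm [OpensMeasurableSpace V] (h : HasSubgaussianNorm τ ν) :
    Integrable (fun x => ‖x‖) ν := by
  simpa using h.integrable_norm_pow 1

theorem integral_norm_le [OpensMeasurableSpace V] (h : HasSubgaussianNorm τ ν) :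
    ∫ x, ‖x‖ ∂ν ≤ τ := by
  have hτ := h.pos
  calc ∫ x, ‖x‖ ∂ν ≤ ∫ x, τ / 2 * Real.exp (‖x‖ ^ 2 / τ ^ 2) ∂ν := by
        refine integral_mono h.integrable_norm (h.integrable_exp_sq.const_mul _) fun x => ?_
        have h1 := Real.add_one_le_exp (‖x‖ ^ 2 / τ ^ 2)
        have h2 : ‖x‖ = τ * (‖x‖ / τ) := by field_simp
        rw [← div_pow] at h1 ⊢
        change ‖x‖ ≤ τ / 2 * Real.exp ((‖x‖ / τ) ^ 2)
        nlinarith [sq_nonneg (‖x‖ / τ - 1)]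
    _ ≤ _ := by
        rw [integral_const_mul]
        nlinarith [h.integral_exp_sq_le]

/-- A `B`-Lipschitz function deviates from its mean by at most `B (‖u‖ + τ)`, because the mean
distance from `u` is at most `‖u‖ + τ`. -/
theorem abs_sub_integral_le [OpensMeasurableSpace V] (h : HasSubgaussianNorm τ ν) {q : V → ℝ}
    {B : ℝ} (hB : 0 ≤ B) {u : V} (hq : Integrable q ν)
    (hL : ∀ᵐ v ∂ν, |q u - q v| ≤ B * ‖u - v‖) :
    |q u - ∫ v, q v ∂ν| ≤ B * (‖u‖ + τ) := by
  have := h.isProbabilityMeasure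
  have e : q u - ∫ v, q v ∂ν = ∫ v, (q u - q v) ∂ν := by
    rw [integral_sub (integrable_const _) hq]; simp
  rw [e]
  calc |∫ v, (q u - q v) ∂ν| ≤ ∫ v, |q u - q v| ∂ν := abs_integral_le_integral_abs
    _ ≤ ∫ v, B * (‖u‖ + ‖v‖) ∂ν := by
        refine integral_mono_ae ((integrable_const _).sub hq).abs
          (((integrable_const _).add h.integrable_norm).const_mul _) ?_
        filter_upwards [hL] with v hv
        exact hv.trans (by gcongr; exact norm_sub_le _ _)
    _ ≤ _ := by
        rw [integral_const_mul, integral_add (integrable_const _) h.integrable_norm]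
        simp only [integral_const, probReal_univ, one_smul]
        gcongr
        exact h.integral_norm_le

end HasSubgaussianNorm

/-- The Hubbard-Stratonovich transform: `exp (x² / (4 σ²))` is a Gaussian average of
exponentials of multiples of `x`, to which the bound of the moment generating function applies. -/
theorem lintegral_exp_sq_le_of_hasSubgaussianMGF {Ω : Type*} [MeasurableSpace Ω] {ν : Measure Ω}
    [IsProbabilityMeasure ν] {X : Ω → ℝ} {σ : ℝ≥0} (hσ : 0 < σ)
    (h : HasSubgaussianMGF X (σ ^ 2) ν) :
    ∫⁻ ω, ENNReal.ofReal (Real.exp (X ω ^ 2 / (4 * σ ^ 2))) ∂ν ≤ 2 := by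
  have hσ' : (0 : ℝ) < σ := hσ
  set s : ℝ := 1 / (√2 * σ) with hs
  have hs2 : s ^ 2 = 1 / (2 * σ ^ 2) := by
    rw [hs, div_pow, mul_pow, Real.sq_sqrt (by norm_num)]; simp
  have hg : ∀ r : ℝ, ∫⁻ g, ENNReal.ofReal (Real.exp (r * g)) ∂(gaussianReal 0 1) =
      ENNReal.ofReal (Real.exp (r ^ 2 / 2)) := fun r => by
    rw [← ofReal_integral_eq_lintegral_ofReal (integrable_exp_mul_gaussianReal r)
      (ae_of_all _ fun _ => (Real.exp_pos _).le)]
    have := congrFun (mgf_id_gaussianReal (μ := 0) (v := 1)) r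
    simp only [mgf, id] at this
    rw [this]; simp
  calc ∫⁻ ω, ENNReal.ofReal (Real.exp (X ω ^ 2 / (4 * σ ^ 2))) ∂ν
      = ∫⁻ ω, ∫⁻ g, ENNReal.ofReal (Real.exp (s * X ω * g)) ∂(gaussianReal 0 1) ∂ν := by
        refine lintegral_congr fun ω => ?_
        rw [hg, mul_pow, hs2]
        congr 2; field_simp; norm_num
    _ = ∫⁻ g, ∫⁻ ω, ENNReal.ofReal (Real.exp (s * X ω * g)) ∂ν ∂(gaussianReal 0 1) := by
        refine lintegral_lintegral_swap ?_
        refine (Real.measurable_exp.comp_aemeasurable ?_).ennreal_ofReal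
        exact ((h.aemeasurable.comp_fst).const_mul s).mul measurable_snd.aemeasurable
    _ ≤ ∫⁻ g, ENNReal.ofReal (Real.exp (g ^ 2 / 4)) ∂(gaussianReal 0 1) := by
        refine lintegral_mono fun g => ?_
        have e : ∀ ω, s * X ω * g = (s * g) * X ω := fun ω => by ring
        simp only [e]
        rw [← ofReal_integral_eq_lintegral_ofReal (h.integrable_exp_mul _)
          (ae_of_all _ fun _ => (Real.exp_pos _).le)]
        refine ENNReal.ofReal_le_ofReal ((h.mgf_le (s * g)).trans (Real.exp_le_exp.2 ?_))
        push_cast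
        rw [mul_pow, hs2]
        apply le_of_eq; field_simp; norm_num; ring
    _ = ENNReal.ofReal √2 := by
        rw [gaussianReal_of_var_ne_zero _ one_ne_zero,
          lintegral_withDensity_eq_lintegral_mul _ (measurable_gaussianPDF 0 1) (by fun_prop)]
        have e : ∀ g : ℝ, (gaussianPDF 0 1 * fun g => ENNReal.ofReal (Real.exp (g ^ 2 / 4))) g =
            ENNReal.ofReal ((√(2 * Real.pi))⁻¹ * Real.exp (-(1 / 4) * g ^ 2)) := fun g => by
          rw [Pi.mul_apply, gaussianPDF, ← ENNReal.ofReal_mul (gaussianPDFReal_nonneg _ _ _),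
            gaussianPDFReal, mul_assoc, ← Real.exp_add]
          simp only [NNReal.coe_one, mul_one, sub_zero]
          congr 3; ring
        rw [lintegral_congr e, ← ofReal_integral_eq_lintegral_ofReal
          ((integrable_exp_neg_mul_sq (by norm_num)).const_mul _)
          (ae_of_all _ fun _ => by positivity), integral_const_mul, integral_gaussian]
        congr 1
        rw [inv_mul_eq_div, ← Real.sqrt_div (by positivity)]
        congr 1; field_simp; norm_num
    _ ≤ 2 := by
        rw [← ENNReal.ofReal_ofNat 2]
        exact ENNReal.ofReal_le_ofReal (by
          rw [Real.sqrt_le_left (by norm_num)]; norm_num)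

/-- A random vector in dimension at most `d` with `σ`-sub-Gaussian coordinates has norm of size
`2 σ √d`. -/
theorem IsSubGaussianVector.hasSubgaussianNorm {n d : ℕ} (hd : 1 ≤ d) (hnd : n ≤ d) {σ : ℝ≥0}
    (hσ : 0 < σ) {ν : Measure (EuclideanSpace ℝ (Fin n))} (hν : IsProbabilityMeasure ν)
    (h : IsSubGaussianVector σ ν) : HasSubgaussianNorm (2 * σ * √d) ν := by
  have hd' : (0 : ℝ) < d := by exact_mod_cast hd
  have hσ' : (0 : ℝ) < σ := hσ
  refine .of_lintegral_le hν (by positivity) ?_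
  rcases Nat.eq_zero_or_pos n with rfl | hn
  · have : ∀ x : EuclideanSpace ℝ (Fin 0), ‖x‖ = 0 := fun x => by
      rw [Subsingleton.elim x 0, norm_zero]
    simp [this]
  have hn' : (0 : ℝ) < n := by exact_mod_cast hn
  calc ∫⁻ x, ENNReal.ofReal (Real.exp (‖x‖ ^ 2 / (2 * σ * √d) ^ 2)) ∂ν
      ≤ ∫⁻ x, ∑ i : Fin n, ENNReal.ofReal (1 / n) *
          ENNReal.ofReal (Real.exp (x i ^ 2 / (4 * σ ^ 2))) ∂ν := by
        refine lintegral_mono fun x => ?_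
        simp only [← ENNReal.ofReal_mul (by positivity : (0 : ℝ) ≤ 1 / n)]
        rw [← ENNReal.ofReal_sum_of_nonneg fun i _ => by positivity]
        refine ENNReal.ofReal_le_ofReal ?_
        have hj := convexOn_exp.map_sum_le (t := Finset.univ) (w := fun _ : Fin n => (1 / n : ℝ))
          (p := fun i => x i ^ 2 / (4 * σ ^ 2)) (fun _ _ => by positivity)
          (by simp [hn'.ne']) (fun _ _ => Set.mem_univ _)
        simp only [smul_eq_mul] at hj
        refine le_trans (Real.exp_le_exp.2 ?_) hj
        rw [← Finset.mul_sum, ← Finset.sum_div, EuclideanSpace.norm_sq_eq]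
        simp only [Real.norm_eq_abs, sq_abs]
        rw [mul_pow, mul_pow, Real.sq_sqrt hd'.le, div_mul_div_comm, one_mul]
        have hnd' : (n : ℝ) ≤ d := by exact_mod_cast hnd
        have : 0 ≤ ∑ i, x i ^ 2 := Finset.sum_nonneg fun i _ => sq_nonneg _
        refine div_le_div_of_nonneg_left this (by positivity) ?_
        nlinarith [sq_nonneg (σ : ℝ)]
    _ ≤ ∑ i : Fin n, ENNReal.ofReal (1 / n) * 2 := by
        rw [lintegral_finsetSum _ fun i _ => by fun_prop]
        refine Finset.sum_le_sum fun i _ => ?_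
        rw [lintegral_const_mul _ (by fun_prop)]
        gcongr
        exact lintegral_exp_sq_le_of_hasSubgaussianMGF hσ (h i).2
    _ = 2 := by
        rw [Finset.sum_const, Finset.card_univ, Fintype.card_fin, nsmul_eq_mul, ← mul_assoc,
          ← ENNReal.ofReal_natCast, ← ENNReal.ofReal_mul hn'.le]
        simp [hn'.ne']

/-! ### Gaussian action noise -/

section Gaussian

variable {V : Type*} [NormedAddCommGroup V] [InnerProductSpace ℝ V]

theorem gaussianDensity_pos {σ : ℝ} (hσ : 0 < σ) (ξ : V) : 0 < gaussianDensity V σ ξ := by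
  unfold gaussianDensity; positivity

theorem continuous_gaussianDensity (σ : ℝ) : Continuous (gaussianDensity V σ) := by
  unfold gaussianDensity; fun_prop

/-- The likelihood ratio of a shifted centred Gaussian. -/
theorem gaussianDensity_sub {σ : ℝ} (ξ h : V) :
    gaussianDensity V σ (ξ - h) = gaussianDensity V σ ξ *
      Real.exp (inner ℝ ξ h / σ ^ 2 - ‖h‖ ^ 2 / (2 * σ ^ 2)) := by
  unfold gaussianDensity
  rw [mul_assoc (_ ^ _ : ℝ), ← Real.exp_add, norm_sub_sq_real]
  congr 2
  rcases eq_or_ne σ 0 with rfl | hσ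
  · simp
  field_simp
  ring

theorem log_gaussianDensity {σ : ℝ} (hσ : 0 < σ) (ξ : V) :
    Real.log (gaussianDensity V σ ξ) =
      Real.log ((2 * Real.pi * σ ^ 2) ^ (-(Module.finrank ℝ V : ℝ) / 2)) +
        -‖ξ‖ ^ 2 / (2 * σ ^ 2) := by
  unfold gaussianDensity
  rw [Real.log_mul (by positivity) (by positivity), Real.log_exp]

variable [FiniteDimensional ℝ V] [MeasurableSpace V] [BorelSpace V]

theorem integral_densityLaw_gaussianDensity {σ : ℝ} (hσ : 0 < σ) {F : Type*}
    [NormedAddCommGroup F] [NormedSpace ℝ F] (q : V → F) :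
    ∫ ξ, q ξ ∂(densityLaw (gaussianDensity V σ)) = ∫ ξ, gaussianDensity V σ ξ • q ξ := by
  rw [densityLaw, integral_withDensity_eq_integral_toReal_smul
    (continuous_gaussianDensity σ).measurable.ennreal_ofReal (ae_of_all _ fun _ => by simp)]
  simp only [ENNReal.toReal_ofReal (gaussianDensity_pos hσ _).le]

theorem lintegral_exp_sq_gaussianDensity {σ : ℝ} (hσ : 0 < σ) {b : ℝ}
    (hb : 2 * σ ^ 2 * b < 1) :
    ∫⁻ ξ, ENNReal.ofReal (Real.exp (b * ‖ξ‖ ^ 2)) ∂(densityLaw (gaussianDensity V σ)) =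
      ENNReal.ofReal ((1 / (1 - 2 * σ ^ 2 * b)) ^ ((Module.finrank ℝ V : ℝ) / 2)) := by
  rw [densityLaw, lintegral_withDensity_eq_lintegral_mul _
    (continuous_gaussianDensity σ).measurable.ennreal_ofReal
    (by fun_prop)]
  set β : ℝ := (1 - 2 * σ ^ 2 * b) / (2 * σ ^ 2) with hβ
  have hβ0 : 0 < β := div_pos (by linarith) (by positivity)
  have e : ∀ ξ : V, ((fun ξ => ENNReal.ofReal (gaussianDensity V σ ξ)) *
      fun ξ : V => ENNReal.ofReal (Real.exp (b * ‖ξ‖ ^ 2))) ξ =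
      ENNReal.ofReal ((2 * Real.pi * σ ^ 2) ^ (-(Module.finrank ℝ V : ℝ) / 2) *
        Real.exp (-β * ‖ξ‖ ^ 2)) := fun ξ => by
    rw [Pi.mul_apply, ← ENNReal.ofReal_mul (gaussianDensity_pos hσ ξ).le, gaussianDensity,
      mul_assoc, ← Real.exp_add]
    congr 3
    rw [hβ]; field_simp; ring
  have hI := GaussianFourier.integral_rexp_neg_mul_sq_norm (V := V) hβ0
  have hint : Integrable fun ξ : V => Real.exp (-β * ‖ξ‖ ^ 2) := by
    refine Integrable.of_integral_ne_zero ?_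
    rw [hI]; positivity
  rw [lintegral_congr e, ← ofReal_integral_eq_lintegral_ofReal (hint.const_mul _)
    (ae_of_all _ fun _ => by positivity), integral_const_mul, hI]
  congr 1
  rw [neg_div, Real.rpow_neg (by positivity), ← Real.inv_rpow (by positivity),
    ← Real.mul_rpow (by positivity) (by positivity)]
  congr 1
  have h1 : 1 - 2 * σ ^ 2 * b ≠ 0 := by linarith
  rw [hβ]; field_simp

theorem isProbabilityMeasure_densityLaw_gaussianDensity {σ : ℝ} (hσ : 0 < σ) :
    IsProbabilityMeasure (densityLaw (gaussianDensity V σ)) := by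
  have h := lintegral_exp_sq_gaussianDensity (V := V) hσ (b := 0) (by simp)
  exact ⟨by simpa using h⟩

theorem hasSubgaussianNorm_gaussianDensity {d : ℕ} (hd : 1 ≤ d) (hnd : Module.finrank ℝ V ≤ d)
    {σ : ℝ} (hσ : 0 < σ) :
    HasSubgaussianNorm (2 * σ * √d) (densityLaw (gaussianDensity V σ)) := by
  have hd' : (1 : ℝ) ≤ d := by exact_mod_cast hd
  have hnd' : (Module.finrank ℝ V : ℝ) ≤ d := by exact_mod_cast hnd
  refine .of_lintegral_le (isProbabilityMeasure_densityLaw_gaussianDensity hσ) (by positivity) ?_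
  have e : ∀ ξ : V, ‖ξ‖ ^ 2 / (2 * σ * √d) ^ 2 = 1 / (4 * σ ^ 2 * d) * ‖ξ‖ ^ 2 := fun ξ => by
    rw [mul_pow, mul_pow, Real.sq_sqrt (by positivity)]; ring
  have eb : 2 * σ ^ 2 * (1 / (4 * σ ^ 2 * d)) = 1 / (2 * d) := by field_simp; norm_num
  have hlt : 1 / (2 * d : ℝ) ≤ 1 / 2 := by
    rw [div_le_div_iff₀ (by positivity) (by norm_num)]; linarith
  simp only [e]
  rw [lintegral_exp_sq_gaussianDensity hσ (by rw [eb]; linarith), eb, ← ENNReal.ofReal_ofNat 2]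
  refine ENNReal.ofReal_le_ofReal ?_
  have h1 : 1 / (1 - 1 / (2 * d : ℝ)) ≤ Real.exp (1 / d) := by
    have : 1 / (1 - 1 / (2 * d : ℝ)) ≤ 1 / d + 1 := by
      rw [div_le_iff₀ (by linarith)]
      have : 1 / (d : ℝ) ≤ 1 := by rw [div_le_one (by positivity)]; exact hd'
      have e2 : 1 / (2 * d : ℝ) = 1 / d / 2 := by field_simp
      have : 0 < 1 / (d : ℝ) := by positivity
      rw [e2]; nlinarith
    exact this.trans (Real.add_one_le_exp _)
  calc (1 / (1 - 1 / (2 * d : ℝ))) ^ ((Module.finrank ℝ V : ℝ) / 2)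
      ≤ Real.exp (1 / d) ^ ((Module.finrank ℝ V : ℝ) / 2) :=
        Real.rpow_le_rpow (div_nonneg zero_le_one (by linarith)) h1 (by positivity)
    _ = Real.exp (1 / d * (Module.finrank ℝ V / 2)) := by rw [← Real.exp_mul]
    _ ≤ Real.exp (1 / 2) := by
        refine Real.exp_le_exp.2 ?_
        rw [div_mul_div_comm, div_le_div_iff₀ (by positivity) (by norm_num)]
        linarith
    _ ≤ 2 := by
        have h2 := Real.exp_one_lt_d9
        have h3 : Real.exp (1 / 2) ^ 2 = Real.exp 1 := by rw [← Real.exp_nat_mul]; norm_num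
        nlinarith [Real.exp_pos (1 / 2)]

/-- Translation of the argument becomes a likelihood ratio. -/
theorem integral_add_gaussianDensity {σ : ℝ} (hσ : 0 < σ) (q : V → ℝ) (h : V) :
    ∫ ξ, q (h + ξ) ∂(densityLaw (gaussianDensity V σ)) =
      ∫ ξ, q ξ * Real.exp (inner ℝ ξ h / σ ^ 2 - ‖h‖ ^ 2 / (2 * σ ^ 2))
        ∂(densityLaw (gaussianDensity V σ)) := by
  rw [integral_densityLaw_gaussianDensity hσ, integral_densityLaw_gaussianDensity hσ,
    ← integral_sub_right_eq_self (fun ξ => gaussianDensity V σ ξ • q (h + ξ)) h]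
  refine integral_congr_ae (ae_of_all _ fun ξ => ?_)
  simp only [gaussianDensity_sub, smul_eq_mul, add_sub_cancel]
  ring

theorem abs_exp_sub_sub_le {x y : ℝ} (hy : 0 ≤ y) :
    |Real.exp (x - y) - 1 - x| ≤ (x ^ 2 + y) * Real.exp |x| := by
  have h1 : |Real.exp (x - y) - Real.exp x| ≤ y * Real.exp |x| := by
    have e : Real.exp (x - y) = Real.exp x * Real.exp (-y) := by rw [← Real.exp_add]; ring_nf
    have h := Real.add_one_le_exp (-y)
    have h' : Real.exp (-y) ≤ 1 := Real.exp_le_one_iff.2 (by linarith)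
    have h2 := Real.exp_pos x
    have h3 := Real.exp_le_exp.2 (le_abs_self x)
    rw [e, abs_le]
    constructor <;> nlinarith
  have h2 : |Real.exp x - 1 - x| ≤ x ^ 2 * Real.exp |x| := by
    have a1 := Real.add_one_le_exp x
    have a2 := Real.add_one_le_exp (-x)
    have a3 : Real.exp x * Real.exp (-x) = 1 := by rw [← Real.exp_add]; simp
    have a4 : Real.exp x * (1 - x) ≤ 1 := by nlinarith [Real.exp_pos x]
    have a5 := Real.one_le_exp (abs_nonneg x)
    rw [abs_of_nonneg (by linarith)]
    rcases le_total 0 x with hx | hx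
    · rw [abs_of_nonneg hx] at a5 ⊢
      nlinarith
    · nlinarith [sq_nonneg x]
  calc _ = |(Real.exp (x - y) - Real.exp x) + (Real.exp x - 1 - x)| := by ring_nf
    _ ≤ _ := (abs_add_le _ _).trans (by linarith)

/-- The constant in the second-order expansion of Gaussian smoothing. -/
noncomputable def smoothingConst (V : Type*) [NormedAddCommGroup V] [InnerProductSpace ℝ V]
    [FiniteDimensional ℝ V] [MeasurableSpace V] [BorelSpace V] (σ τ : ℝ) : ℝ :=
  ∫ ξ, (‖ξ‖ + τ) * ((‖ξ‖ ^ 2 / σ ^ 4 + 1 / (2 * σ ^ 2)) * Real.exp (‖ξ‖ / σ))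
    ∂(densityLaw (gaussianDensity V σ))

theorem smoothingConst_nonneg {σ τ : ℝ} (hτ : 0 ≤ τ) : 0 ≤ smoothingConst V σ τ :=
  integral_nonneg fun _ => by positivity

/-- Gaussian smoothing of a function of linear growth and mean zero has a second-order expansion,
uniformly over all such functions; its linear term is the likelihood-ratio gradient. -/
theorem abs_integral_add_sub_inner_le {σ τ : ℝ} (hσ : 0 < σ)
    (hτ : HasSubgaussianNorm τ (densityLaw (gaussianDensity V σ))) {q : V → ℝ}
    (hq : AEStronglyMeasurable q (densityLaw (gaussianDensity V σ)))
    {B : ℝ} (hB : 0 ≤ B) (hqB : ∀ ξ, |q ξ| ≤ B * (‖ξ‖ + τ))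
    (hq0 : ∫ ξ, q ξ ∂(densityLaw (gaussianDensity V σ)) = 0) {h : V} (hh : ‖h‖ ≤ σ) :
    |∫ ξ, q (h + ξ) ∂(densityLaw (gaussianDensity V σ)) -
      inner ℝ h (∫ ξ, (q ξ / σ ^ 2) • ξ ∂(densityLaw (gaussianDensity V σ)))| ≤
      B * smoothingConst V σ τ * ‖h‖ ^ 2 := by
  set γ := densityLaw (gaussianDensity V σ)
  have hτ0 := hτ.pos
  have hmeas : Measurable fun ξ : V => inner ℝ ξ h := by fun_prop
  have i0 : Integrable q γ := by
    have := hτ.isProbabilityMeasure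
    exact ((hτ.integrable_norm.add (integrable_const τ)).const_mul B).mono' hq (ae_of_all _ hqB)
  have i1 : Integrable (fun ξ => (q ξ / σ ^ 2) • ξ) γ := by
    refine (((hτ.integrable_norm_pow 2).add (hτ.integrable_norm.const_mul τ)).const_mul
      (B / σ ^ 2)).mono' ((hq.aemeasurable.div_const _).aestronglyMeasurable.smul
        aestronglyMeasurable_id) (ae_of_all _ fun ξ => ?_)
    rw [norm_smul, norm_div, Real.norm_eq_abs, Real.norm_of_nonneg (by positivity : 0 ≤ σ ^ 2)]
    have := mul_le_mul_of_nonneg_right (hqB ξ) (norm_nonneg ξ)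
    simp only [Pi.add_apply]
    rw [div_mul_eq_mul_div, div_mul_eq_mul_div]
    refine div_le_div_of_nonneg_right (this.trans (le_of_eq (by ring))) (by positivity)
  have i2 : Integrable (fun ξ => (‖ξ‖ + τ) *
      ((‖ξ‖ ^ 2 / σ ^ 4 + 1 / (2 * σ ^ 2)) * Real.exp (‖ξ‖ / σ))) γ := by
    have hk := fun k : ℕ => hτ.integrable_pow_mul_exp k (1 / σ)
    refine ((((hk 3).div_const (σ ^ 4)).add (((hk 2).div_const (σ ^ 4)).const_mul τ)).add
      (((hk 1).div_const (2 * σ ^ 2)).add (((hk 0).div_const (2 * σ ^ 2)).const_mul τ))).congr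
        (ae_of_all _ fun ξ => ?_)
    simp only [Pi.add_apply]
    rw [show 1 / σ * ‖ξ‖ = ‖ξ‖ / σ by ring]
    ring
  have hpt : ∀ ξ : V, |q ξ * (Real.exp (inner ℝ ξ h / σ ^ 2 - ‖h‖ ^ 2 / (2 * σ ^ 2)) - 1 -
      inner ℝ ξ h / σ ^ 2)| ≤ B * ‖h‖ ^ 2 * ((‖ξ‖ + τ) *
        ((‖ξ‖ ^ 2 / σ ^ 4 + 1 / (2 * σ ^ 2)) * Real.exp (‖ξ‖ / σ))) := fun ξ => by
    have hx : |inner ℝ ξ h / σ ^ 2| ≤ ‖ξ‖ * ‖h‖ / σ ^ 2 := by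
      rw [abs_div, abs_of_nonneg (by positivity : 0 ≤ σ ^ 2)]
      gcongr
      exact abs_real_inner_le_norm _ _
    have hx2 : (inner ℝ ξ h / σ ^ 2) ^ 2 ≤ ‖h‖ ^ 2 * (‖ξ‖ ^ 2 / σ ^ 4) := by
      rw [← sq_abs]
      refine (pow_le_pow_left₀ (abs_nonneg _) hx 2).trans (le_of_eq ?_)
      field_simp
    have hx3 : |inner ℝ ξ h / σ ^ 2| ≤ ‖ξ‖ / σ := by
      refine hx.trans ?_
      rw [div_le_div_iff₀ (by positivity) hσ]
      nlinarith [mul_le_mul_of_nonneg_left hh (mul_nonneg (norm_nonneg ξ) hσ.le)]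
    rw [abs_mul]
    calc _ ≤ B * (‖ξ‖ + τ) * (((inner ℝ ξ h / σ ^ 2) ^ 2 + ‖h‖ ^ 2 / (2 * σ ^ 2)) *
          Real.exp |inner ℝ ξ h / σ ^ 2|) :=
          mul_le_mul (hqB ξ) (abs_exp_sub_sub_le (by positivity)) (abs_nonneg _) (by positivity)
      _ ≤ B * (‖ξ‖ + τ) * ((‖h‖ ^ 2 * (‖ξ‖ ^ 2 / σ ^ 4) + ‖h‖ ^ 2 / (2 * σ ^ 2)) *
          Real.exp (‖ξ‖ / σ)) := by gcongr
      _ = _ := by ring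
  have i3 : Integrable (fun ξ => q ξ *
      (Real.exp (inner ℝ ξ h / σ ^ 2 - ‖h‖ ^ 2 / (2 * σ ^ 2)) - 1 - inner ℝ ξ h / σ ^ 2)) γ := by
    refine (i2.const_mul (B * ‖h‖ ^ 2)).mono' (hq.mul ?_) (ae_of_all _ hpt)
    exact Measurable.aestronglyMeasurable (by fun_prop)
  have i4 : Integrable (fun ξ => q ξ * (inner ℝ ξ h / σ ^ 2)) γ := by
    refine (i1.const_inner h).congr (ae_of_all _ fun ξ => ?_)
    simp only [inner_smul_right]
    rw [real_inner_comm]; ring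
  have e : ∫ ξ, q (h + ξ) ∂γ - inner ℝ h (∫ ξ, (q ξ / σ ^ 2) • ξ ∂γ) =
      ∫ ξ, q ξ * (Real.exp (inner ℝ ξ h / σ ^ 2 - ‖h‖ ^ 2 / (2 * σ ^ 2)) - 1 -
        inner ℝ ξ h / σ ^ 2) ∂γ := by
    have e1 : inner ℝ h (∫ ξ, (q ξ / σ ^ 2) • ξ ∂γ) = ∫ ξ, q ξ * (inner ℝ ξ h / σ ^ 2) ∂γ := by
      rw [← integral_inner i1]
      refine integral_congr_ae (ae_of_all _ fun ξ => ?_)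
      simp only [inner_smul_right]
      rw [real_inner_comm]; ring
    have e2 : ∫ ξ, q (h + ξ) ∂γ = ∫ ξ, (q ξ * (Real.exp (inner ℝ ξ h / σ ^ 2 -
        ‖h‖ ^ 2 / (2 * σ ^ 2)) - 1 - inner ℝ ξ h / σ ^ 2) + q ξ +
          q ξ * (inner ℝ ξ h / σ ^ 2)) ∂γ := by
      rw [integral_add_gaussianDensity hσ]
      exact integral_congr_ae (ae_of_all _ fun ξ => by ring)
    have e3 := integral_add (i3.add i0) i4
    have e4 := integral_add i3 i0
    simp only [Pi.add_apply] at e3 e4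
    rw [e2, e3, e4, hq0, e1]
    ring
  rw [e]
  calc _ ≤ ∫ ξ, B * ‖h‖ ^ 2 * ((‖ξ‖ + τ) *
        ((‖ξ‖ ^ 2 / σ ^ 4 + 1 / (2 * σ ^ 2)) * Real.exp (‖ξ‖ / σ))) ∂γ :=
        abs_integral_le_integral_abs.trans (integral_mono i3.abs (i2.const_mul _) hpt)
    _ = _ := by rw [integral_const_mul, smoothingConst]; ring

end Gaussian

/-! ### Resampling one coordinate of a product measure -/

section Resampling

variable {ι : Type*} [Fintype ι] [DecidableEq ι] {X : ι → Type*} [∀ i, MeasurableSpace (X i)]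
  (μ : ∀ i, Measure (X i)) [∀ i, IsProbabilityMeasure (μ i)]

theorem measurePreserving_update (i : ι) :
    MeasurePreserving (fun q : (∀ j, X j) × X i => Function.update q.1 i q.2)
      ((Measure.pi μ).prod (μ i)) (Measure.pi μ) := by
  have hm : Measurable fun q : (∀ j, X j) × X i => Function.update q.1 i q.2 := by
    refine measurable_pi_iff.2 fun j => ?_
    rcases eq_or_ne j i with rfl | hj
    · simpa using measurable_snd
    · simp only [Function.update_of_ne hj]
      exact (measurable_pi_apply j).comp measurable_fst
  refine ⟨hm, (Measure.pi_eq fun s hs => ?_).symm⟩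
  rw [Measure.map_apply hm (MeasurableSet.univ_pi hs)]
  have e : (fun q : (∀ j, X j) × X i => Function.update q.1 i q.2) ⁻¹' Set.univ.pi s =
      Set.univ.pi (Function.update s i Set.univ) ×ˢ s i := by
    ext q
    simp only [Set.mem_preimage, Set.mem_univ_pi, Set.mem_prod]
    constructor
    · refine fun h => ⟨fun j => ?_, by simpa using h i⟩
      rcases eq_or_ne j i with rfl | hj
      · simp
      · simpa [hj] using h j
    · rintro ⟨h1, h2⟩ j
      rcases eq_or_ne j i with rfl | hj
      · simpa using h2
      · simpa [hj] using h1 j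
  rw [e, Measure.prod_prod, Measure.pi_pi, ← Finset.mul_prod_erase _ _ (Finset.mem_univ i),
    ← Finset.mul_prod_erase Finset.univ (fun j => μ j (s j)) (Finset.mem_univ i)]
  simp only [Function.update_self, measure_univ, one_mul]
  rw [mul_comm]
  congr 1
  refine Finset.prod_congr rfl fun j hj => ?_
  rw [Function.update_of_ne (Finset.ne_of_mem_erase hj)]

theorem ae_pi_of_ae_update (i : ι) {s : Set (∀ j, X j)} (hs : MeasurableSet s)
    (h : ∀ᵐ ω ∂(Measure.pi μ), ∀ᵐ y ∂(μ i), Function.update ω i y ∈ s) :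
    ∀ᵐ ω ∂(Measure.pi μ), ω ∈ s := by
  have hmp := measurePreserving_update μ i
  rw [← hmp.map_eq]
  refine (ae_map_iff (p := fun ω => ω ∈ s) hmp.measurable.aemeasurable hs).2 ?_
  exact (Measure.ae_prod_iff_ae_ae (hmp.measurable hs)).2 h

variable {F : Type*} [NormedAddCommGroup F]

/-- The expectation of `G` is computed by first averaging over the `i`-th coordinate. -/
theorem integral_pi_eq_integral_integral_update [NormedSpace ℝ F] (i : ι) {G : (∀ j, X j) → F}
    (hG : Integrable G (Measure.pi μ)) :
    ∫ ω, G ω ∂(Measure.pi μ) =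
      ∫ ω, ∫ y, G (Function.update ω i y) ∂(μ i) ∂(Measure.pi μ) := by
  have hmp := measurePreserving_update μ i
  have h1 : Integrable (fun q : (∀ j, X j) × X i => G (Function.update q.1 i q.2))
      ((Measure.pi μ).prod (μ i)) := hmp.integrable_comp_of_integrable hG
  rw [← integral_prod _ h1]
  conv_lhs => rw [← hmp.map_eq]
  exact integral_map hmp.measurable.aemeasurable (by rw [hmp.map_eq]; exact hG.1)

theorem ae_integrable_update (i : ι) {G : (∀ j, X j) → F} (hG : Integrable G (Measure.pi μ)) :
    ∀ᵐ ω ∂(Measure.pi μ), Integrable (fun y => G (Function.update ω i y)) (μ i) :=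
  ((measurePreserving_update μ i).integrable_comp_of_integrable hG).prod_right_ae

end Resampling

theorem ContinuousOn.aestronglyMeasurable_comp {Ω S F : Type*} [MeasurableSpace Ω]
    [TopologicalSpace S] [MeasurableSpace S] [OpensMeasurableSpace S] [NormedAddCommGroup F]
    [SecondCountableTopology S] {D : Set S} (hD : MeasurableSet D) {φ : S → F}
    (hφ : ContinuousOn φ D) {μ : Measure Ω} {X : Ω → S} (hX : Measurable X)
    (hXD : ∀ᵐ ω ∂μ, X ω ∈ D) [TopologicalSpace.PseudoMetrizableSpace S] :
    AEStronglyMeasurable (fun ω => φ (X ω)) μ := by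
  have h1 := hφ.aestronglyMeasurable (μ := μ.map X) hD
  rw [Measure.restrict_eq_self_of_ae_mem] at h1
  · exact h1.comp_measurable hX
  · exact (ae_map_iff hX.aemeasurable hD).2 hXD

/-! ### Value functions and temporal-difference errors -/

theorem dist_toLp_le {X Y : Type*} [SeminormedAddCommGroup X] [SeminormedAddCommGroup Y]
    (x x' : X) (y y' : Y) :
    dist (WithLp.toLp 2 (x, y)) (WithLp.toLp 2 (x', y')) ≤ ‖x - x'‖ + ‖y - y'‖ := by
  rw [WithLp.prod_dist_eq_of_L2, Real.sqrt_le_left (by positivity)]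
  simp only [dist_eq_norm]
  change ‖x - x'‖ ^ 2 + ‖y - y'‖ ^ 2 ≤ _
  nlinarith [norm_nonneg (x - x'), norm_nonneg (y - y')]

namespace ControlProblem

variable {dS dA dΘ : ℕ}
  {P : ControlProblem (EuclideanSpace ℝ (Fin dS)) (EuclideanSpace ℝ (Fin dA))
    (EuclideanSpace ℝ (Fin dΘ))}

/-- A regular control problem with noises of norm size `τ`, together with Lipschitz constants of
`R`, `R̃_θ`, `π` and `f̃_θ`. -/
structure LipschitzBounds (P : ControlProblem (EuclideanSpace ℝ (Fin dS))
    (EuclideanSpace ℝ (Fin dA)) (EuclideanSpace ℝ (Fin dΘ)))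
    (p : EuclideanSpace ℝ (Fin dA) → ℝ) (θ : EuclideanSpace ℝ (Fin dΘ)) (τ : ℝ)
    (LR LRt Lπ Lft : ℝ≥0) : Prop where
  regular : P.Regular p
  action : HasSubgaussianNorm τ (densityLaw p)
  noise : ∀ t < P.T, HasSubgaussianNorm τ (P.noise t)
  mem_params : θ ∈ P.params
  lipschitz_R : ∀ t < P.T, LipschitzOnWith LR (P.RJoint t) P.stateAction
  lipschitz_RTilde : ∀ t < P.T, LipschitzOnWith LRt (P.RTilde p t θ) P.states
  lipschitz_pol : LipschitzOnWith Lπ P.polJoint P.paramState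
  lipschitz_fTilde : ∀ t < P.T, LipschitzOnWith Lft (P.fTilde t θ) P.stateAction
  one_le : 1 ≤ Lft

namespace LipschitzBounds

variable {p : EuclideanSpace ℝ (Fin dA) → ℝ} {θ : EuclideanSpace ℝ (Fin dΘ)} {τ : ℝ}
  {LR LRt Lπ Lft : ℝ≥0}

theorem one_le_coe (h : P.LipschitzBounds p θ τ LR LRt Lπ Lft) : (1 : ℝ) ≤ Lft := h.one_le

theorem abs_R_sub_le (h : P.LipschitzBounds p θ τ LR LRt Lπ Lft) {t : ℕ} (ht : t < P.T)
    {s s' : EuclideanSpace ℝ (Fin dS)} (hs : s ∈ P.states) (hs' : s' ∈ P.states)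
    (a a' : EuclideanSpace ℝ (Fin dA)) :
    |P.R t s a - P.R t s' a'| ≤ LR * (‖s - s'‖ + ‖a - a'‖) := by
  have := (h.lipschitz_R t ht).dist_le_mul (WithLp.toLp 2 (s, a)) hs (WithLp.toLp 2 (s', a')) hs'
  exact this.trans (mul_le_mul_of_nonneg_left (dist_toLp_le _ _ _ _) LR.2)

theorem norm_fTilde_sub_le (h : P.LipschitzBounds p θ τ LR LRt Lπ Lft) {t : ℕ} (ht : t < P.T)
    {s s' : EuclideanSpace ℝ (Fin dS)} (hs : s ∈ P.states) (hs' : s' ∈ P.states)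
    (u u' : EuclideanSpace ℝ (Fin dA)) :
    ‖P.f t s (P.pol θ s + u) - P.f t s' (P.pol θ s' + u')‖ ≤ Lft * (‖s - s'‖ + ‖u - u'‖) := by
  have := (h.lipschitz_fTilde t ht).dist_le_mul (WithLp.toLp 2 (s, u)) hs
    (WithLp.toLp 2 (s', u')) hs'
  rw [dist_eq_norm] at this
  exact this.trans (mul_le_mul_of_nonneg_left (dist_toLp_le _ _ _ _) Lft.2)

theorem norm_pol_sub_le (h : P.LipschitzBounds p θ τ LR LRt Lπ Lft)
    {θ₁ θ₂ : EuclideanSpace ℝ (Fin dΘ)} (h₁ : θ₁ ∈ P.params) (h₂ : θ₂ ∈ P.params)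
    {s s' : EuclideanSpace ℝ (Fin dS)} (hs : s ∈ P.states) (hs' : s' ∈ P.states) :
    ‖P.pol θ₁ s - P.pol θ₂ s'‖ ≤ Lπ * (‖θ₁ - θ₂‖ + ‖s - s'‖) := by
  have := h.lipschitz_pol.dist_le_mul (WithLp.toLp 2 (θ₁, s)) ⟨h₁, hs⟩
    (WithLp.toLp 2 (θ₂, s')) ⟨h₂, hs'⟩
  rw [dist_eq_norm] at this
  exact this.trans (mul_le_mul_of_nonneg_left (dist_toLp_le _ _ _ _) Lπ.2)

theorem ae_step_mem (h : P.LipschitzBounds p θ τ LR LRt Lπ Lft) {t : ℕ} (ht : t < P.T)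
    {s : EuclideanSpace ℝ (Fin dS)} (hs : s ∈ P.states) (a : EuclideanSpace ℝ (Fin dA)) :
    ∀ᵐ z ∂(P.noise t), P.f t s a + z ∈ P.states :=
  h.regular.step_mem t ht s hs a

/-- Lipschitz functions on the state space are integrable along the transition noise. -/
theorem integrable_comp_add (h : P.LipschitzBounds p θ τ LR LRt Lπ Lft) {t : ℕ} (ht : t < P.T)
    {V : EuclideanSpace ℝ (Fin dS) → ℝ} {c : ℝ} (hc : 0 ≤ c)
    (hV : ∀ s ∈ P.states, ∀ s' ∈ P.states, |V s - V s'| ≤ c * ‖s - s'‖)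
    {m : EuclideanSpace ℝ (Fin dS)} (hm : ∀ᵐ z ∂(P.noise t), m + z ∈ P.states) :
    Integrable (fun z => V (m + z)) (P.noise t) := by
  have := (h.noise t ht).isProbabilityMeasure
  obtain ⟨z₀, hz₀⟩ := hm.exists
  have hVc : ContinuousOn V P.states := by
    have : LipschitzOnWith c.toNNReal V P.states := .of_dist_le_mul fun x hx y hy => by
      rw [Real.coe_toNNReal c hc, dist_eq_norm]; exact hV x hx y hy
    exact this.continuousOn
  refine (((integrable_const (|V (m + z₀)| + c * ‖z₀‖)).add
    ((h.noise t ht).integrable_norm.const_mul c))).mono'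
    (hVc.aestronglyMeasurable_comp h.regular.measurableSet_states (measurable_const_add m) hm) ?_
  filter_upwards [hm] with z hz
  have h1 := hV _ hz _ hz₀
  have h2 : ‖m + z - (m + z₀)‖ ≤ ‖z‖ + ‖z₀‖ := by
    rw [add_sub_add_left_eq_sub]; exact norm_sub_le _ _
  have h3 : |V (m + z)| ≤ |V (m + z₀)| + |V (m + z) - V (m + z₀)| := by
    have := abs_add_le (V (m + z₀)) (V (m + z) - V (m + z₀))
    simpa using this
  rw [Real.norm_eq_abs]
  simp only [Pi.add_apply]
  nlinarith

theorem abs_integral_comp_add_sub_le (h : P.LipschitzBounds p θ τ LR LRt Lπ Lft) {t : ℕ}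
    (ht : t < P.T) {V : EuclideanSpace ℝ (Fin dS) → ℝ} {c : ℝ} (hc : 0 ≤ c)
    (hV : ∀ s ∈ P.states, ∀ s' ∈ P.states, |V s - V s'| ≤ c * ‖s - s'‖)
    {m m' : EuclideanSpace ℝ (Fin dS)} (hm : ∀ᵐ z ∂(P.noise t), m + z ∈ P.states)
    (hm' : ∀ᵐ z ∂(P.noise t), m' + z ∈ P.states) :
    |∫ z, V (m + z) ∂(P.noise t) - ∫ z, V (m' + z) ∂(P.noise t)| ≤ c * ‖m - m'‖ := by
  have := (h.noise t ht).isProbabilityMeasure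
  have i1 := h.integrable_comp_add ht hc hV hm
  have i2 := h.integrable_comp_add ht hc hV hm'
  rw [← integral_sub i1 i2]
  refine abs_integral_le_integral_abs.trans ?_
  calc _ ≤ ∫ _, c * ‖m - m'‖ ∂(P.noise t) := by
        refine integral_mono_ae (i1.sub i2).abs (integrable_const _) ?_
        filter_upwards [hm, hm'] with z h1 h2
        simpa using hV _ h1 _ h2
    _ = _ := by simp

/-- The one-step look-ahead is Lipschitz if the continuation value is. -/
theorem abs_qStep_sub_le (h : P.LipschitzBounds p θ τ LR LRt Lπ Lft) {t : ℕ}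
    (ht : t < P.T) {V : EuclideanSpace ℝ (Fin dS) → ℝ} {c : ℝ} (hc : 0 ≤ c)
    (hV : ∀ s ∈ P.states, ∀ s' ∈ P.states, |V s - V s'| ≤ c * ‖s - s'‖)
    {s s' : EuclideanSpace ℝ (Fin dS)} (hs : s ∈ P.states) (hs' : s' ∈ P.states)
    (u u' : EuclideanSpace ℝ (Fin dA)) :
    |P.qStep V t s (P.pol θ s + u) - P.qStep V t s' (P.pol θ s' + u')| ≤
      LR * ((1 + Lπ) * ‖s - s'‖ + ‖u - u'‖) + c * Lft * (‖s - s'‖ + ‖u - u'‖) := by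
  have h1 := h.abs_R_sub_le ht hs hs' (P.pol θ s + u) (P.pol θ s' + u')
  have h2 := h.abs_integral_comp_add_sub_le ht hc hV (h.ae_step_mem ht hs (P.pol θ s + u))
    (h.ae_step_mem ht hs' (P.pol θ s' + u'))
  have h3 := mul_le_mul_of_nonneg_left (h.norm_fTilde_sub_le ht hs hs' u u') hc
  have h4 := h.norm_pol_sub_le h.mem_params h.mem_params hs hs'
  have h5 : ‖P.pol θ s + u - (P.pol θ s' + u')‖ ≤ ‖P.pol θ s - P.pol θ s'‖ + ‖u - u'‖ := by
    rw [add_sub_add_comm]; exact norm_add_le _ _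
  simp only [sub_self, norm_zero, zero_add] at h4
  unfold qStep
  have h6 : P.R t s (P.pol θ s + u) + ∫ z, V (P.f t s (P.pol θ s + u) + z) ∂(P.noise t) -
      (P.R t s' (P.pol θ s' + u') + ∫ z, V (P.f t s' (P.pol θ s' + u') + z) ∂(P.noise t)) =
      (P.R t s (P.pol θ s + u) - P.R t s' (P.pol θ s' + u')) +
      (∫ z, V (P.f t s (P.pol θ s + u) + z) ∂(P.noise t) -
        ∫ z, V (P.f t s' (P.pol θ s' + u') + z) ∂(P.noise t)) := by ring
  rw [h6]
  have h7 := abs_add_le (P.R t s (P.pol θ s + u) - P.R t s' (P.pol θ s' + u'))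
    (∫ z, V (P.f t s (P.pol θ s + u) + z) ∂(P.noise t) -
        ∫ z, V (P.f t s' (P.pol θ s' + u') + z) ∂(P.noise t))
  have h8 : (LR : ℝ) * (‖s - s'‖ + ‖P.pol θ s + u - (P.pol θ s' + u')‖) ≤
      LR * ((1 + Lπ) * ‖s - s'‖ + ‖u - u'‖) :=
    mul_le_mul_of_nonneg_left (by linarith) LR.2
  linarith

theorem integrable_qStep (h : P.LipschitzBounds p θ τ LR LRt Lπ Lft) {t : ℕ}
    (ht : t < P.T) {V : EuclideanSpace ℝ (Fin dS) → ℝ} {c : ℝ} (hc : 0 ≤ c)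
    (hV : ∀ s ∈ P.states, ∀ s' ∈ P.states, |V s - V s'| ≤ c * ‖s - s'‖)
    {s : EuclideanSpace ℝ (Fin dS)} (hs : s ∈ P.states) :
    Continuous (fun u => P.qStep V t s (P.pol θ s + u)) ∧
      Integrable (fun u => P.qStep V t s (P.pol θ s + u)) (densityLaw p) ∧
      Integrable (fun u => P.R t s (P.pol θ s + u)) (densityLaw p) := by
  have := h.action.isProbabilityMeasure
  have key : ∀ (q : EuclideanSpace ℝ (Fin dA) → ℝ) (C : ℝ≥0),
      (∀ u u', |q u - q u'| ≤ C * ‖u - u'‖) → Continuous q ∧ Integrable q (densityLaw p) := by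
    intro q C hq
    have hqc : Continuous q :=
      (LipschitzWith.of_dist_le_mul fun x y => by rw [dist_eq_norm]; exact hq x y).continuous
    refine ⟨hqc, ((integrable_const |q 0|).add (h.action.integrable_norm.const_mul C)).mono'
      hqc.aestronglyMeasurable (ae_of_all _ fun u => ?_)⟩
    have h1 := hq u 0
    rw [sub_zero] at h1
    have h2 := abs_add_le (q 0) (q u - q 0)
    rw [add_sub_cancel] at h2
    rw [Real.norm_eq_abs]
    simp only [Pi.add_apply]
    linarith
  have k1 := key (fun u => P.qStep V t s (P.pol θ s + u)) (LR + c.toNNReal * Lft) fun u u' => by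
    have := h.abs_qStep_sub_le ht hc hV hs hs u u'
    push_cast
    rw [Real.coe_toNNReal c hc]
    simp only [sub_self, norm_zero, mul_zero, zero_add] at this
    linarith
  refine ⟨k1.1, k1.2, (key _ LR fun u u' => ?_).2⟩
  simpa using h.abs_R_sub_le ht hs hs (P.pol θ s + u) (P.pol θ s + u')

/-- Each step adds the Lipschitz constant of `R̃_θ` and multiplies that of the continuation value
by the one of `f̃_θ`. -/
theorem abs_valueToGo_sub_le (h : P.LipschitzBounds p θ τ LR LRt Lπ Lft) (k : ℕ) :
    ∀ t, t + k = P.T → ∀ s ∈ P.states, ∀ s' ∈ P.states,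
      |P.valueToGo p θ k t s - P.valueToGo p θ k t s'| ≤ k * LRt * Lft ^ k * ‖s - s'‖ := by
  have := h.action.isProbabilityMeasure
  induction k with
  | zero => intro t _ s _ s' _; simp [valueToGo]
  | succ k ih =>
    intro t htk s hs s' hs'
    have ht : t < P.T := by omega
    have hV := ih (t + 1) (by omega)
    set V := P.valueToGo p θ k (t + 1)
    have hc : (0 : ℝ) ≤ k * LRt * Lft ^ k := by positivity
    have hsplit : ∀ x ∈ P.states, Integrable (fun ξ =>
        ∫ z, V (P.f t x (P.pol θ x + ξ) + z) ∂(P.noise t)) (densityLaw p) ∧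
        P.valueToGo p θ (k + 1) t x = P.RTilde p t θ x +
        ∫ ξ, ∫ z, V (P.f t x (P.pol θ x + ξ) + z) ∂(P.noise t) ∂(densityLaw p) := by
      intro x hx
      obtain ⟨_, i1, i2⟩ := h.integrable_qStep ht hc hV hx
      have i3 : Integrable (fun ξ =>
          ∫ z, V (P.f t x (P.pol θ x + ξ) + z) ∂(P.noise t)) (densityLaw p) :=
        (i1.sub i2).congr (ae_of_all _ fun ξ => by simp [qStep])
      exact ⟨i3, by simp only [valueToGo, qStep, RTilde]; rw [integral_add i2 i3]⟩
    obtain ⟨i1, e1⟩ := hsplit s hs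
    obtain ⟨i2, e2⟩ := hsplit s' hs'
    have hR := (h.lipschitz_RTilde t ht).dist_le_mul s hs s' hs'
    rw [dist_eq_norm, dist_eq_norm] at hR
    have hI : |∫ ξ, ∫ z, V (P.f t s (P.pol θ s + ξ) + z) ∂(P.noise t) ∂(densityLaw p) -
        ∫ ξ, ∫ z, V (P.f t s' (P.pol θ s' + ξ) + z) ∂(P.noise t) ∂(densityLaw p)| ≤
        k * LRt * Lft ^ k * Lft * ‖s - s'‖ := by
      rw [← integral_sub i1 i2]
      refine abs_integral_le_integral_abs.trans ?_
      calc _ ≤ ∫ _, k * LRt * Lft ^ k * Lft * ‖s - s'‖ ∂(densityLaw p) := by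
            refine integral_mono (i1.sub i2).abs (integrable_const _) fun ξ => ?_
            have h1 := h.abs_integral_comp_add_sub_le ht hc hV
              (h.ae_step_mem ht hs (P.pol θ s + ξ)) (h.ae_step_mem ht hs' (P.pol θ s' + ξ))
            have h2 := mul_le_mul_of_nonneg_left (h.norm_fTilde_sub_le ht hs hs' ξ ξ) hc
            simp only [sub_self, norm_zero, add_zero] at h2
            refine (h1.trans h2).trans (le_of_eq (by ring))
        _ = _ := by simp
    rw [e1, e2, add_sub_add_comm]
    refine (abs_add_le _ _).trans ((add_le_add hR hI).trans ?_)
    have h1 : (1 : ℝ) ≤ (Lft : ℝ) ^ (k + 1) := one_le_pow₀ h.one_le_coe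
    have h2 : (LRt : ℝ) * ‖s - s'‖ ≤ LRt * ‖s - s'‖ * Lft ^ (k + 1) :=
      le_mul_of_one_le_right (by positivity) h1
    push_cast
    rw [pow_succ] at h2 ⊢
    nlinarith

end LipschitzBounds

/-- The advantage `Q_t(s, π_θ(s) + u) - V_t(s)` of perturbing the action by `u`. -/
noncomputable def advantage (P : ControlProblem (EuclideanSpace ℝ (Fin dS))
    (EuclideanSpace ℝ (Fin dA)) (EuclideanSpace ℝ (Fin dΘ)))
    (p : EuclideanSpace ℝ (Fin dA) → ℝ) (θ : EuclideanSpace ℝ (Fin dΘ)) (t : ℕ)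
    (s : EuclideanSpace ℝ (Fin dS)) (u : EuclideanSpace ℝ (Fin dA)) : ℝ :=
  P.qStep (P.value p θ (t + 1)) t s (P.pol θ s + u) - P.value p θ t s

/-- The temporal-difference error `R_t + V_{t+1}(s_{t+1}) - V_t(s)` when the action is perturbed by
`u` and the transition by `z`. -/
noncomputable def tdError (P : ControlProblem (EuclideanSpace ℝ (Fin dS))
    (EuclideanSpace ℝ (Fin dA)) (EuclideanSpace ℝ (Fin dΘ)))
    (p : EuclideanSpace ℝ (Fin dA) → ℝ) (θ : EuclideanSpace ℝ (Fin dΘ)) (t : ℕ)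
    (s : EuclideanSpace ℝ (Fin dS)) (u : EuclideanSpace ℝ (Fin dA))
    (z : EuclideanSpace ℝ (Fin dS)) : ℝ :=
  P.R t s (P.pol θ s + u) + P.value p θ (t + 1) (P.f t s (P.pol θ s + u) + z) - P.value p θ t s

/-- A Lipschitz constant of the temporal-difference errors with respect to the noise. -/
noncomputable def tdBound (T : ℕ) (LR LRt Lft : ℝ≥0) : ℝ := T * (LR + LRt) * Lft ^ T

theorem tdBound_nonneg (T : ℕ) (LR LRt Lft : ℝ≥0) : 0 ≤ tdBound T LR LRt Lft := by
  unfold tdBound; positivity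

theorem value_horizon (p : EuclideanSpace ℝ (Fin dA) → ℝ) (θ : EuclideanSpace ℝ (Fin dΘ))
    (s : EuclideanSpace ℝ (Fin dS)) : P.value p θ P.T s = 0 := by
  simp [value, valueToGo]

theorem value_eq_integral (p : EuclideanSpace ℝ (Fin dA) → ℝ) (θ : EuclideanSpace ℝ (Fin dΘ))
    {t : ℕ} (ht : t < P.T) (s : EuclideanSpace ℝ (Fin dS)) :
    P.value p θ t s =
      ∫ ξ, P.qStep (P.value p θ (t + 1)) t s (P.pol θ s + ξ) ∂(densityLaw p) := by
  have e : P.T - t = (P.T - (t + 1)) + 1 := by omega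
  unfold value
  rw [e, valueToGo]

namespace LipschitzBounds

variable {p : EuclideanSpace ℝ (Fin dA) → ℝ} {θ : EuclideanSpace ℝ (Fin dΘ)} {τ : ℝ}
  {LR LRt Lπ Lft : ℝ≥0}

theorem abs_value_succ_sub_le (h : P.LipschitzBounds p θ τ LR LRt Lπ Lft) {t : ℕ} (ht : t < P.T) :
    ∀ s ∈ P.states, ∀ s' ∈ P.states, |P.value p θ (t + 1) s - P.value p θ (t + 1) s'| ≤
      P.T * LRt * Lft ^ (P.T - 1) * ‖s - s'‖ := by
  intro s hs s' hs'
  refine (h.abs_valueToGo_sub_le (P.T - (t + 1)) (t + 1) (by omega) s hs s' hs').trans ?_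
  have h1 : ((P.T - (t + 1) : ℕ) : ℝ) ≤ P.T := by exact_mod_cast Nat.sub_le _ _
  have h2 : (Lft : ℝ) ^ (P.T - (t + 1)) ≤ Lft ^ (P.T - 1) :=
    pow_le_pow_right₀ h.one_le_coe (by omega)
  gcongr

theorem abs_value_sub_le (h : P.LipschitzBounds p θ τ LR LRt Lπ Lft) {t : ℕ} (ht : t ≤ P.T) :
    ∀ s ∈ P.states, ∀ s' ∈ P.states, |P.value p θ t s - P.value p θ t s'| ≤
      P.T * LRt * Lft ^ P.T * ‖s - s'‖ := by
  intro s hs s' hs'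
  refine (h.abs_valueToGo_sub_le (P.T - t) t (by omega) s hs s' hs').trans ?_
  have h1 : ((P.T - t : ℕ) : ℝ) ≤ P.T := by exact_mod_cast Nat.sub_le _ _
  have h2 : (Lft : ℝ) ^ (P.T - t) ≤ Lft ^ P.T := pow_le_pow_right₀ h.one_le_coe (by omega)
  gcongr

theorem continuousOn_value (h : P.LipschitzBounds p θ τ LR LRt Lπ Lft) {t : ℕ} (ht : t ≤ P.T) :
    ContinuousOn (P.value p θ t) P.states := by
  have : LipschitzOnWith (P.T * LRt * Lft ^ P.T) (P.value p θ t) P.states :=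
    .of_dist_le_mul fun x hx y hy => by
      simpa [dist_eq_norm] using h.abs_value_sub_le ht x hx y hy
  exact this.continuousOn

/-- The temporal-difference bound dominates the Lipschitz constant of the reward and that of the
continuation value, the latter also after one more transition. -/
theorem le_tdBound (h : P.LipschitzBounds p θ τ LR LRt Lπ Lft) {t : ℕ} (ht : t < P.T) :
    (LR : ℝ) + P.T * LRt * Lft ^ (P.T - 1) * Lft ≤ tdBound P.T LR LRt Lft ∧
      (P.T : ℝ) * LRt * Lft ^ (P.T - 1) ≤ tdBound P.T LR LRt Lft := by
  have h1 : (1 : ℝ) ≤ P.T := by exact_mod_cast (by omega : 1 ≤ P.T)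
  have h2 : (1 : ℝ) ≤ (Lft : ℝ) ^ P.T := one_le_pow₀ h.one_le_coe
  have e : (Lft : ℝ) ^ (P.T - 1) * Lft = Lft ^ P.T := by
    rw [← pow_succ]; congr 1; omega
  have h3 : (Lft : ℝ) ^ (P.T - 1) ≤ Lft ^ P.T := pow_le_pow_right₀ h.one_le_coe (by omega)
  have h4 : (LR : ℝ) ≤ P.T * LR * Lft ^ P.T := by
    have : (1 : ℝ) ≤ P.T * Lft ^ P.T := by nlinarith
    nlinarith [LR.2]
  have h5 : (P.T : ℝ) * LRt * Lft ^ (P.T - 1) ≤ P.T * LRt * Lft ^ P.T := by gcongr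
  have h6 : 0 ≤ (P.T : ℝ) * LR * Lft ^ P.T := by positivity
  unfold tdBound
  rw [mul_assoc _ _ (Lft : ℝ), e]
  constructor <;> linarith

theorem abs_advantage_sub_le (h : P.LipschitzBounds p θ τ LR LRt Lπ Lft) {t : ℕ} (ht : t < P.T)
    {s : EuclideanSpace ℝ (Fin dS)} (hs : s ∈ P.states) (u u' : EuclideanSpace ℝ (Fin dA)) :
    |P.advantage p θ t s u - P.advantage p θ t s u'| ≤ tdBound P.T LR LRt Lft * ‖u - u'‖ := by
  have h1 := h.abs_qStep_sub_le ht (by positivity) (h.abs_value_succ_sub_le ht) hs hs u u'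
  unfold advantage
  rw [sub_sub_sub_cancel_right]
  refine h1.trans ?_
  have h2 := mul_le_mul_of_nonneg_right (h.le_tdBound ht).1 (norm_nonneg (u - u'))
  simp only [sub_self, norm_zero]
  linarith

theorem abs_advantage_sub_le_state (h : P.LipschitzBounds p θ τ LR LRt Lπ Lft) {t : ℕ}
    (ht : t < P.T) {s s' : EuclideanSpace ℝ (Fin dS)} (hs : s ∈ P.states) (hs' : s' ∈ P.states)
    (u : EuclideanSpace ℝ (Fin dA)) :
    |P.advantage p θ t s u - P.advantage p θ t s' u| ≤
      tdBound P.T LR LRt Lft * (3 + Lπ) * ‖s - s'‖ := by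
  have h1 := h.abs_qStep_sub_le ht (by positivity) (h.abs_value_succ_sub_le ht) hs hs' u u
  have h2 := h.abs_value_sub_le ht.le s hs s' hs'
  have e : P.advantage p θ t s u - P.advantage p θ t s' u =
    (P.qStep (P.value p θ (t + 1)) t s (P.pol θ s + u) -
      P.qStep (P.value p θ (t + 1)) t s' (P.pol θ s' + u)) -
      (P.value p θ t s - P.value p θ t s') := by unfold advantage; ring
  rw [e]
  refine (abs_sub _ _).trans ((add_le_add h1 h2).trans ?_)
  have h3 := (h.le_tdBound ht).1
  have h4 : (P.T : ℝ) * LRt * Lft ^ P.T ≤ tdBound P.T LR LRt Lft := by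
    have : 0 ≤ (P.T : ℝ) * LR * Lft ^ P.T := by positivity
    unfold tdBound; linarith
  have h5 : 0 ≤ (P.T : ℝ) * LRt * Lft ^ (P.T - 1) * Lft := by positivity
  have h6 : (LR : ℝ) ≤ tdBound P.T LR LRt Lft := by linarith
  have h7 := mul_le_mul_of_nonneg_right h6 (by positivity : (0 : ℝ) ≤ (1 + Lπ) * ‖s - s'‖)
  have h8 := mul_le_mul_of_nonneg_right h4 (norm_nonneg (s - s'))
  have h9 := mul_le_mul_of_nonneg_right h3 (norm_nonneg (s - s'))
  have h10 : 0 ≤ (LR : ℝ) * ‖s - s'‖ := by positivity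
  simp only [sub_self, norm_zero, add_zero]
  linarith

theorem continuous_advantage (h : P.LipschitzBounds p θ τ LR LRt Lπ Lft) {t : ℕ} (ht : t < P.T)
    {s : EuclideanSpace ℝ (Fin dS)} (hs : s ∈ P.states) :
    Continuous (P.advantage p θ t s) :=
  (h.integrable_qStep ht (by positivity) (h.abs_value_succ_sub_le ht) hs).1.sub continuous_const

theorem integrable_advantage (h : P.LipschitzBounds p θ τ LR LRt Lπ Lft) {t : ℕ} (ht : t < P.T)
    {s : EuclideanSpace ℝ (Fin dS)} (hs : s ∈ P.states) :
    Integrable (P.advantage p θ t s) (densityLaw p) := by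
  have := h.action.isProbabilityMeasure
  exact (h.integrable_qStep ht (by positivity) (h.abs_value_succ_sub_le ht) hs).2.1.sub
    (integrable_const _)

theorem integral_advantage (h : P.LipschitzBounds p θ τ LR LRt Lπ Lft) {t : ℕ} (ht : t < P.T)
    {s : EuclideanSpace ℝ (Fin dS)} (hs : s ∈ P.states) :
    ∫ ξ, P.advantage p θ t s ξ ∂(densityLaw p) = 0 := by
  have := h.action.isProbabilityMeasure
  unfold advantage
  rw [integral_sub (h.integrable_qStep ht (by positivity) (h.abs_value_succ_sub_le ht) hs).2.1
    (integrable_const _), ← P.value_eq_integral p θ ht]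
  simp

theorem abs_advantage_le (h : P.LipschitzBounds p θ τ LR LRt Lπ Lft) {t : ℕ} (ht : t < P.T)
    {s : EuclideanSpace ℝ (Fin dS)} (hs : s ∈ P.states) (u : EuclideanSpace ℝ (Fin dA)) :
    |P.advantage p θ t s u| ≤ tdBound P.T LR LRt Lft * (‖u‖ + τ) := by
  have := h.action.abs_sub_integral_le (tdBound_nonneg _ _ _ _) (u := u)
    (h.integrable_advantage ht hs) (ae_of_all _ fun v => h.abs_advantage_sub_le ht hs u v)
  rwa [h.integral_advantage ht hs, sub_zero] at this

theorem integral_tdError (h : P.LipschitzBounds p θ τ LR LRt Lπ Lft) {t : ℕ} (ht : t < P.T)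
    {s : EuclideanSpace ℝ (Fin dS)} (hs : s ∈ P.states) (u : EuclideanSpace ℝ (Fin dA)) :
    ∫ z, P.tdError p θ t s u z ∂(P.noise t) = P.advantage p θ t s u := by
  have := (h.noise t ht).isProbabilityMeasure
  have i := h.integrable_comp_add ht (by positivity) (h.abs_value_succ_sub_le ht)
    (h.ae_step_mem ht hs (P.pol θ s + u))
  unfold tdError advantage qStep
  have e : ∀ z, P.R t s (P.pol θ s + u) + P.value p θ (t + 1) (P.f t s (P.pol θ s + u) + z) -
      P.value p θ t s = P.value p θ (t + 1) (P.f t s (P.pol θ s + u) + z) +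
        (P.R t s (P.pol θ s + u) - P.value p θ t s) := fun z => by ring
  simp_rw [e]
  rw [integral_add i (integrable_const _)]
  simp only [integral_const, probReal_univ, one_smul]
  ring

theorem abs_tdError_le (h : P.LipschitzBounds p θ τ LR LRt Lπ Lft) {t : ℕ} (ht : t < P.T)
    {s : EuclideanSpace ℝ (Fin dS)} (hs : s ∈ P.states) (u : EuclideanSpace ℝ (Fin dA))
    {z : EuclideanSpace ℝ (Fin dS)} (hz : P.f t s (P.pol θ s + u) + z ∈ P.states) :
    |P.tdError p θ t s u z| ≤ tdBound P.T LR LRt Lft * (‖u‖ + ‖z‖ + 2 * τ) := by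
  have h1 := h.abs_advantage_le ht hs u
  have i := h.integrable_comp_add ht (by positivity) (h.abs_value_succ_sub_le ht)
    (h.ae_step_mem ht hs (P.pol θ s + u))
  have h2 := (h.noise t ht).abs_sub_integral_le
    (q := fun z => P.value p θ (t + 1) (P.f t s (P.pol θ s + u) + z)) (u := z)
    (tdBound_nonneg P.T LR LRt Lft) i (by
      filter_upwards [h.ae_step_mem ht hs (P.pol θ s + u)] with z' hz'
      have := h.abs_value_succ_sub_le ht _ hz _ hz'
      rw [add_sub_add_left_eq_sub] at this
      exact this.trans (mul_le_mul_of_nonneg_right (h.le_tdBound ht).2 (norm_nonneg _)))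
  have e : P.tdError p θ t s u z = P.advantage p θ t s u +
      (P.value p θ (t + 1) (P.f t s (P.pol θ s + u) + z) -
        ∫ z, P.value p θ (t + 1) (P.f t s (P.pol θ s + u) + z) ∂(P.noise t)) := by
    unfold tdError advantage qStep; ring
  rw [e]
  refine (abs_add_le _ _).trans ((add_le_add h1 h2).trans (le_of_eq (by ring)))

end LipschitzBounds

end ControlProblem

namespace ControlProblem

variable {dS dA dΘ : ℕ}
  {P : ControlProblem (EuclideanSpace ℝ (Fin dS)) (EuclideanSpace ℝ (Fin dA))
    (EuclideanSpace ℝ (Fin dΘ))}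

/-! ### Rollouts -/

theorem noiseAt_update_of_ne (ω : P.RolloutNoise) (i : Fin P.T)
    (y : EuclideanSpace ℝ (Fin dA) × EuclideanSpace ℝ (Fin dS)) {t : ℕ} (ht : t ≠ i) :
    P.noiseAt (Function.update ω i y) t = P.noiseAt ω t := by
  unfold noiseAt
  split_ifs with hlt
  · rw [Function.update_of_ne]
    rintro rfl
    exact ht rfl
  · rfl

theorem noiseAt_update_self (ω : P.RolloutNoise) (i : Fin P.T)
    (y : EuclideanSpace ℝ (Fin dA) × EuclideanSpace ℝ (Fin dS)) :
    P.noiseAt (Function.update ω i y) i = y := by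
  simp [noiseAt]

theorem state_update (θ : EuclideanSpace ℝ (Fin dΘ)) (ω : P.RolloutNoise) (i : Fin P.T)
    (y : EuclideanSpace ℝ (Fin dA) × EuclideanSpace ℝ (Fin dS)) {t : ℕ} (ht : t ≤ i) :
    P.state θ (Function.update ω i y) t = P.state θ ω t := by
  induction t with
  | zero => rfl
  | succ t ih =>
    simp only [state, ih (by omega), P.noiseAt_update_of_ne ω i y (by omega : t ≠ i)]

theorem measurable_noiseAt (t : ℕ) : Measurable fun ω : P.RolloutNoise => P.noiseAt ω t := by
  unfold noiseAt
  split_ifs with hlt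
  · exact measurable_pi_apply _
  · exact measurable_const

theorem Regular.measurable_state {p : EuclideanSpace ℝ (Fin dA) → ℝ} (h : P.Regular p)
    {θ : EuclideanSpace ℝ (Fin dΘ)} (hθ : θ ∈ P.params) {t : ℕ} (ht : t ≤ P.T) :
    Measurable fun ω : P.RolloutNoise => P.state θ ω t := by
  induction t with
  | zero => exact measurable_const
  | succ t ih =>
    have hs := ih (by omega)
    exact ((h.measurable_f t (by omega)).comp (hs.prodMk (((h.measurable_pol θ hθ).comp hs).add
      (P.measurable_noiseAt t).fst))).add (P.measurable_noiseAt t).snd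

/-- The perturbation, relative to the policy of `θ`, of the action taken at time `t` in a rollout
with the policy of `θ'`. -/
noncomputable def perturbation (P : ControlProblem (EuclideanSpace ℝ (Fin dS))
    (EuclideanSpace ℝ (Fin dA)) (EuclideanSpace ℝ (Fin dΘ))) (θ θ' : EuclideanSpace ℝ (Fin dΘ))
    (s : EuclideanSpace ℝ (Fin dS)) : EuclideanSpace ℝ (Fin dA) := P.pol θ' s - P.pol θ s

theorem perturbation_self (θ : EuclideanSpace ℝ (Fin dΘ)) (s : EuclideanSpace ℝ (Fin dS)) :
    P.perturbation θ θ s = 0 := sub_self _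

/-- The temporal-difference error with respect to the policy of `θ` at time `t` of a rollout with
the policy of `θ'`. -/
noncomputable def rolloutTD (P : ControlProblem (EuclideanSpace ℝ (Fin dS))
    (EuclideanSpace ℝ (Fin dA)) (EuclideanSpace ℝ (Fin dΘ)))
    (p : EuclideanSpace ℝ (Fin dA) → ℝ) (θ θ' : EuclideanSpace ℝ (Fin dΘ))
    (ω : P.RolloutNoise) (t : ℕ) : ℝ :=
  P.tdError p θ t (P.state θ' ω t)
    (P.perturbation θ θ' (P.state θ' ω t) + (P.noiseAt ω t).1) (P.noiseAt ω t).2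

theorem pol_add_perturbation_add (θ θ' : EuclideanSpace ℝ (Fin dΘ)) (ω : P.RolloutNoise) (t : ℕ) :
    P.pol θ (P.state θ' ω t) + (P.perturbation θ θ' (P.state θ' ω t) + (P.noiseAt ω t).1) =
      P.action θ' ω t := by
  unfold perturbation action; abel

theorem rolloutTD_eq (p : EuclideanSpace ℝ (Fin dA) → ℝ) (θ θ' : EuclideanSpace ℝ (Fin dΘ))
    (ω : P.RolloutNoise) (t : ℕ) :
    P.rolloutTD p θ θ' ω t = P.R t (P.state θ' ω t) (P.action θ' ω t) +
      P.value p θ (t + 1) (P.state θ' ω (t + 1)) - P.value p θ t (P.state θ' ω t) := by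
  unfold rolloutTD tdError
  rw [pol_add_perturbation_add]
  rfl

/-- The rewards to go exceed the value of the current state by the sum of the temporal-difference
errors to come. -/
theorem qHat_sub_value (p : EuclideanSpace ℝ (Fin dA) → ℝ) (θ θ' : EuclideanSpace ℝ (Fin dΘ))
    (ω : P.RolloutNoise) {t : ℕ} (ht : t ≤ P.T) :
    P.qHat θ' ω t - P.value p θ t (P.state θ' ω t) =
      ∑ i ∈ Finset.Ico t P.T, P.rolloutTD p θ θ' ω i := by
  have h1 : ∀ i, P.rolloutTD p θ θ' ω i = P.R i (P.state θ' ω i) (P.action θ' ω i) +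
      (P.value p θ (i + 1) (P.state θ' ω (i + 1)) - P.value p θ i (P.state θ' ω i)) := fun i => by
    rw [rolloutTD_eq]; ring
  simp only [h1, Finset.sum_add_distrib]
  rw [Finset.sum_Ico_sub (fun i => P.value p θ i (P.state θ' ω i)) ht, value_horizon]
  unfold qHat
  ring

theorem sum_reward_eq (p : EuclideanSpace ℝ (Fin dA) → ℝ) (θ θ' : EuclideanSpace ℝ (Fin dΘ))
    (ω : P.RolloutNoise) :
    ∑ t ∈ Finset.range P.T, P.R t (P.state θ' ω t) (P.action θ' ω t) =
      P.value p θ 0 P.s₀ + ∑ t ∈ Finset.range P.T, P.rolloutTD p θ θ' ω t := by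
  have := P.qHat_sub_value p θ θ' ω (Nat.zero_le _)
  rw [Nat.Ico_zero_eq_range] at this
  unfold qHat at this
  rw [Nat.Ico_zero_eq_range] at this
  change _ - P.value p θ 0 P.s₀ = _ at this
  linarith

namespace LipschitzBounds

variable {p : EuclideanSpace ℝ (Fin dA) → ℝ} {θ : EuclideanSpace ℝ (Fin dΘ)} {τ : ℝ}
  {LR LRt Lπ Lft : ℝ≥0}

theorem isProbabilityMeasure_prod (h : P.LipschitzBounds p θ τ LR LRt Lπ Lft) (t : Fin P.T) :
    IsProbabilityMeasure ((densityLaw p).prod (P.noise t)) := by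
  have := h.action.isProbabilityMeasure
  have := (h.noise t t.2).isProbabilityMeasure
  infer_instance

theorem isProbabilityMeasure_rolloutLaw (h : P.LipschitzBounds p θ τ LR LRt Lπ Lft) :
    IsProbabilityMeasure (P.rolloutLaw p) := by
  have := h.isProbabilityMeasure_prod
  unfold rolloutLaw
  infer_instance

theorem ae_prod_step_mem (h : P.LipschitzBounds p θ τ LR LRt Lπ Lft) {t : ℕ} (ht : t < P.T)
    {s : EuclideanSpace ℝ (Fin dS)} (hs : s ∈ P.states) (m : EuclideanSpace ℝ (Fin dA)) :
    ∀ᵐ y ∂((densityLaw p).prod (P.noise t)), P.f t s (m + y.1) + y.2 ∈ P.states := by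
  have := (h.noise t ht).isProbabilityMeasure
  have hmf : Measurable fun y : EuclideanSpace ℝ (Fin dA) × EuclideanSpace ℝ (Fin dS) =>
      P.f t s (m + y.1) + y.2 :=
    ((h.regular.measurable_f t ht).comp
      (measurable_const.prodMk (measurable_fst.const_add _))).add measurable_snd
  have hset := hmf h.regular.measurableSet_states
  refine (Measure.ae_prod_iff_ae_ae hset).2 (ae_of_all _ fun ξ => ?_)
  exact h.ae_step_mem ht hs (m + ξ)

theorem ae_state_mem (h : P.LipschitzBounds p θ τ LR LRt Lπ Lft)
    {θ' : EuclideanSpace ℝ (Fin dΘ)} (hθ' : θ' ∈ P.params) {t : ℕ} (ht : t ≤ P.T) :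
    ∀ᵐ ω ∂(P.rolloutLaw p), P.state θ' ω t ∈ P.states := by
  have := h.isProbabilityMeasure_prod
  induction t with
  | zero => exact ae_of_all _ fun ω => h.regular.s₀_mem
  | succ t ih =>
    have ht' : t < P.T := by omega
    have hm := h.regular.measurable_state hθ' ht
    suffices hsuff : ∀ᵐ ω ∂(P.rolloutLaw p),
        ω ∈ (fun ω => P.state θ' ω (t + 1)) ⁻¹' P.states from hsuff
    refine ae_pi_of_ae_update _ ⟨t, ht'⟩ (hm h.regular.measurableSet_states) ?_
    filter_upwards [ih ht'.le] with ω hω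
    have hpn := (h.noise t ht').isProbabilityMeasure
    have e : ∀ y, P.state θ' (Function.update ω ⟨t, ht'⟩ y) (t + 1) =
        P.f t (P.state θ' ω t) (P.pol θ' (P.state θ' ω t) + y.1) + y.2 := fun y => by
      have e1 := P.noiseAt_update_self ω ⟨t, ht'⟩ y
      simp only at e1
      rw [state, P.state_update θ' ω ⟨t, ht'⟩ y le_rfl, e1]
    simp only [Set.mem_preimage, e]
    exact h.ae_prod_step_mem ht' hω _

theorem norm_perturbation_le (h : P.LipschitzBounds p θ τ LR LRt Lπ Lft)
    {θ' : EuclideanSpace ℝ (Fin dΘ)} (hθ' : θ' ∈ P.params) {s : EuclideanSpace ℝ (Fin dS)}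
    (hs : s ∈ P.states) : ‖P.perturbation θ θ' s‖ ≤ Lπ * ‖θ' - θ‖ := by
  simpa [perturbation] using h.norm_pol_sub_le hθ' h.mem_params hs hs

theorem aestronglyMeasurable_rolloutTD (h : P.LipschitzBounds p θ τ LR LRt Lπ Lft)
    {θ' : EuclideanSpace ℝ (Fin dΘ)} (hθ' : θ' ∈ P.params) {t : ℕ} (ht : t < P.T) :
    AEStronglyMeasurable (fun ω => P.rolloutTD p θ θ' ω t) (P.rolloutLaw p) := by
  have hs := h.regular.measurable_state hθ' ht.le
  simp only [rolloutTD_eq]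
  refine (AEStronglyMeasurable.add ?_ ?_).sub ?_
  · exact ((h.regular.measurable_R t ht).comp (hs.prodMk
      (((h.regular.measurable_pol θ' hθ').comp hs).add
        (P.measurable_noiseAt t).fst))).aestronglyMeasurable
  · exact (h.continuousOn_value (by omega)).aestronglyMeasurable_comp
      h.regular.measurableSet_states (h.regular.measurable_state hθ' ht) (h.ae_state_mem hθ' ht)
  · exact (h.continuousOn_value ht.le).aestronglyMeasurable_comp
      h.regular.measurableSet_states hs (h.ae_state_mem hθ' ht.le)

theorem abs_rolloutTD_le (h : P.LipschitzBounds p θ τ LR LRt Lπ Lft)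
    {θ' : EuclideanSpace ℝ (Fin dΘ)} (hθ' : θ' ∈ P.params) {t : ℕ} (ht : t < P.T) :
    ∀ᵐ ω ∂(P.rolloutLaw p), |P.rolloutTD p θ θ' ω t| ≤ tdBound P.T LR LRt Lft *
      (Lπ * ‖θ' - θ‖ + ‖(P.noiseAt ω t).1‖ + ‖(P.noiseAt ω t).2‖ + 2 * τ) := by
  filter_upwards [h.ae_state_mem hθ' ht.le, h.ae_state_mem hθ' ht] with ω h1 h2
  refine (h.abs_tdError_le ht h1 _ ?_).trans ?_
  · rw [pol_add_perturbation_add]; exact h2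
  · have := norm_add_le (P.perturbation θ θ' (P.state θ' ω t)) (P.noiseAt ω t).1
    have h3 := h.norm_perturbation_le hθ' h1
    exact mul_le_mul_of_nonneg_left (by linarith) (tdBound_nonneg _ _ _ _)

theorem integrable_comp_noiseAt (h : P.LipschitzBounds p θ τ LR LRt Lπ Lft) {t : ℕ}
    (ht : t < P.T) {F : Type*} [NormedAddCommGroup F]
    {q : EuclideanSpace ℝ (Fin dA) × EuclideanSpace ℝ (Fin dS) → F}
    (hq : Integrable q ((densityLaw p).prod (P.noise t))) :
    Integrable (fun ω => q (P.noiseAt ω t)) (P.rolloutLaw p) := by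
  have := h.isProbabilityMeasure_prod
  have e : ∀ ω : P.RolloutNoise, P.noiseAt ω t = ω ⟨t, ht⟩ := fun ω => by simp [noiseAt, ht]
  simp only [e]
  exact integrable_comp_eval (i := (⟨t, ht⟩ : Fin P.T))
    (μ := fun t : Fin P.T => (densityLaw p).prod (P.noise t)) hq

theorem integral_comp_noiseAt (h : P.LipschitzBounds p θ τ LR LRt Lπ Lft) {t : ℕ}
    (ht : t < P.T) {q : EuclideanSpace ℝ (Fin dA) × EuclideanSpace ℝ (Fin dS) → ℝ}
    (hq : Integrable q ((densityLaw p).prod (P.noise t))) :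
    ∫ ω, q (P.noiseAt ω t) ∂(P.rolloutLaw p) = ∫ y, q y ∂((densityLaw p).prod (P.noise t)) := by
  have := h.isProbabilityMeasure_prod
  have e : ∀ ω : P.RolloutNoise, P.noiseAt ω t = ω ⟨t, ht⟩ := fun ω => by simp [noiseAt, ht]
  simp only [e]
  exact integral_comp_eval (i := (⟨t, ht⟩ : Fin P.T))
    (μ := fun t : Fin P.T => (densityLaw p).prod (P.noise t)) hq.1

theorem integrable_norm_noiseAt_pow (h : P.LipschitzBounds p θ τ LR LRt Lπ Lft) {t : ℕ}
    (ht : t < P.T) (k : ℕ) :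
    Integrable (fun ω => ‖(P.noiseAt ω t).1‖ ^ k) (P.rolloutLaw p) ∧
      Integrable (fun ω => ‖(P.noiseAt ω t).2‖ ^ k) (P.rolloutLaw p) := by
  have := h.action.isProbabilityMeasure
  have := (h.noise t ht).isProbabilityMeasure
  exact ⟨h.integrable_comp_noiseAt ht ((h.action.integrable_norm_pow k).comp_fst _),
    h.integrable_comp_noiseAt ht (((h.noise t ht).integrable_norm_pow k).comp_snd _)⟩

theorem integrable_rolloutTD (h : P.LipschitzBounds p θ τ LR LRt Lπ Lft)
    {θ' : EuclideanSpace ℝ (Fin dΘ)} (hθ' : θ' ∈ P.params) {t : ℕ} (ht : t < P.T) :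
    Integrable (fun ω => P.rolloutTD p θ θ' ω t) (P.rolloutLaw p) := by
  have := h.isProbabilityMeasure_rolloutLaw
  obtain ⟨i1, i2⟩ := h.integrable_norm_noiseAt_pow ht 1
  simp only [pow_one] at i1 i2
  refine (((((integrable_const (Lπ * ‖θ' - θ‖)).add i1).add i2).add
    (integrable_const (2 * τ))).const_mul (tdBound P.T LR LRt Lft)).mono'
    (h.aestronglyMeasurable_rolloutTD hθ' ht) ?_
  filter_upwards [h.abs_rolloutTD_le hθ' ht] with ω hω
  exact hω

/-- Averaging a temporal-difference error over the noise of its own time step leaves the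
advantage; `K` is a weight that involves only the action noise of that step. -/
theorem integral_rolloutTD_smul (h : P.LipschitzBounds p θ τ LR LRt Lπ Lft)
    {θ' : EuclideanSpace ℝ (Fin dΘ)} (hθ' : θ' ∈ P.params) {t : ℕ} (ht : t < P.T)
    {F : Type*} [NormedAddCommGroup F] [NormedSpace ℝ F] [CompleteSpace F]
    {K : P.RolloutNoise → F} {k : P.RolloutNoise → EuclideanSpace ℝ (Fin dA) → F}
    (hK : ∀ ω y, K (Function.update ω ⟨t, ht⟩ y) = k ω y.1)
    (hi : Integrable (fun ω => P.rolloutTD p θ θ' ω t • K ω) (P.rolloutLaw p)) :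
    Integrable (fun ω => ∫ ξ, P.advantage p θ t (P.state θ' ω t)
        (P.perturbation θ θ' (P.state θ' ω t) + ξ) • k ω ξ ∂(densityLaw p)) (P.rolloutLaw p) ∧
    ∫ ω, P.rolloutTD p θ θ' ω t • K ω ∂(P.rolloutLaw p) =
      ∫ ω, ∫ ξ, P.advantage p θ t (P.state θ' ω t)
        (P.perturbation θ θ' (P.state θ' ω t) + ξ) • k ω ξ ∂(densityLaw p)
        ∂(P.rolloutLaw p) := by
  have := h.isProbabilityMeasure_prod
  have := h.action.isProbabilityMeasure
  have := (h.noise t ht).isProbabilityMeasure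
  unfold rolloutLaw at hi ⊢
  have hi2 := ((measurePreserving_update _ (⟨t, ht⟩ : Fin P.T)).integrable_comp_of_integrable
    hi).integral_prod_left
  rw [integral_pi_eq_integral_integral_update _ (⟨t, ht⟩ : Fin P.T) hi]
  suffices hae : _ =ᵐ[_] _ from ⟨hi2.congr hae, integral_congr_ae hae⟩
  filter_upwards [ae_integrable_update _ (⟨t, ht⟩ : Fin P.T) hi, h.ae_state_mem hθ' ht.le]
    with ω h1 h2
  have e : ∀ y, P.rolloutTD p θ θ' (Function.update ω ⟨t, ht⟩ y) t •
      K (Function.update ω ⟨t, ht⟩ y) = P.tdError p θ t (P.state θ' ω t)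
        (P.perturbation θ θ' (P.state θ' ω t) + y.1) y.2 • k ω y.1 := fun y => by
    have e1 := P.noiseAt_update_self ω ⟨t, ht⟩ y
    simp only at e1
    rw [hK, rolloutTD, P.state_update θ' ω ⟨t, ht⟩ y le_rfl, e1]
  simp only [Function.comp_apply, e] at h1 ⊢
  rw [integral_prod _ h1]
  refine integral_congr_ae (ae_of_all _ fun ξ => ?_)
  simp only
  rw [integral_smul_const, h.integral_tdError ht h2]

end LipschitzBounds

end ControlProblem

namespace ControlProblem

variable {dS dA dΘ : ℕ}
  {P : ControlProblem (EuclideanSpace ℝ (Fin dS)) (EuclideanSpace ℝ (Fin dA))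
    (EuclideanSpace ℝ (Fin dΘ))}

/-! ### The derivative of the policy in the parameter -/

/-- `D s` is the derivative at `θ` of `θ' ↦ π_θ'(s)`, with estimates uniform in the state `s`. -/
structure HasUniformPolicyDeriv (P : ControlProblem (EuclideanSpace ℝ (Fin dS))
    (EuclideanSpace ℝ (Fin dA)) (EuclideanSpace ℝ (Fin dΘ))) (θ : EuclideanSpace ℝ (Fin dΘ))
    (D : EuclideanSpace ℝ (Fin dS) → EuclideanSpace ℝ (Fin dΘ) →L[ℝ] EuclideanSpace ℝ (Fin dA))
    (Lπ C r : ℝ) : Prop where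
  const_nonneg : 0 ≤ C
  radius_pos : 0 < r
  ball_subset : Metric.ball θ r ⊆ P.params
  hasFDerivAt : ∀ s ∈ P.states, HasFDerivAt (fun θ' => P.pol θ' s) (D s) θ
  norm_le : ∀ s ∈ P.states, ‖D s‖ ≤ Lπ
  norm_sub_le : ∀ s ∈ P.states, ∀ s' ∈ P.states, ‖D s - D s'‖ ≤ C * ‖s - s'‖
  norm_remainder_le : ∀ θ' ∈ Metric.ball θ r, ∀ s ∈ P.states,
    ‖P.pol θ' s - P.pol θ s - D s (θ' - θ)‖ ≤ C * ‖θ' - θ‖ ^ 2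

theorem LipschitzBounds.exists_hasUniformPolicyDeriv {p : EuclideanSpace ℝ (Fin dA) → ℝ}
    {θ : EuclideanSpace ℝ (Fin dΘ)} {τ : ℝ} {LR LRt Lπ Lft : ℝ≥0}
    (h : P.LipschitzBounds p θ τ LR LRt Lπ Lft) :
    ∃ D C r, P.HasUniformPolicyDeriv θ D Lπ C r := by
  obtain ⟨-, hC2, C, hC⟩ := h.regular.smooth_pol
  have hopen := h.regular.isOpen_params
  obtain ⟨r, hr, hball⟩ := Metric.isOpen_iff.1 hopen θ h.mem_params
  set ι : EuclideanSpace ℝ (Fin dΘ) →L[ℝ]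
      WithLp 2 (EuclideanSpace ℝ (Fin dΘ) × EuclideanSpace ℝ (Fin dS)) :=
    (WithLp.prodContinuousLinearEquiv 2 ℝ (EuclideanSpace ℝ (Fin dΘ))
      (EuclideanSpace ℝ (Fin dS))).symm.toContinuousLinearMap.comp
      (ContinuousLinearMap.inl ℝ _ _) with hι
  have hιn : ‖ι‖ ≤ 1 := ContinuousLinearMap.opNorm_le_bound _ zero_le_one fun v => by
    rw [one_mul, WithLp.prod_norm_eq_of_L2]
    simp [hι]
  set E : EuclideanSpace ℝ (Fin dΘ) → EuclideanSpace ℝ (Fin dS) →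
      EuclideanSpace ℝ (Fin dΘ) →L[ℝ] EuclideanSpace ℝ (Fin dA) := fun θ' s =>
    (fderivWithin ℝ P.polJoint P.paramState (WithLp.toLp 2 (θ', s))).comp ι with hE
  have hder : ∀ θ' ∈ P.params, ∀ s ∈ P.states, HasFDerivAt (fun θ' => P.pol θ' s) (E θ' s) θ' := by
    intro θ' hθ' s hs
    have hmem : (WithLp.toLp 2 (θ', s) :
        WithLp 2 (EuclideanSpace ℝ (Fin dΘ) × EuclideanSpace ℝ (Fin dS))) ∈ P.paramState :=
      ⟨hθ', hs⟩
    have h1 := ((hC2.differentiableOn (by norm_num)) _ hmem).hasFDerivWithinAt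
    have h2 : HasFDerivWithinAt (fun x => (WithLp.toLp 2 (x, s) :
        WithLp 2 (EuclideanSpace ℝ (Fin dΘ) × EuclideanSpace ℝ (Fin dS)))) ι P.params θ' := by
      have h3 : HasFDerivAt (fun x => ι x + WithLp.toLp 2 (0, s)) ι θ' :=
        ι.hasFDerivAt.add_const _
      refine (h3.congr_of_eventuallyEq (Eventually.of_forall fun x => ?_)).hasFDerivWithinAt
      apply (WithLp.equiv 2 _).injective
      simp [hι]
    have hmaps : Set.MapsTo (fun x => (WithLp.toLp 2 (x, s) :
        WithLp 2 (EuclideanSpace ℝ (Fin dΘ) × EuclideanSpace ℝ (Fin dS)))) P.params P.paramState :=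
      fun x hx => ⟨hx, hs⟩
    have h4 := h1.comp θ' h2 hmaps
    exact h4.hasFDerivAt (hopen.mem_nhds hθ')
  have hLip : ∀ θ₁ ∈ P.params, ∀ θ₂ ∈ P.params, ∀ s ∈ P.states, ∀ s' ∈ P.states,
      ‖E θ₁ s - E θ₂ s'‖ ≤ C * (‖θ₁ - θ₂‖ + ‖s - s'‖) := by
    intro θ₁ h₁ θ₂ h₂ s hs s' hs'
    have h5 := hC.dist_le_mul (WithLp.toLp 2 (θ₁, s)) ⟨h₁, hs⟩ (WithLp.toLp 2 (θ₂, s')) ⟨h₂, hs'⟩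
    rw [dist_eq_norm] at h5
    have h6 := mul_le_mul_of_nonneg_left (dist_toLp_le θ₁ θ₂ s s') C.2
    rw [hE]
    simp only
    rw [← ContinuousLinearMap.sub_comp]
    refine (ContinuousLinearMap.opNorm_comp_le _ _).trans ?_
    calc _ ≤ ‖fderivWithin ℝ P.polJoint P.paramState (WithLp.toLp 2 (θ₁, s)) -
          fderivWithin ℝ P.polJoint P.paramState (WithLp.toLp 2 (θ₂, s'))‖ * 1 := by gcongr
      _ ≤ _ := by rw [mul_one]; exact h5.trans h6
  refine ⟨E θ, C, r, C.2, hr, hball, fun s hs => hder θ h.mem_params s hs, fun s hs => ?_,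
    fun s hs s' hs' => ?_, fun θ' hθ' s hs => ?_⟩
  · refine (hder θ h.mem_params s hs).le_of_lip' Lπ.2 ?_
    filter_upwards [hopen.mem_nhds h.mem_params] with x hx
    simpa using h.norm_pol_sub_le hx h.mem_params hs hs
  · simpa using hLip θ h.mem_params θ h.mem_params s hs s' hs'
  · have hsub : Metric.closedBall θ ‖θ' - θ‖ ⊆ P.params := fun x hx =>
      hball (Metric.mem_ball.2 ((Metric.mem_closedBall.1 hx).trans_lt (by
        rw [← dist_eq_norm]; exact Metric.mem_ball.1 hθ')))
    have := (convex_closedBall θ ‖θ' - θ‖).norm_image_sub_le_of_norm_hasFDerivWithin_le'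
      (f := fun θ' => P.pol θ' s) (f' := fun θ' => E θ' s) (φ := E θ s) (C := C * ‖θ' - θ‖)
      (x := θ) (y := θ') (fun x hx => (hder x (hsub hx) s hs).hasFDerivWithinAt)
      (fun x hx => by
        have h7 := hLip x (hsub hx) θ h.mem_params s hs s hs
        rw [sub_self, norm_zero, add_zero] at h7
        refine h7.trans (mul_le_mul_of_nonneg_left ?_ C.2)
        rw [← dist_eq_norm]; exact hx)
      (Metric.mem_closedBall_self (norm_nonneg _))
      (by rw [Metric.mem_closedBall, dist_eq_norm])
    rw [pow_two, ← mul_assoc]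
    exact this

theorem HasUniformPolicyDeriv.continuousOn {θ : EuclideanSpace ℝ (Fin dΘ)}
    {D : EuclideanSpace ℝ (Fin dS) → EuclideanSpace ℝ (Fin dΘ) →L[ℝ] EuclideanSpace ℝ (Fin dA)}
    {Lπ C r : ℝ} (hD : P.HasUniformPolicyDeriv θ D Lπ C r) : ContinuousOn D P.states := by
  have : LipschitzOnWith C.toNNReal D P.states := .of_dist_le_mul fun x hx y hy => by
    rw [Real.coe_toNNReal C hD.const_nonneg, dist_eq_norm, dist_eq_norm]
    exact hD.norm_sub_le x hx y hy
  exact this.continuousOn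

/-- The score of the Gaussian policy. -/
theorem HasUniformPolicyDeriv.score_eq {θ : EuclideanSpace ℝ (Fin dΘ)}
    {D : EuclideanSpace ℝ (Fin dS) → EuclideanSpace ℝ (Fin dΘ) →L[ℝ] EuclideanSpace ℝ (Fin dA)}
    {Lπ C r : ℝ} (hD : P.HasUniformPolicyDeriv θ D Lπ C r) {σ : ℝ} (hσ : 0 < σ)
    {s : EuclideanSpace ℝ (Fin dS)} (hs : s ∈ P.states) (ξ : EuclideanSpace ℝ (Fin dA)) :
    P.score (gaussianDensity _ σ) θ s (P.pol θ s + ξ) =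
      (σ ^ 2)⁻¹ • ContinuousLinearMap.adjoint (D s) ξ := by
  unfold score
  simp only [log_gaussianDensity hσ]
  refine HasGradientAt.gradient ?_
  rw [hasGradientAt_iff_hasFDerivAt]
  have h1 := ((hD.hasFDerivAt s hs).const_sub (P.pol θ s + ξ)).norm_sq
  have h2 := ((h1.neg.mul_const (2 * σ ^ 2)⁻¹).const_add
    (Real.log ((2 * Real.pi * σ ^ 2) ^
      (-(Module.finrank ℝ (EuclideanSpace ℝ (Fin dA)) : ℝ) / 2))))
  simp only [div_eq_mul_inv] at h2 ⊢
  refine h2.congr_fderiv ?_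
  ext v
  simp [ContinuousLinearMap.adjoint_inner_left]
  ring

end ControlProblem

namespace ControlProblem

variable {dS dA dΘ : ℕ}
  {P : ControlProblem (EuclideanSpace ℝ (Fin dS)) (EuclideanSpace ℝ (Fin dA))
    (EuclideanSpace ℝ (Fin dΘ))}

/-! ### The policy gradient theorem -/

/-- The likelihood-ratio gradient of the advantage `∫ A_t(s, h + ξ) dξ` in the shift `h`, at
`h = 0`. -/
noncomputable def advantageGrad (P : ControlProblem (EuclideanSpace ℝ (Fin dS))
    (EuclideanSpace ℝ (Fin dA)) (EuclideanSpace ℝ (Fin dΘ))) (σ : ℝ)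
    (θ : EuclideanSpace ℝ (Fin dΘ)) (t : ℕ) (s : EuclideanSpace ℝ (Fin dS)) :
    EuclideanSpace ℝ (Fin dA) :=
  ∫ ξ, (P.advantage (gaussianDensity _ σ) θ t s ξ / σ ^ 2) • ξ ∂(densityLaw (gaussianDensity _ σ))

/-- The contribution of the state `s` at time `t` to the policy gradient. -/
noncomputable def localGrad (P : ControlProblem (EuclideanSpace ℝ (Fin dS))
    (EuclideanSpace ℝ (Fin dA)) (EuclideanSpace ℝ (Fin dΘ))) (σ : ℝ)
    (θ : EuclideanSpace ℝ (Fin dΘ))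
    (D : EuclideanSpace ℝ (Fin dS) → EuclideanSpace ℝ (Fin dΘ) →L[ℝ] EuclideanSpace ℝ (Fin dA))
    (t : ℕ) (s : EuclideanSpace ℝ (Fin dS)) : EuclideanSpace ℝ (Fin dΘ) :=
  ContinuousLinearMap.adjoint (D s) (P.advantageGrad σ θ t s)

/-- The policy gradient at `θ`. -/
noncomputable def policyGrad (P : ControlProblem (EuclideanSpace ℝ (Fin dS))
    (EuclideanSpace ℝ (Fin dA)) (EuclideanSpace ℝ (Fin dΘ))) (σ : ℝ)
    (θ : EuclideanSpace ℝ (Fin dΘ))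
    (D : EuclideanSpace ℝ (Fin dS) → EuclideanSpace ℝ (Fin dΘ) →L[ℝ] EuclideanSpace ℝ (Fin dA)) :
    EuclideanSpace ℝ (Fin dΘ) :=
  ∑ t ∈ Finset.range P.T,
    ∫ ω, P.localGrad σ θ D t (P.state θ ω t) ∂(P.rolloutLaw (gaussianDensity _ σ))

theorem pgEstimate_eq (p : EuclideanSpace ℝ (Fin dA) → ℝ) (θ : EuclideanSpace ℝ (Fin dΘ))
    (ω : P.RolloutNoise) :
    P.pgEstimate p θ ω = ∑ t ∈ Finset.range P.T, ∑ i ∈ Finset.Ico t P.T,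
      P.rolloutTD p θ θ ω i • P.score p θ (P.state θ ω t) (P.action θ ω t) := by
  unfold pgEstimate
  refine Finset.sum_congr rfl fun t ht => ?_
  rw [P.qHat_sub_value p θ θ ω (Finset.mem_range.1 ht).le, Finset.sum_smul]

namespace LipschitzBounds

section General

variable {p : EuclideanSpace ℝ (Fin dA) → ℝ} {θ : EuclideanSpace ℝ (Fin dΘ)} {τ : ℝ}
  {LR LRt Lπ Lft : ℝ≥0}

/-- The mean advantage at time `t` along rollouts with the policy of `θ'`. -/
theorem integral_rolloutTD (h : P.LipschitzBounds p θ τ LR LRt Lπ Lft)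
    {θ' : EuclideanSpace ℝ (Fin dΘ)} (hθ' : θ' ∈ P.params) {t : ℕ} (ht : t < P.T) :
    Integrable (fun ω => ∫ ξ, P.advantage p θ t (P.state θ' ω t)
        (P.perturbation θ θ' (P.state θ' ω t) + ξ) ∂(densityLaw p)) (P.rolloutLaw p) ∧
    ∫ ω, P.rolloutTD p θ θ' ω t ∂(P.rolloutLaw p) =
      ∫ ω, ∫ ξ, P.advantage p θ t (P.state θ' ω t)
        (P.perturbation θ θ' (P.state θ' ω t) + ξ) ∂(densityLaw p) ∂(P.rolloutLaw p) := by
  have := h.integral_rolloutTD_smul hθ' ht (K := fun _ => (1 : ℝ)) (k := fun _ _ => 1)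
    (fun _ _ => rfl) (by simpa using h.integrable_rolloutTD hθ' ht)
  simpa using this

theorem J_eq (h : P.LipschitzBounds p θ τ LR LRt Lπ Lft) {θ' : EuclideanSpace ℝ (Fin dΘ)}
    (hθ' : θ' ∈ P.params) :
    P.J p θ' = P.value p θ 0 P.s₀ +
      ∑ t ∈ Finset.range P.T, ∫ ω, P.rolloutTD p θ θ' ω t ∂(P.rolloutLaw p) := by
  have := h.isProbabilityMeasure_rolloutLaw
  unfold J
  simp only [P.sum_reward_eq p θ θ']
  rw [integral_add (integrable_const _) (integrable_finsetSum _ fun t ht =>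
    h.integrable_rolloutTD hθ' (Finset.mem_range.1 ht)), integral_finsetSum _ fun t ht =>
      h.integrable_rolloutTD hθ' (Finset.mem_range.1 ht)]
  simp

/-- The performance difference lemma. -/
theorem J_sub_J (h : P.LipschitzBounds p θ τ LR LRt Lπ Lft) {θ' : EuclideanSpace ℝ (Fin dΘ)}
    (hθ' : θ' ∈ P.params) :
    P.J p θ' - P.J p θ = ∑ t ∈ Finset.range P.T, ∫ ω, ∫ ξ, P.advantage p θ t (P.state θ' ω t)
        (P.perturbation θ θ' (P.state θ' ω t) + ξ) ∂(densityLaw p) ∂(P.rolloutLaw p) := by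
  rw [h.J_eq hθ', h.J_eq h.mem_params, add_sub_add_left_eq_sub]
  have h0 : ∑ t ∈ Finset.range P.T, ∫ ω, P.rolloutTD p θ θ ω t ∂(P.rolloutLaw p) = 0 := by
    refine Finset.sum_eq_zero fun t ht => ?_
    have ht' := Finset.mem_range.1 ht
    rw [(h.integral_rolloutTD h.mem_params ht').2]
    refine integral_eq_zero_of_ae ?_
    filter_upwards [h.ae_state_mem h.mem_params ht'.le] with ω hω
    simp [perturbation_self, h.integral_advantage ht' hω]
  rw [h0, sub_zero]
  exact Finset.sum_congr rfl fun t ht => (h.integral_rolloutTD hθ' (Finset.mem_range.1 ht)).2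

/-- With the same noise, the states visited under two policies are close. -/
theorem exists_norm_state_sub_le (h : P.LipschitzBounds p θ τ LR LRt Lπ Lft) {t : ℕ}
    (ht : t ≤ P.T) : ∃ c : ℝ, 0 ≤ c ∧ ∀ θ' ∈ P.params, ∀ᵐ ω ∂(P.rolloutLaw p),
      ‖P.state θ' ω t - P.state θ ω t‖ ≤ c * ‖θ' - θ‖ := by
  induction t with
  | zero => exact ⟨0, le_rfl, fun θ' _ => ae_of_all _ fun ω => by simp [state]⟩
  | succ t ih =>
    obtain ⟨c, hc, ih⟩ := ih (by omega)
    refine ⟨Lft * (c + Lπ), by positivity, fun θ' hθ' => ?_⟩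
    filter_upwards [ih θ' hθ', h.ae_state_mem hθ' (by omega : t ≤ P.T),
      h.ae_state_mem h.mem_params (by omega : t ≤ P.T)] with ω h1 h2 h3
    have h4 := h.norm_fTilde_sub_le (by omega : t < P.T) h2 h3
      (P.perturbation θ θ' (P.state θ' ω t) + (P.noiseAt ω t).1) (P.noiseAt ω t).1
    rw [pol_add_perturbation_add, add_sub_cancel_right] at h4
    have h5 := h.norm_perturbation_le hθ' h2
    simp only [state, add_sub_add_right_eq_sub]
    refine h4.trans ?_
    have h6 := mul_le_mul_of_nonneg_left (add_le_add h1 h5) Lft.2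
    refine h6.trans (le_of_eq (by simp only [NNReal.val_eq_coe]; ring))

end General

variable {σ : ℝ} {θ : EuclideanSpace ℝ (Fin dΘ)} {τ : ℝ} {LR LRt Lπ Lft : ℝ≥0}

theorem integrable_advantage_smul
    (h : P.LipschitzBounds (gaussianDensity _ σ) θ τ LR LRt Lπ Lft)
    {t : ℕ} (ht : t < P.T) {s : EuclideanSpace ℝ (Fin dS)} (hs : s ∈ P.states) :
    Integrable (fun ξ => (P.advantage (gaussianDensity _ σ) θ t s ξ / σ ^ 2) • ξ)
      (densityLaw (gaussianDensity (EuclideanSpace ℝ (Fin dA)) σ)) := by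
  have i := (((h.action.integrable_norm_pow 2).add (h.action.integrable_norm.const_mul τ)).const_mul
    (tdBound P.T LR LRt Lft / σ ^ 2))
  refine i.mono' (((h.continuous_advantage ht hs).div_const _).smul
    continuous_id).aestronglyMeasurable (ae_of_all _ fun ξ => ?_)
  rw [norm_smul, norm_div, Real.norm_eq_abs, Real.norm_of_nonneg (by positivity : 0 ≤ σ ^ 2)]
  have := mul_le_mul_of_nonneg_right (h.abs_advantage_le ht hs ξ) (norm_nonneg ξ)
  simp only [Pi.add_apply]
  rw [div_mul_eq_mul_div, div_mul_eq_mul_div]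
  exact div_le_div_of_nonneg_right (this.trans (le_of_eq (by ring))) (by positivity)

theorem exists_norm_advantageGrad_le
    (h : P.LipschitzBounds (gaussianDensity _ σ) θ τ LR LRt Lπ Lft) :
    ∃ c : ℝ, 0 ≤ c ∧ ∀ t < P.T, ∀ s ∈ P.states, ‖P.advantageGrad σ θ t s‖ ≤ c ∧
      ∀ s' ∈ P.states, ‖P.advantageGrad σ θ t s - P.advantageGrad σ θ t s'‖ ≤ c * ‖s - s'‖ := by
  set γ := densityLaw (gaussianDensity (EuclideanSpace ℝ (Fin dA)) σ)
  have hτ := h.action.pos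
  have hB := tdBound_nonneg P.T LR LRt Lft
  set B := tdBound P.T LR LRt Lft
  have i1 : Integrable (fun ξ : EuclideanSpace ℝ (Fin dA) => B * (‖ξ‖ + τ) / σ ^ 2 * ‖ξ‖) γ := by
    have i := (((h.action.integrable_norm_pow 2).add
      (h.action.integrable_norm.const_mul τ)).const_mul (B / σ ^ 2))
    refine i.congr (ae_of_all _ fun ξ => ?_)
    simp only [Pi.add_apply]; ring
  have i2 : Integrable (fun ξ : EuclideanSpace ℝ (Fin dA) => B * (3 + Lπ) / σ ^ 2 * ‖ξ‖) γ :=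
    h.action.integrable_norm.const_mul _
  have n1 : 0 ≤ ∫ ξ : EuclideanSpace ℝ (Fin dA), B * (‖ξ‖ + τ) / σ ^ 2 * ‖ξ‖ ∂γ :=
    integral_nonneg fun _ => by positivity
  have n2 : 0 ≤ ∫ ξ : EuclideanSpace ℝ (Fin dA), B * (3 + Lπ) / σ ^ 2 * ‖ξ‖ ∂γ :=
    integral_nonneg fun _ => by positivity
  refine ⟨_, add_nonneg n1 n2, fun t ht s hs => ⟨?_, fun s' hs' => ?_⟩⟩
  · refine le_trans ?_ (le_add_of_nonneg_right n2)
    refine norm_integral_le_of_norm_le i1 (ae_of_all _ fun ξ => ?_)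
    rw [norm_smul, norm_div, Real.norm_eq_abs, Real.norm_of_nonneg (by positivity : 0 ≤ σ ^ 2)]
    gcongr
    exact h.abs_advantage_le ht hs ξ
  · refine le_trans ?_ (mul_le_mul_of_nonneg_right (le_add_of_nonneg_left n1) (norm_nonneg _))
    unfold advantageGrad
    rw [← integral_sub (h.integrable_advantage_smul ht hs) (h.integrable_advantage_smul ht hs'),
      ← integral_mul_const]
    refine norm_integral_le_of_norm_le (i2.mul_const _) (ae_of_all _ fun ξ => ?_)
    rw [← sub_smul, ← sub_div, norm_smul, norm_div, Real.norm_eq_abs,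
      Real.norm_of_nonneg (by positivity : 0 ≤ σ ^ 2)]
    have := h.abs_advantage_sub_le_state ht hs hs' ξ
    calc _ ≤ B * (3 + Lπ) * ‖s - s'‖ / σ ^ 2 * ‖ξ‖ := by gcongr
      _ = _ := by ring

variable {D : EuclideanSpace ℝ (Fin dS) → EuclideanSpace ℝ (Fin dΘ) →L[ℝ] EuclideanSpace ℝ (Fin dA)}
  {C r : ℝ}

theorem exists_norm_localGrad_le
    (h : P.LipschitzBounds (gaussianDensity _ σ) θ τ LR LRt Lπ Lft)
    (hD : P.HasUniformPolicyDeriv θ D Lπ C r) :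
    ∃ c : ℝ, 0 ≤ c ∧ ∀ t < P.T, ∀ s ∈ P.states, ‖P.localGrad σ θ D t s‖ ≤ c ∧
      ∀ s' ∈ P.states, ‖P.localGrad σ θ D t s - P.localGrad σ θ D t s'‖ ≤ c * ‖s - s'‖ := by
  obtain ⟨c, hc, hv⟩ := h.exists_norm_advantageGrad_le
  have hC := hD.const_nonneg
  have hn : ∀ (A : EuclideanSpace ℝ (Fin dΘ) →L[ℝ] EuclideanSpace ℝ (Fin dA))
      (x : EuclideanSpace ℝ (Fin dA)),
      ‖ContinuousLinearMap.adjoint A x‖ ≤ ‖A‖ * ‖x‖ := fun A x => by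
    refine (ContinuousLinearMap.le_opNorm _ _).trans (le_of_eq ?_)
    rw [LinearIsometryEquiv.norm_map]
  refine ⟨Lπ * c + C * c, by positivity, fun t ht s hs => ⟨?_, fun s' hs' => ?_⟩⟩
  · refine (hn _ _).trans ((mul_le_mul (hD.norm_le s hs) (hv t ht s hs).1 (norm_nonneg _)
      Lπ.2).trans (le_add_of_nonneg_right (by positivity)))
  · have e : P.localGrad σ θ D t s - P.localGrad σ θ D t s' =
        ContinuousLinearMap.adjoint (D s) (P.advantageGrad σ θ t s - P.advantageGrad σ θ t s') +
        ContinuousLinearMap.adjoint (D s - D s') (P.advantageGrad σ θ t s') := by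
      simp [localGrad]
    rw [e]
    have h1 := (hn (D s) (P.advantageGrad σ θ t s - P.advantageGrad σ θ t s')).trans
      (mul_le_mul (hD.norm_le s hs) ((hv t ht s hs).2 s' hs') (norm_nonneg _) Lπ.2)
    have h2 := (hn (D s - D s') (P.advantageGrad σ θ t s')).trans
      (mul_le_mul (hD.norm_sub_le s hs s' hs') (hv t ht s' hs').1 (norm_nonneg _) (by positivity))
    refine (norm_add_le _ _).trans ((add_le_add h1 h2).trans (le_of_eq (by ring)))

theorem integrable_localGrad
    (h : P.LipschitzBounds (gaussianDensity _ σ) θ τ LR LRt Lπ Lft)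
    (hD : P.HasUniformPolicyDeriv θ D Lπ C r) {θ' : EuclideanSpace ℝ (Fin dΘ)}
    (hθ' : θ' ∈ P.params) {t : ℕ} (ht : t < P.T) :
    Integrable (fun ω => P.localGrad σ θ D t (P.state θ' ω t))
      (P.rolloutLaw (gaussianDensity _ σ)) := by
  obtain ⟨c, hc, hW⟩ := h.exists_norm_localGrad_le hD
  have := h.isProbabilityMeasure_rolloutLaw
  have hcont : ContinuousOn (P.localGrad σ θ D t) P.states := by
    have : LipschitzOnWith c.toNNReal (P.localGrad σ θ D t) P.states :=
      .of_dist_le_mul fun x hx y hy => by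
        rw [Real.coe_toNNReal c hc, dist_eq_norm, dist_eq_norm]; exact (hW t ht x hx).2 y hy
    exact this.continuousOn
  refine (integrable_const c).mono' (hcont.aestronglyMeasurable_comp
    h.regular.measurableSet_states (h.regular.measurable_state hθ' ht.le)
    (h.ae_state_mem hθ' ht.le)) ?_
  filter_upwards [h.ae_state_mem hθ' ht.le] with ω hω
  exact (hW t ht _ hω).1

/-- The mean advantage at time `t` under a nearby policy agrees to first order with its
linearization at `θ`. -/
theorem exists_abs_integral_advantage_sub_le (hσ : 0 < σ)
    (h : P.LipschitzBounds (gaussianDensity _ σ) θ τ LR LRt Lπ Lft)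
    (hD : P.HasUniformPolicyDeriv θ D Lπ C r) {t : ℕ} (ht : t < P.T) :
    ∃ c : ℝ, 0 ≤ c ∧ ∀ᶠ θ' in 𝓝 θ,
      |∫ ω, ∫ ξ, P.advantage (gaussianDensity _ σ) θ t (P.state θ' ω t)
          (P.perturbation θ θ' (P.state θ' ω t) + ξ) ∂(densityLaw (gaussianDensity _ σ))
          ∂(P.rolloutLaw (gaussianDensity _ σ)) -
        inner ℝ (∫ ω, P.localGrad σ θ D t (P.state θ ω t)
          ∂(P.rolloutLaw (gaussianDensity _ σ))) (θ' - θ)| ≤ c * ‖θ' - θ‖ ^ 2 := by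
  have hP := h.isProbabilityMeasure_rolloutLaw
  obtain ⟨cv, hcv, hv⟩ := h.exists_norm_advantageGrad_le
  obtain ⟨cW, hcW, hW⟩ := h.exists_norm_localGrad_le hD
  obtain ⟨cs, hcs, hs⟩ := h.exists_norm_state_sub_le ht.le
  set B := tdBound P.T LR LRt Lft * smoothingConst (EuclideanSpace ℝ (Fin dA)) σ τ
  have hB : 0 ≤ B := mul_nonneg (tdBound_nonneg _ _ _ _) (smoothingConst_nonneg h.action.pos.le)
  have hC := hD.const_nonneg
  refine ⟨B * Lπ ^ 2 + C * cv + cW * cs, by positivity, ?_⟩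
  have hr : ∀ᶠ θ' in 𝓝 θ, ‖θ' - θ‖ < r ∧ Lπ * ‖θ' - θ‖ < σ := by
    refine Filter.Eventually.and ?_ ?_
    · filter_upwards [Metric.ball_mem_nhds θ hD.radius_pos] with x hx
      rwa [← dist_eq_norm]
    · have : Tendsto (fun θ' => (Lπ : ℝ) * ‖θ' - θ‖) (𝓝 θ) (𝓝 0) := by
        have : Continuous fun θ' => (Lπ : ℝ) * ‖θ' - θ‖ := by fun_prop
        simpa using this.tendsto θ
      exact this.eventually_lt_const hσ
  filter_upwards [hr] with θ' ⟨h1, h2⟩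
  have hball : θ' ∈ Metric.ball θ r := by rwa [Metric.mem_ball, dist_eq_norm]
  have hθ' := hD.ball_subset hball
  have i1 := (h.integral_rolloutTD hθ' ht).1
  have i2 := h.integrable_localGrad hD h.mem_params ht
  have e : inner ℝ (∫ ω, P.localGrad σ θ D t (P.state θ ω t)
      ∂(P.rolloutLaw (gaussianDensity _ σ))) (θ' - θ) =
      ∫ ω, inner ℝ (θ' - θ) (P.localGrad σ θ D t (P.state θ ω t))
        ∂(P.rolloutLaw (gaussianDensity _ σ)) := by
    rw [integral_inner i2, real_inner_comm]
  rw [e, ← integral_sub i1 (i2.const_inner _), ← Real.norm_eq_abs]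
  refine (norm_integral_le_of_norm_le_const (C := (B * Lπ ^ 2 + C * cv + cW * cs) *
    ‖θ' - θ‖ ^ 2) ?_).trans (by simp)
  filter_upwards [h.ae_state_mem hθ' ht.le, h.ae_state_mem h.mem_params ht.le, hs θ' hθ']
    with ω m1 m2 m3
  generalize P.state θ' ω t = x at *
  generalize P.state θ ω t = y at *
  have hpert := h.norm_perturbation_le hθ' m1
  have hsm := abs_integral_add_sub_inner_le hσ h.action
    (h.continuous_advantage ht m1).aestronglyMeasurable (tdBound_nonneg P.T LR LRt Lft)
    (h.abs_advantage_le ht m1) (h.integral_advantage ht m1) (hpert.trans h2.le)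
  change |_ - inner ℝ _ (P.advantageGrad σ θ t x)| ≤ B * _ at hsm
  have hrem := hD.norm_remainder_le θ' hball x m1
  have a1 : B * ‖P.perturbation θ θ' x‖ ^ 2 ≤ B * Lπ ^ 2 * ‖θ' - θ‖ ^ 2 := by
    calc _ ≤ B * (Lπ * ‖θ' - θ‖) ^ 2 := by gcongr
      _ = _ := by ring
  have a2 : |inner ℝ (P.perturbation θ θ' x - D x (θ' - θ)) (P.advantageGrad σ θ t x)| ≤
      C * ‖θ' - θ‖ ^ 2 * cv :=
    (abs_real_inner_le_norm _ _).trans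
      (mul_le_mul hrem (hv t ht x m1).1 (norm_nonneg _) (by positivity))
  have a3 : |inner ℝ (θ' - θ) (P.localGrad σ θ D t x - P.localGrad σ θ D t y)| ≤
      ‖θ' - θ‖ * (cW * (cs * ‖θ' - θ‖)) :=
    (abs_real_inner_le_norm _ _).trans (mul_le_mul_of_nonneg_left
      (((hW t ht x m1).2 y m2).trans (mul_le_mul_of_nonneg_left m3 hcW)) (norm_nonneg _))
  have e2 : inner ℝ (θ' - θ) (P.localGrad σ θ D t x) =
      inner ℝ (D x (θ' - θ)) (P.advantageGrad σ θ t x) := by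
    rw [localGrad, ContinuousLinearMap.adjoint_inner_right]
  rw [inner_sub_right, e2] at a3
  rw [inner_sub_left] at a2
  rw [Real.norm_eq_abs]
  rw [abs_le] at *
  constructor <;> nlinarith [hsm.1, hsm.2, a2.1, a2.2, a3.1, a3.2]

theorem hasGradientAt_J (hσ : 0 < σ)
    (h : P.LipschitzBounds (gaussianDensity _ σ) θ τ LR LRt Lπ Lft)
    (hD : P.HasUniformPolicyDeriv θ D Lπ C r) :
    HasGradientAt (P.J (gaussianDensity _ σ)) (P.policyGrad σ θ D) θ := by
  choose! c hc hev using fun t (ht : t ∈ Finset.range P.T) =>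
    h.exists_abs_integral_advantage_sub_le hσ hD (Finset.mem_range.1 ht)
  have hO : (fun θ' => P.J (gaussianDensity _ σ) θ' - P.J (gaussianDensity _ σ) θ -
      inner ℝ (P.policyGrad σ θ D) (θ' - θ)) =O[𝓝 θ] fun θ' => ‖θ' - θ‖ ^ 2 := by
    refine Asymptotics.IsBigO.of_bound (∑ t ∈ Finset.range P.T, c t) ?_
    filter_upwards [(Filter.eventually_all_finset _).2 hev,
      h.regular.isOpen_params.mem_nhds h.mem_params] with θ' h1 h2
    rw [h.J_sub_J h2, policyGrad, sum_inner, ← Finset.sum_sub_distrib, Finset.sum_mul]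
    refine (norm_sum_le _ _).trans (Finset.sum_le_sum fun t ht => ?_)
    rw [Real.norm_eq_abs, Real.norm_of_nonneg (by positivity)]
    exact h1 t ht
  have h0 := Asymptotics.IsBigO.hasFDerivAt (𝕜 := ℝ) hO (by norm_num : 1 < 2)
  rw [hasGradientAt_iff_hasFDerivAt]
  have h1 := ((h0.add ((InnerProductSpace.toDual ℝ _ (P.policyGrad σ θ D)).hasFDerivAt.comp θ
    ((hasFDerivAt_id θ).sub_const θ))).add_const (P.J (gaussianDensity _ σ) θ))
  refine (h1.congr_of_eventuallyEq (Eventually.of_forall fun x => ?_)).congr_fderiv ?_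
  · simp
  · ext v; simp

theorem ae_score_eq (hσ : 0 < σ)
    (h : P.LipschitzBounds (gaussianDensity _ σ) θ τ LR LRt Lπ Lft)
    (hD : P.HasUniformPolicyDeriv θ D Lπ C r) {t : ℕ} (ht : t < P.T) :
    ∀ᵐ ω ∂(P.rolloutLaw (gaussianDensity _ σ)),
      P.score (gaussianDensity _ σ) θ (P.state θ ω t) (P.action θ ω t) =
        (σ ^ 2)⁻¹ • ContinuousLinearMap.adjoint (D (P.state θ ω t)) (P.noiseAt ω t).1 := by
  filter_upwards [h.ae_state_mem h.mem_params ht.le] with ω hω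
  exact hD.score_eq hσ hω _

theorem aestronglyMeasurable_score (hσ : 0 < σ)
    (h : P.LipschitzBounds (gaussianDensity _ σ) θ τ LR LRt Lπ Lft)
    (hD : P.HasUniformPolicyDeriv θ D Lπ C r) {t : ℕ} (ht : t < P.T) :
    AEStronglyMeasurable
      (fun ω => P.score (gaussianDensity _ σ) θ (P.state θ ω t) (P.action θ ω t))
      (P.rolloutLaw (gaussianDensity _ σ)) := by
  have h1 := hD.continuousOn.aestronglyMeasurable_comp h.regular.measurableSet_states
    (h.regular.measurable_state h.mem_params ht.le) (h.ae_state_mem h.mem_params ht.le)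
  have h2 : Continuous fun q : (EuclideanSpace ℝ (Fin dΘ) →L[ℝ] EuclideanSpace ℝ (Fin dA)) ×
      EuclideanSpace ℝ (Fin dA) => (σ ^ 2)⁻¹ • ContinuousLinearMap.adjoint q.1 q.2 :=
    (continuous_const_smul ((σ ^ 2)⁻¹)).comp (Continuous.clm_apply
      (f := fun q : (EuclideanSpace ℝ (Fin dΘ) →L[ℝ] EuclideanSpace ℝ (Fin dA)) ×
        EuclideanSpace ℝ (Fin dA) => ContinuousLinearMap.adjoint q.1)
      ((LinearIsometryEquiv.continuous ContinuousLinearMap.adjoint).comp continuous_fst)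
      continuous_snd)
  exact (h2.comp_aestronglyMeasurable
    (h1.prodMk (P.measurable_noiseAt t).fst.aestronglyMeasurable)).congr
    ((h.ae_score_eq hσ hD ht).mono fun ω hω => hω.symm)

theorem norm_score_le (hσ : 0 < σ)
    (h : P.LipschitzBounds (gaussianDensity _ σ) θ τ LR LRt Lπ Lft)
    (hD : P.HasUniformPolicyDeriv θ D Lπ C r) {t : ℕ} (ht : t < P.T) :
    ∀ᵐ ω ∂(P.rolloutLaw (gaussianDensity _ σ)),
      ‖P.score (gaussianDensity _ σ) θ (P.state θ ω t) (P.action θ ω t)‖ ≤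
        Lπ / σ ^ 2 * ‖(P.noiseAt ω t).1‖ := by
  filter_upwards [h.ae_score_eq hσ hD ht, h.ae_state_mem h.mem_params ht.le] with ω h1 h2
  rw [h1, norm_smul, norm_inv, Real.norm_of_nonneg (by positivity : 0 ≤ σ ^ 2), div_eq_inv_mul,
    mul_assoc]
  refine mul_le_mul_of_nonneg_left ?_ (by positivity)
  refine (ContinuousLinearMap.le_opNorm _ _).trans ?_
  rw [LinearIsometryEquiv.norm_map]
  exact mul_le_mul_of_nonneg_right (hD.norm_le _ h2) (norm_nonneg _)

theorem integrable_rolloutTD_smul_score (hσ : 0 < σ)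
    (h : P.LipschitzBounds (gaussianDensity _ σ) θ τ LR LRt Lπ Lft)
    (hD : P.HasUniformPolicyDeriv θ D Lπ C r) {i t : ℕ} (hi : i < P.T) (ht : t < P.T) :
    Integrable (fun ω => P.rolloutTD (gaussianDensity _ σ) θ θ ω i •
      P.score (gaussianDensity _ σ) θ (P.state θ ω t) (P.action θ ω t))
      (P.rolloutLaw (gaussianDensity _ σ)) := by
  have := h.isProbabilityMeasure_rolloutLaw
  obtain ⟨a1, a2⟩ := h.integrable_norm_noiseAt_pow hi 2
  obtain ⟨b1, -⟩ := h.integrable_norm_noiseAt_pow ht 2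
  have hB := tdBound_nonneg P.T LR LRt Lft
  refine ((((a1.add a2).add b1).add (integrable_const (τ ^ 2))).const_mul
    (tdBound P.T LR LRt Lft * (Lπ / σ ^ 2) * 3)).mono'
    ((h.aestronglyMeasurable_rolloutTD h.mem_params hi).smul
      (h.aestronglyMeasurable_score hσ hD ht)) ?_
  filter_upwards [h.abs_rolloutTD_le h.mem_params hi, h.norm_score_le hσ hD ht] with ω h1 h2
  rw [sub_self, norm_zero, mul_zero, zero_add] at h1
  rw [norm_smul, Real.norm_eq_abs]
  simp only [Pi.add_apply]
  have hτ := h.action.pos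
  calc _ ≤ (tdBound P.T LR LRt Lft * (‖(P.noiseAt ω i).1‖ + ‖(P.noiseAt ω i).2‖ + 2 * τ)) *
        (Lπ / σ ^ 2 * ‖(P.noiseAt ω t).1‖) := mul_le_mul h1 h2 (norm_nonneg _) (by positivity)
    _ = tdBound P.T LR LRt Lft * (Lπ / σ ^ 2) *
        ((‖(P.noiseAt ω i).1‖ + ‖(P.noiseAt ω i).2‖ + 2 * τ) * ‖(P.noiseAt ω t).1‖) := by ring
    _ ≤ tdBound P.T LR LRt Lft * (Lπ / σ ^ 2) * (3 * (‖(P.noiseAt ω i).1‖ ^ 2 +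
          ‖(P.noiseAt ω i).2‖ ^ 2 + ‖(P.noiseAt ω t).1‖ ^ 2 + τ ^ 2)) := by
        refine mul_le_mul_of_nonneg_left ?_ (by positivity)
        nlinarith [sq_nonneg (‖(P.noiseAt ω i).1‖ - ‖(P.noiseAt ω t).1‖),
          sq_nonneg (‖(P.noiseAt ω i).2‖ - ‖(P.noiseAt ω t).1‖),
          sq_nonneg (τ - ‖(P.noiseAt ω t).1‖)]
    _ = _ := by ring

theorem integral_rolloutTD_smul_score_of_lt (hσ : 0 < σ)
    (h : P.LipschitzBounds (gaussianDensity _ σ) θ τ LR LRt Lπ Lft)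
    (hD : P.HasUniformPolicyDeriv θ D Lπ C r) {i t : ℕ} (hi : i < P.T) (ht : t < i) :
    ∫ ω, P.rolloutTD (gaussianDensity _ σ) θ θ ω i •
      P.score (gaussianDensity _ σ) θ (P.state θ ω t) (P.action θ ω t)
      ∂(P.rolloutLaw (gaussianDensity _ σ)) = 0 := by
  rw [(h.integral_rolloutTD_smul h.mem_params hi
    (k := fun ω _ => P.score (gaussianDensity _ σ) θ (P.state θ ω t) (P.action θ ω t))
    (fun ω y => ?_) (h.integrable_rolloutTD_smul_score hσ hD hi (ht.trans hi))).2]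
  · refine integral_eq_zero_of_ae ?_
    filter_upwards [h.ae_state_mem h.mem_params hi.le] with ω hω
    rw [integral_smul_const]
    simp [perturbation_self, h.integral_advantage hi hω]
  · simp only [ControlProblem.action]
    rw [P.state_update θ ω ⟨i, hi⟩ y (by simpa using ht.le),
      P.noiseAt_update_of_ne ω ⟨i, hi⟩ y (by simpa using ht.ne)]

theorem integral_rolloutTD_smul_score_self (hσ : 0 < σ)
    (h : P.LipschitzBounds (gaussianDensity _ σ) θ τ LR LRt Lπ Lft)
    (hD : P.HasUniformPolicyDeriv θ D Lπ C r) {t : ℕ} (ht : t < P.T) :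
    ∫ ω, P.rolloutTD (gaussianDensity _ σ) θ θ ω t •
      P.score (gaussianDensity _ σ) θ (P.state θ ω t) (P.action θ ω t)
      ∂(P.rolloutLaw (gaussianDensity _ σ)) =
    ∫ ω, P.localGrad σ θ D t (P.state θ ω t) ∂(P.rolloutLaw (gaussianDensity _ σ)) := by
  rw [(h.integral_rolloutTD_smul h.mem_params ht
    (k := fun ω ξ => P.score (gaussianDensity _ σ) θ (P.state θ ω t) (P.pol θ (P.state θ ω t) + ξ))
    (fun ω y => ?_) (h.integrable_rolloutTD_smul_score hσ hD ht ht)).2]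
  · refine integral_congr_ae ?_
    filter_upwards [h.ae_state_mem h.mem_params ht.le] with ω hω
    simp only [perturbation_self, zero_add, hD.score_eq hσ hω]
    rw [localGrad, advantageGrad,
      ← ContinuousLinearMap.integral_comp_comm _ (h.integrable_advantage_smul ht hω)]
    refine integral_congr_ae (ae_of_all _ fun ξ => ?_)
    simp only [map_smul, smul_smul]
    rw [div_eq_mul_inv]
  · have e1 := P.noiseAt_update_self ω ⟨t, ht⟩ y
    simp only at e1
    simp only [ControlProblem.action]
    rw [P.state_update θ ω ⟨t, ht⟩ y le_rfl, e1]

theorem integrable_pgEstimate (hσ : 0 < σ)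
    (h : P.LipschitzBounds (gaussianDensity _ σ) θ τ LR LRt Lπ Lft)
    (hD : P.HasUniformPolicyDeriv θ D Lπ C r) :
    Integrable (P.pgEstimate (gaussianDensity _ σ) θ) (P.rolloutLaw (gaussianDensity _ σ)) := by
  have e := funext fun ω => P.pgEstimate_eq (gaussianDensity _ σ) θ ω
  rw [e]
  exact integrable_finsetSum _ fun t ht => integrable_finsetSum _ fun i hi =>
    h.integrable_rolloutTD_smul_score hσ hD (Finset.mem_Ico.1 hi).2 (Finset.mem_range.1 ht)

/-- The estimate is unbiased: future temporal-difference errors are uncorrelated with the score. -/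
theorem integral_pgEstimate (hσ : 0 < σ)
    (h : P.LipschitzBounds (gaussianDensity _ σ) θ τ LR LRt Lπ Lft)
    (hD : P.HasUniformPolicyDeriv θ D Lπ C r) :
    ∫ ω, P.pgEstimate (gaussianDensity _ σ) θ ω ∂(P.rolloutLaw (gaussianDensity _ σ)) =
      P.policyGrad σ θ D := by
  simp only [pgEstimate_eq]
  have hi := fun t (ht : t ∈ Finset.range P.T) i (hi : i ∈ Finset.Ico t P.T) =>
    h.integrable_rolloutTD_smul_score hσ hD (Finset.mem_Ico.1 hi).2 (Finset.mem_range.1 ht)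
  rw [integral_finsetSum _ fun t ht => integrable_finsetSum _ (hi t ht), policyGrad]
  refine Finset.sum_congr rfl fun t ht => ?_
  have ht' := Finset.mem_range.1 ht
  rw [integral_finsetSum _ (hi t ht), Finset.sum_eq_single_of_mem t (Finset.mem_Ico.2 ⟨le_rfl, ht'⟩)
    fun i hi hit => h.integral_rolloutTD_smul_score_of_lt hσ hD (Finset.mem_Ico.1 hi).2
      (lt_of_le_of_ne (Finset.mem_Ico.1 hi).1 hit.symm),
    h.integral_rolloutTD_smul_score_self hσ hD ht']

end LipschitzBounds

end ControlProblem

namespace ControlProblem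

variable {dS dA dΘ : ℕ}
  {P : ControlProblem (EuclideanSpace ℝ (Fin dS)) (EuclideanSpace ℝ (Fin dA))
    (EuclideanSpace ℝ (Fin dΘ))}

/-! ### The upper bound -/

namespace LipschitzBounds

variable {σ : ℝ} {θ : EuclideanSpace ℝ (Fin dΘ)} {τ : ℝ} {LR LRt Lπ Lft : ℝ≥0}
  {D : EuclideanSpace ℝ (Fin dS) → EuclideanSpace ℝ (Fin dΘ) →L[ℝ] EuclideanSpace ℝ (Fin dA)}
  {C r : ℝ}

/-- The estimate is at most quadratic in the noise. The factor `σ⁻²` comes from the score. -/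
theorem norm_pgEstimate_le (hσ : 0 < σ)
    (h : P.LipschitzBounds (gaussianDensity _ σ) θ τ LR LRt Lπ Lft)
    (hD : P.HasUniformPolicyDeriv θ D Lπ C r) :
    ∀ᵐ ω ∂(P.rolloutLaw (gaussianDensity _ σ)), ‖P.pgEstimate (gaussianDensity _ σ) θ ω‖ ≤
      tdBound P.T LR LRt Lft * (Lπ / σ ^ 2) * (P.T * ∑ i ∈ Finset.range P.T,
        3 * (‖(P.noiseAt ω i).1‖ ^ 2 + ‖(P.noiseAt ω i).2‖ ^ 2 + 4 * τ ^ 2)) := by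
  have hB := tdBound_nonneg P.T LR LRt Lft
  set B := tdBound P.T LR LRt Lft
  have hτ := h.action.pos
  have h1 : ∀ᵐ ω ∂(P.rolloutLaw (gaussianDensity _ σ)), ∀ i ∈ Finset.range P.T,
      |P.rolloutTD (gaussianDensity _ σ) θ θ ω i| ≤ B * (Lπ * ‖θ - θ‖ + ‖(P.noiseAt ω i).1‖ +
        ‖(P.noiseAt ω i).2‖ + 2 * τ) := by
    rw [Filter.eventually_all_finset]
    exact fun i hi => h.abs_rolloutTD_le h.mem_params (Finset.mem_range.1 hi)
  have h2 : ∀ᵐ ω ∂(P.rolloutLaw (gaussianDensity _ σ)), ∀ t ∈ Finset.range P.T,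
      ‖P.score (gaussianDensity _ σ) θ (P.state θ ω t) (P.action θ ω t)‖ ≤
        Lπ / σ ^ 2 * ‖(P.noiseAt ω t).1‖ := by
    rw [Filter.eventually_all_finset]
    exact fun i hi => h.norm_score_le hσ hD (Finset.mem_range.1 hi)
  filter_upwards [h1, h2] with ω a1 a2
  rw [sub_self, norm_zero, mul_zero] at a1
  simp only [zero_add] at a1
  set n : ℕ → ℝ := fun i => ‖(P.noiseAt ω i).1‖ + ‖(P.noiseAt ω i).2‖ + 2 * τ with hn
  have hn0 : ∀ i, 0 ≤ n i := fun i => by positivity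
  have hle : ∀ i, ‖(P.noiseAt ω i).1‖ ≤ n i := fun i => by
    have := norm_nonneg (P.noiseAt ω i).2
    simp only [hn]; linarith
  have hS : 0 ≤ ∑ i ∈ Finset.range P.T, n i := Finset.sum_nonneg fun i _ => hn0 i
  rw [pgEstimate_eq]
  calc _ ≤ ∑ t ∈ Finset.range P.T, ∑ i ∈ Finset.range P.T,
          B * n i * (Lπ / σ ^ 2 * n t) := by
        refine (norm_sum_le _ _).trans (Finset.sum_le_sum fun t ht => ?_)
        refine (norm_sum_le _ _).trans ((Finset.sum_le_sum_of_subset_of_nonneg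
          (fun i hi => Finset.mem_range.2 (Finset.mem_Ico.1 hi).2)
          (fun _ _ _ => norm_nonneg _)).trans (Finset.sum_le_sum fun i hi => ?_))
        rw [norm_smul, Real.norm_eq_abs]
        exact mul_le_mul (a1 i hi) ((a2 t ht).trans
          (mul_le_mul_of_nonneg_left (hle t) (by positivity))) (norm_nonneg _)
          (mul_nonneg hB (hn0 i))
    _ = B * (Lπ / σ ^ 2) * (∑ i ∈ Finset.range P.T, n i) ^ 2 := by
        rw [sq (∑ i ∈ Finset.range P.T, n i), Finset.sum_mul_sum, Finset.mul_sum, Finset.sum_comm]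
        refine Finset.sum_congr rfl fun t _ => ?_
        rw [Finset.mul_sum]
        exact Finset.sum_congr rfl fun i _ => by ring
    _ ≤ _ := by
        refine mul_le_mul_of_nonneg_left ?_ (by positivity)
        refine (sq_sum_le_card_mul_sum_sq).trans ?_
        rw [Finset.card_range]
        refine mul_le_mul_of_nonneg_left (Finset.sum_le_sum fun i _ => ?_) (Nat.cast_nonneg _)
        simp only [hn]
        nlinarith [sq_nonneg (‖(P.noiseAt ω i).1‖ - ‖(P.noiseAt ω i).2‖),
          sq_nonneg (‖(P.noiseAt ω i).1‖ - 2 * τ), sq_nonneg (‖(P.noiseAt ω i).2‖ - 2 * τ)]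

/-- The estimate is sub-exponential. Convexity of `exp` reduces the sum over time to single noise
terms, so that no independence is needed. -/
theorem integral_exp_norm_pgEstimate_le (hσ : 0 < σ)
    (h : P.LipschitzBounds (gaussianDensity _ σ) θ τ LR LRt Lπ Lft)
    (hD : P.HasUniformPolicyDeriv θ D Lπ C r) (hT : 0 < P.T) {M : ℝ} (hM : 0 < M)
    (hMle : 6 * P.T ^ 2 * tdBound P.T LR LRt Lft * Lπ * (τ ^ 2 / σ ^ 2) ≤ M) :
    Integrable (fun ω => Real.exp (‖P.pgEstimate (gaussianDensity _ σ) θ ω‖ / M))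
      (P.rolloutLaw (gaussianDensity _ σ)) ∧
    ∫ ω, Real.exp (‖P.pgEstimate (gaussianDensity _ σ) θ ω‖ / M)
      ∂(P.rolloutLaw (gaussianDensity _ σ)) ≤ 16 := by
  have hB := tdBound_nonneg P.T LR LRt Lft
  have hτ := h.action.pos
  have hT' : (0 : ℝ) < P.T := by exact_mod_cast hT
  have := h.action.isProbabilityMeasure
  set γ := densityLaw (gaussianDensity (EuclideanSpace ℝ (Fin dA)) σ)
  set b : ℕ → P.RolloutNoise → ℝ := fun i ω =>
    Real.exp (‖(P.noiseAt ω i).1‖ ^ 2 / τ ^ 2) + Real.exp (‖(P.noiseAt ω i).2‖ ^ 2 / τ ^ 2) with hb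
  have hbi : ∀ i ∈ Finset.range P.T, Integrable (b i) (P.rolloutLaw (gaussianDensity _ σ)) ∧
      ∫ ω, b i ω ∂(P.rolloutLaw (gaussianDensity _ σ)) ≤ 4 := by
    intro i hi
    have hi' := Finset.mem_range.1 hi
    have := (h.noise i hi').isProbabilityMeasure
    have j1 := h.action.integrable_exp_sq.comp_fst (P.noise i)
    have j2 := (h.noise i hi').integrable_exp_sq.comp_snd γ
    have e1 := h.integral_comp_noiseAt hi' j1
    have e2 := h.integral_comp_noiseAt hi' j2
    have f1 := integral_fun_fst (μ := γ) (ν := P.noise i)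
      (fun x : EuclideanSpace ℝ (Fin dA) => Real.exp (‖x‖ ^ 2 / τ ^ 2))
    have f2 := integral_fun_snd (μ := γ) (ν := P.noise i)
      (fun x : EuclideanSpace ℝ (Fin dS) => Real.exp (‖x‖ ^ 2 / τ ^ 2))
    rw [f1] at e1
    rw [f2] at e2
    simp only [probReal_univ, one_smul] at e1 e2
    refine ⟨(h.integrable_comp_noiseAt hi' j1).add (h.integrable_comp_noiseAt hi' j2), ?_⟩
    simp only [hb]
    rw [integral_add (h.integrable_comp_noiseAt hi' j1) (h.integrable_comp_noiseAt hi' j2), e1, e2]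
    linarith [h.action.integral_exp_sq_le, (h.noise i hi').integral_exp_sq_le]
  have hint : Integrable (fun ω => (1 / P.T : ℝ) * (Real.exp 2 / 2) *
      ∑ i ∈ Finset.range P.T, b i ω) (P.rolloutLaw (gaussianDensity _ σ)) :=
    (integrable_finsetSum _ fun i hi => (hbi i hi).1).const_mul _
  have hpt : ∀ᵐ ω ∂(P.rolloutLaw (gaussianDensity _ σ)),
      Real.exp (‖P.pgEstimate (gaussianDensity _ σ) θ ω‖ / M) ≤
      (1 / P.T : ℝ) * (Real.exp 2 / 2) * ∑ i ∈ Finset.range P.T, b i ω := by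
    filter_upwards [h.norm_pgEstimate_le hσ hD] with ω hω
    set x : ℕ → ℝ := fun i => ‖(P.noiseAt ω i).1‖ ^ 2 / τ ^ 2 with hx
    set y : ℕ → ℝ := fun i => ‖(P.noiseAt ω i).2‖ ^ 2 / τ ^ 2 with hy
    have e1 : tdBound P.T LR LRt Lft * (Lπ / σ ^ 2) * (P.T * ∑ i ∈ Finset.range P.T,
        3 * (‖(P.noiseAt ω i).1‖ ^ 2 + ‖(P.noiseAt ω i).2‖ ^ 2 + 4 * τ ^ 2)) =
        6 * P.T ^ 2 * tdBound P.T LR LRt Lft * Lπ * (τ ^ 2 / σ ^ 2) *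
          ∑ i ∈ Finset.range P.T, (1 / P.T : ℝ) * ((x i + y i) / 2 + 2) := by
      simp only [Finset.mul_sum]
      refine Finset.sum_congr rfl fun i _ => ?_
      simp only [hx, hy]
      field_simp
      ring
    have hnn : 0 ≤ ∑ i ∈ Finset.range P.T, (1 / P.T : ℝ) * ((x i + y i) / 2 + 2) :=
      Finset.sum_nonneg fun i _ => by positivity
    have h3 : ‖P.pgEstimate (gaussianDensity _ σ) θ ω‖ / M ≤
        ∑ i ∈ Finset.range P.T, (1 / P.T : ℝ) * ((x i + y i) / 2 + 2) := by
      rw [div_le_iff₀' hM]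
      rw [e1] at hω
      exact hω.trans (mul_le_mul_of_nonneg_right hMle hnn)
    have h4 := convexOn_exp.map_sum_le (t := Finset.range P.T) (w := fun _ => (1 / P.T : ℝ))
      (p := fun i => (x i + y i) / 2 + 2) (fun _ _ => by positivity) (by simp [hT'.ne'])
      (fun _ _ => Set.mem_univ _)
    simp only [smul_eq_mul] at h4
    refine (Real.exp_le_exp.2 h3).trans (h4.trans ?_)
    rw [mul_assoc, ← Finset.mul_sum]
    refine mul_le_mul_of_nonneg_left ?_ (by positivity)
    rw [Finset.mul_sum]
    refine Finset.sum_le_sum fun i _ => ?_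
    have h5 : Real.exp ((x i + y i) / 2) ≤ (Real.exp (x i) + Real.exp (y i)) / 2 := by
      have e3 : ∀ z : ℝ, Real.exp z = Real.exp (z / 2) ^ 2 := fun z => by
        rw [← Real.exp_nat_mul]; congr 1; push_cast; ring
      rw [add_div, Real.exp_add, e3 (x i), e3 (y i)]
      nlinarith [sq_nonneg (Real.exp (x i / 2) - Real.exp (y i / 2))]
    rw [Real.exp_add]
    simp only [hb]
    have := mul_le_mul_of_nonneg_right h5 (Real.exp_pos 2).le
    linarith
  have hmeas : AEStronglyMeasurable
      (fun ω => Real.exp (‖P.pgEstimate (gaussianDensity _ σ) θ ω‖ / M))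
      (P.rolloutLaw (gaussianDensity _ σ)) :=
    Real.continuous_exp.comp_aestronglyMeasurable
      ((h.integrable_pgEstimate hσ hD).norm.div_const M).1
  have hi : Integrable (fun ω => Real.exp (‖P.pgEstimate (gaussianDensity _ σ) θ ω‖ / M))
      (P.rolloutLaw (gaussianDensity _ σ)) := by
    refine hint.mono' hmeas ?_
    filter_upwards [hpt] with ω hω
    rwa [Real.norm_of_nonneg (Real.exp_pos _).le]
  refine ⟨hi, (integral_mono_ae hi hint hpt).trans ?_⟩
  rw [integral_const_mul, integral_finsetSum _ fun i hi => (hbi i hi).1]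
  have h6 : ∑ i ∈ Finset.range P.T, ∫ ω, b i ω ∂(P.rolloutLaw (gaussianDensity _ σ)) ≤
      P.T * 4 := by
    refine (Finset.sum_le_sum fun i hi => (hbi i hi).2).trans ?_
    simp
  have h7 : Real.exp 2 ≤ 8 := by
    have := Real.exp_one_lt_d9
    have e : Real.exp 2 = Real.exp 1 ^ 2 := by rw [← Real.exp_nat_mul]; norm_num
    rw [e]; nlinarith [Real.exp_pos 1]
  calc _ ≤ (1 / P.T : ℝ) * (8 / 2) * (P.T * 4) := by gcongr
    _ = 16 := by field_simp; norm_num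

theorem nPG_le (hσ : 0 < σ)
    (h : P.LipschitzBounds (gaussianDensity _ σ) θ τ LR LRt Lπ Lft)
    (hD : P.HasUniformPolicyDeriv θ D Lπ C r) (hT : 0 < P.T) {M : ℝ} (hM : 0 < M)
    (hMle : 6 * P.T ^ 2 * tdBound P.T LR LRt Lft * Lπ * (τ ^ 2 / σ ^ 2) ≤ M) {ε δ : ℝ}
    (hε : 0 < ε) (hεM : ε ≤ M) (hδ : 0 < δ) {n : ℕ} (hn1 : 1 ≤ n)
    (hn : 4 * (16 * Real.exp 15) * M ^ 2 / ε ^ 2 * Real.log (2 / δ) ≤ n) :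
    P.nPG (gaussianDensity _ σ) θ ε δ ≤ n := by
  have := h.isProbabilityMeasure_rolloutLaw
  obtain ⟨he, he16⟩ := h.integral_exp_norm_pgEstimate_le hσ hD hT hM hMle
  have hDi := h.integrable_pgEstimate hσ hD
  have hmean : gradient (P.J (gaussianDensity _ σ)) θ =
      ∫ ω, P.pgEstimate (gaussianDensity _ σ) θ ω ∂(P.rolloutLaw (gaussianDensity _ σ)) := by
    rw [h.integral_pgEstimate hσ hD, (h.hasGradientAt_J hσ hD).gradient]
  set G := gradient (P.J (gaussianDensity _ σ)) θ
  have hG : ‖G‖ / M ≤ 15 := by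
    rw [hmean]
    refine (div_le_div_of_nonneg_right (norm_integral_le_integral_norm _) hM.le).trans ?_
    rw [← integral_div]
    calc _ ≤ ∫ ω, (Real.exp (‖P.pgEstimate (gaussianDensity _ σ) θ ω‖ / M) - 1)
          ∂(P.rolloutLaw (gaussianDensity _ σ)) := by
          refine integral_mono (hDi.norm.div_const _) (he.sub (integrable_const _)) fun ω => ?_
          have := Real.add_one_le_exp (‖P.pgEstimate (gaussianDensity _ σ) θ ω‖ / M)
          change _ ≤ Real.exp (‖P.pgEstimate (gaussianDensity _ σ) θ ω‖ / M) - 1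
          linarith
      _ ≤ 15 := by
          rw [integral_sub he (integrable_const _)]
          simp only [integral_const, probReal_univ, one_smul]
          linarith
  have hbd : ∀ ω, Real.exp (‖P.pgEstimate (gaussianDensity _ σ) θ ω - G‖ / M) ≤
      Real.exp (‖P.pgEstimate (gaussianDensity _ σ) θ ω‖ / M) * Real.exp 15 := fun ω => by
    rw [← Real.exp_add]
    refine Real.exp_le_exp.2 ?_
    have := div_le_div_of_nonneg_right
      (norm_sub_le (P.pgEstimate (gaussianDensity _ σ) θ ω) G) hM.le
    rw [add_div] at this
    linarith
  have hXm : AEStronglyMeasurable (fun ω => P.pgEstimate (gaussianDensity _ σ) θ ω - G)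
    (P.rolloutLaw (gaussianDensity _ σ)) := hDi.1.sub aestronglyMeasurable_const
  have heX : Integrable (fun ω => Real.exp (‖P.pgEstimate (gaussianDensity _ σ) θ ω - G‖ / M))
      (P.rolloutLaw (gaussianDensity _ σ)) := by
    refine (he.mul_const (Real.exp 15)).mono' (Real.continuous_exp.comp_aestronglyMeasurable
      (hXm.norm.aemeasurable.div_const M).aestronglyMeasurable) (ae_of_all _ fun ω => ?_)
    rw [Real.norm_of_nonneg (Real.exp_pos _).le]
    exact hbd ω
  have hA1 : (1 : ℝ) ≤ 2 * (16 * Real.exp 15) := by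
    have := Real.one_le_exp (by norm_num : (0 : ℝ) ≤ 15)
    linarith
  refine sampleComplexity_le_of_integral_exp_norm_le hXm ?_ hM heX (A := 16 * Real.exp 15) ?_
    hε (hεM.trans (le_mul_of_one_le_left hM.le hA1)) hδ hn1 hn
  · rw [integral_sub hDi (integrable_const _), ← hmean]; simp
  · refine (integral_mono heX (he.mul_const (Real.exp 15)) hbd).trans ?_
    rw [integral_mul_const]
    gcongr

end LipschitzBounds

end ControlProblem

theorem sqrtENat_mono {m n : ℕ∞} (h : m ≤ n) : sqrtENat m ≤ sqrtENat n := by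
  unfold sqrtENat
  gcongr

theorem sqrtENat_natCast (n : ℕ) : sqrtENat n = ENNReal.ofReal √n := by
  unfold sqrtENat
  rw [Real.sqrt_eq_rpow, ← ENNReal.ofReal_rpow_of_nonneg (by positivity) (by norm_num)]
  simp

/-- The constant of the upper bound. -/
noncomputable def upperConst : ℝ := √(2304 * (16 * Real.exp 15) + 1)

theorem upperConst_pos : 0 < upperConst := by unfold upperConst; positivity

theorem ControlProblem.sqrtENat_nPG_le {dS dA dΘ : ℕ}
    (P : ControlProblem (EuclideanSpace ℝ (Fin dS)) (EuclideanSpace ℝ (Fin dA))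
      (EuclideanSpace ℝ (Fin dΘ))) {σ : ℝ≥0} (hσ : 0 < σ)
    (hreg : P.Regular (gaussianDensity (EuclideanSpace ℝ (Fin dA)) σ))
    (hsub : ∀ t < P.T, IsSubGaussianVector σ (P.noise t)) {θ : EuclideanSpace ℝ (Fin dΘ)}
    (hθ : θ ∈ P.params) {LR LRt Lf Lπ Lft : ℝ≥0}
    (hLR : ∀ t < P.T, LipschitzOnWith LR (P.RJoint t) P.stateAction)
    (hLRt : ∀ t < P.T,
      LipschitzOnWith LRt (P.RTilde (gaussianDensity (EuclideanSpace ℝ (Fin dA)) σ) t θ) P.states)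
    (hLf : ∀ t < P.T, BarLipschitzOn Lf (P.fJoint t) P.stateAction)
    (hLπ : LipschitzOnWith Lπ P.polJoint P.paramState)
    (hLft : ∀ t < P.T, BarLipschitzOn Lft (P.fTilde t θ) P.stateAction) :
    DifferentiableAt ℝ (P.J (gaussianDensity (EuclideanSpace ℝ (Fin dA)) σ)) θ ∧
    ∀ K : ℝ, K = (P.T : ℝ) ^ 6 * (LR + LRt) * Lf * Lπ * Lft ^ P.T * (max dS dA : ℝ) ^ 4 →
    ∀ ε δ : ℝ, 0 < ε → ε ≤ K → 0 < δ → δ < 1 →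
      sqrtENat (P.nPG (gaussianDensity (EuclideanSpace ℝ (Fin dA)) σ) θ ε δ) ≤
        ENNReal.ofReal (upperConst * (K / ε) * (1 + Real.log P.T) *
          (1 + Real.log (max dS dA : ℝ)) ^ (3 / 2 : ℝ) *
          (1 + Real.log (1 / δ)) ^ (1 / 2 : ℝ)) := by
  have hσ' : (0 : ℝ) < σ := hσ
  rcases Nat.eq_zero_or_pos P.T with hT | hT
  · refine ⟨?_, fun K hK ε δ hε hεK => ?_⟩
    · have : P.J (gaussianDensity (EuclideanSpace ℝ (Fin dA)) σ) = fun _ => 0 := by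
        ext θ'; simp [ControlProblem.J, hT]
      rw [this]
      exact differentiableAt_const _
    · exfalso
      rw [hT] at hK
      simp at hK
      linarith
  -- `d` replaces `max dS dA`, which may vanish
  set d : ℕ := max 1 (max dS dA) with hd
  have hd1 : 1 ≤ d := le_max_left _ _
  have hbounds : P.LipschitzBounds (gaussianDensity (EuclideanSpace ℝ (Fin dA)) σ) θ
      (2 * σ * √d) LR LRt Lπ Lft :=
    { regular := hreg
      action := hasSubgaussianNorm_gaussianDensity hd1 (by simp [hd]) hσ'
      noise := fun t ht => (hsub t ht).hasSubgaussianNorm hd1 (by simp [hd]) hσ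
        (hreg.isProbabilityMeasure_noise t ht)
      mem_params := hθ
      lipschitz_R := hLR
      lipschitz_RTilde := hLRt
      lipschitz_pol := hLπ
      lipschitz_fTilde := fun t ht => (hLft t ht).2.1
      one_le := (hLft 0 hT).2.2 }
  obtain ⟨D, C, r, hD⟩ := hbounds.exists_hasUniformPolicyDeriv
  refine ⟨(hbounds.hasGradientAt_J hσ' hD).differentiableAt, ?_⟩
  intro K hK ε δ hε hεK hδ hδ1
  have hK0 : 0 < K := hε.trans_le hεK
  have hT1 : (1 : ℝ) ≤ P.T := by exact_mod_cast hT
  have hmax : 1 ≤ max dS dA := by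
    by_contra hcon
    have h1 : dS = 0 := by omega
    have h2 : dA = 0 := by omega
    have h3 : max (dS : ℝ) dA = 0 := by rw [h1, h2]; simp
    rw [h3] at hK
    simp at hK
    linarith
  have hd' : d = max dS dA := by omega
  have hdR : (max dS dA : ℝ) = d := by rw [hd', Nat.cast_max]
  have hd1' : (1 : ℝ) ≤ d := by exact_mod_cast hd1
  rw [hdR] at hK ⊢
  have hLf1 : (1 : ℝ) ≤ Lf := (hLf 0 hT).2.2
  have hMle : 6 * (P.T : ℝ) ^ 2 * ControlProblem.tdBound P.T LR LRt Lft * Lπ *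
      ((2 * σ * √d) ^ 2 / σ ^ 2) ≤ 24 * K := by
    have e : (2 * σ * √d) ^ 2 / (σ : ℝ) ^ 2 = 4 * d := by
      rw [mul_pow, mul_pow, Real.sq_sqrt (by positivity)]; field_simp; norm_num
    rw [e, ControlProblem.tdBound, hK]
    have h3 : (P.T : ℝ) ^ 3 ≤ P.T ^ 6 := pow_le_pow_right₀ hT1 (by norm_num)
    have h4 : (d : ℝ) ≤ d ^ 4 := le_self_pow₀ hd1' (by norm_num)
    calc _ = 24 * ((P.T : ℝ) ^ 3 * (LR + LRt) * 1 * Lπ * Lft ^ P.T * d) := by ring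
      _ ≤ _ := by gcongr
  have hlog2 : Real.log (2 / δ) ≤ 1 + Real.log (1 / δ) := by
    rw [Real.log_div (by norm_num) hδ.ne', Real.log_div (by norm_num) hδ.ne', Real.log_one]
    have := Real.log_two_lt_d9
    linarith
  have hlog0 : 0 < Real.log (2 / δ) := Real.log_pos (by rw [lt_div_iff₀ hδ]; linarith)
  have hlog1 : 0 ≤ Real.log (1 / δ) := Real.log_nonneg (by rw [le_div_iff₀ hδ]; linarith)
  set A : ℝ := 16 * Real.exp 15 with hA
  have hA0 : 0 < A := by positivity
  have hx0 : 0 < 4 * A * (24 * K) ^ 2 / ε ^ 2 * Real.log (2 / δ) := by positivity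
  have hn := hbounds.nPG_le hσ' hD hT (by positivity) hMle hε (by linarith) hδ
    (Nat.one_le_ceil_iff.2 hx0) (Nat.le_ceil _)
  refine (sqrtENat_mono hn).trans ?_
  rw [sqrtENat_natCast]
  refine ENNReal.ofReal_le_ofReal ?_
  have hKε : 1 ≤ K / ε := by rwa [le_div_iff₀ hε, one_mul]
  calc √(⌈4 * A * (24 * K) ^ 2 / ε ^ 2 * Real.log (2 / δ)⌉₊ : ℝ)
      ≤ √((2304 * A + 1) * (K / ε) ^ 2 * (1 + Real.log (1 / δ))) := by
        refine Real.sqrt_le_sqrt ?_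
        have h5 := (Nat.ceil_lt_add_one hx0.le).le
        have e : 4 * A * (24 * K) ^ 2 / ε ^ 2 * Real.log (2 / δ) =
            2304 * A * (K / ε) ^ 2 * Real.log (2 / δ) := by field_simp; ring
        have h6 : 2304 * A * (K / ε) ^ 2 * Real.log (2 / δ) ≤
            2304 * A * (K / ε) ^ 2 * (1 + Real.log (1 / δ)) := by gcongr
        have h7 : 1 ≤ (K / ε) ^ 2 * (1 + Real.log (1 / δ)) := by
          have := one_le_pow₀ (n := 2) hKε
          nlinarith
        rw [e] at h5 ⊢
        linarith
    _ = upperConst * (K / ε) * (1 + Real.log (1 / δ)) ^ (1 / 2 : ℝ) := by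
        rw [Real.sqrt_mul (by positivity), Real.sqrt_mul (by positivity),
          Real.sqrt_sq (by positivity), ← Real.sqrt_eq_rpow, upperConst]
    _ ≤ _ := by
        have h8 : 1 ≤ 1 + Real.log P.T := by linarith [Real.log_nonneg hT1]
        have h9 : 1 ≤ (1 + Real.log (d : ℝ)) ^ (3 / 2 : ℝ) :=
          Real.one_le_rpow (by linarith [Real.log_nonneg hd1']) (by norm_num)
        have h10 : 0 ≤ upperConst * (K / ε) := mul_nonneg upperConst_pos.le (by positivity)
        refine mul_le_mul_of_nonneg_right ?_ (by positivity)
        refine (le_mul_of_one_le_right h10 h8).trans (le_mul_of_one_le_right ?_ h9)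
        exact mul_nonneg h10 (by linarith)

/-! ### Sample complexities of related random vectors -/

section SampleComplexity

variable {Ω Ω' E : Type*} [MeasurableSpace Ω] [MeasurableSpace Ω'] [NormedAddCommGroup E]
  [NormedSpace ℝ E]

theorem sampleComplexity_anti (μ : Measure Ω) (X : Ω → E) {ε ε' : ℝ} (h : ε ≤ ε') (δ : ℝ) :
    sampleComplexity μ X ε' δ ≤ sampleComplexity μ X ε δ :=
  le_iInf₂ fun n hn => iInf₂_le n ⟨hn.1, (measure_mono fun _ hx => h.trans hx).trans hn.2⟩

/-- The sample complexity of a random vector that factors through a measure-preserving map, up to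
a scalar. -/
theorem sampleComplexity_eq_of_ae_eq_smul_comp [MeasurableSpace E] [BorelSpace E]
    [SecondCountableTopology E] {μ : Measure Ω}
    {ν : Measure Ω'} [IsProbabilityMeasure μ] [IsProbabilityMeasure ν] {g : Ω → Ω'}
    (hg : MeasurePreserving g μ ν) {X : Ω → E} {Y : Ω' → E} (hY : Measurable Y) {c : ℝ}
    (hc : c ≠ 0) (hX : ∀ᵐ ω ∂μ, X ω = c • Y (g ω)) (ε δ : ℝ) :
    sampleComplexity μ X ε δ = sampleComplexity ν Y (ε / |c|) δ := by
  have key : ∀ n : ℕ, (Measure.pi fun _ : Fin n => μ) {x | ε ≤ ‖(n : ℝ)⁻¹ • ∑ i, X (x i)‖} =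
      (Measure.pi fun _ : Fin n => ν) {x | ε / |c| ≤ ‖(n : ℝ)⁻¹ • ∑ i, Y (x i)‖} := by
    intro n
    have hm : MeasurableSet {x : Fin n → Ω' | ε / |c| ≤ ‖(n : ℝ)⁻¹ • ∑ i, Y (x i)‖} := by
      refine measurableSet_le measurable_const (Measurable.norm (Measurable.const_smul ?_ _))
      exact Finset.measurable_fun_sum _ fun i _ => hY.comp (measurable_pi_apply i)
    rw [← (measurePreserving_pi (fun _ : Fin n => μ) (fun _ => ν) fun _ => hg).measure_preimage
      hm.nullMeasurableSet]
    refine measure_congr ?_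
    have hae : ∀ᵐ x ∂(Measure.pi fun _ : Fin n => μ), ∀ i, X (x i) = c • Y (g (x i)) :=
      ae_all_iff.2 fun i =>
        (measurePreserving_eval (fun _ : Fin n => μ) i).quasiMeasurePreserving.ae hX
    refine eventuallyEq_set.2 ?_
    filter_upwards [hae] with x hx
    simp only [Set.mem_ofPred_eq, Set.mem_preimage, hx]
    rw [← Finset.smul_sum, smul_comm, norm_smul c, Real.norm_eq_abs,
      div_le_iff₀' (abs_pos.2 hc)]
  unfold sampleComplexity
  simp only [key]

end SampleComplexity

/-! ### A chain that amplifies the first action -/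

section Linear

variable {X Y : Type*} [NormedAddCommGroup X] [NormedSpace ℝ X] [NormedAddCommGroup Y]
  [NormedSpace ℝ Y]

theorem ContinuousLinearMap.lipschitzOnWith_fderivWithin_univ (A : X →L[ℝ] Y) (L : ℝ≥0) :
    LipschitzOnWith L (fderivWithin ℝ A Set.univ) Set.univ := by
  rw [fderivWithin_univ]
  have e : fderiv ℝ A = fun _ => A := funext fun x => A.fderiv
  rw [e]
  exact (LipschitzWith.const' A).weaken (zero_le) |>.lipschitzOnWith

theorem ContinuousLinearMap.smoothLipschitzOn (A : X →L[ℝ] Y) :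
    SmoothLipschitzOn A Set.univ :=
  ⟨⟨_, A.lipschitz.lipschitzOnWith⟩, A.contDiff.contDiffOn,
    ⟨0, A.lipschitzOnWith_fderivWithin_univ 0⟩⟩

theorem ContinuousLinearMap.lipschitzOnWith_of_le (A : X →L[ℝ] Y) {L : ℝ≥0}
    (hA : ∀ x, ‖A x‖ ≤ L * ‖x‖) : LipschitzOnWith L A Set.univ :=
  (A.lipschitz.weaken (A.opNorm_le_bound L.2 hA)).lipschitzOnWith

theorem ContinuousLinearMap.barLipschitzOn (A : X →L[ℝ] Y) {L : ℝ≥0} (hL : 1 ≤ L)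
    (hA : ∀ x, ‖A x‖ ≤ L * ‖x‖) : BarLipschitzOn L A Set.univ :=
  ⟨A.lipschitzOnWith_fderivWithin_univ L, A.lipschitzOnWith_of_le hA, hL⟩

end Linear

/-- The first action is amplified by the factor `L` in every step, and the last state is the only
reward. Later actions have no effect. -/
noncomputable def chainProblem (T : ℕ) (L : ℝ≥0) : ControlProblem ℝ ℝ ℝ where
  T := T
  states := Set.univ
  params := Set.univ
  f t s a := if t = 0 then L * a else L * s
  R t s _ := if t + 1 = T then s else 0
  noise _ := Measure.dirac 0
  pol θ _ := θ
  s₀ := 0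

namespace chainProblem

variable (T : ℕ) (L : ℝ≥0)

theorem stateAction_eq : (chainProblem T L).stateAction = Set.univ :=
  Set.eq_univ_of_forall fun _ => Set.mem_univ _

theorem paramState_eq : (chainProblem T L).paramState = Set.univ :=
  Set.eq_univ_of_forall fun _ => ⟨Set.mem_univ _, Set.mem_univ _⟩

theorem paramStateAction_eq : (chainProblem T L).paramStateAction = Set.univ :=
  Set.eq_univ_of_forall fun _ => ⟨Set.mem_univ _, Set.mem_univ _⟩

theorem fJoint_eq (t : ℕ) : (chainProblem T L).fJoint t =
    ((if t = 0 then (L : ℝ) • WithLp.sndL 2 ℝ ℝ ℝ else (L : ℝ) • WithLp.fstL 2 ℝ ℝ ℝ :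
      WithLp 2 (ℝ × ℝ) →L[ℝ] ℝ)) := by
  ext x
  split_ifs with h <;> simp [ControlProblem.fJoint, chainProblem, h]

theorem fPol_eq (t : ℕ) : (chainProblem T L).fPol t =
    ((if t = 0 then (L : ℝ) • WithLp.fstL 2 ℝ ℝ ℝ else (L : ℝ) • WithLp.sndL 2 ℝ ℝ ℝ :
      WithLp 2 (ℝ × ℝ) →L[ℝ] ℝ)) := by
  ext x
  split_ifs with h <;> simp [ControlProblem.fPol, chainProblem, h]

theorem RJoint_eq (t : ℕ) : (chainProblem T L).RJoint t =
    ((if t + 1 = T then WithLp.fstL 2 ℝ ℝ ℝ else 0 : WithLp 2 (ℝ × ℝ) →L[ℝ] ℝ)) := by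
  ext x
  split_ifs with h <;> simp [ControlProblem.RJoint, chainProblem, h]

theorem RPol_eq (t : ℕ) : (chainProblem T L).RPol t =
    ((if t + 1 = T then WithLp.sndL 2 ℝ ℝ ℝ else 0 : WithLp 2 (ℝ × ℝ) →L[ℝ] ℝ)) := by
  ext x
  split_ifs with h <;> simp [ControlProblem.RPol, chainProblem, h]

theorem polJoint_eq : (chainProblem T L).polJoint = WithLp.fstL 2 ℝ ℝ ℝ := by
  ext x; rfl

theorem fTilde_eq (t : ℕ) :
    (fun x : WithLp 2 (ℝ × WithLp 2 (ℝ × ℝ)) => (chainProblem T L).fTilde t x.fst x.snd) =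
    ((if t = 0 then (L : ℝ) • (WithLp.fstL 2 ℝ ℝ (WithLp 2 (ℝ × ℝ)) +
        (WithLp.sndL 2 ℝ ℝ ℝ).comp (WithLp.sndL 2 ℝ ℝ (WithLp 2 (ℝ × ℝ))))
      else (L : ℝ) • (WithLp.fstL 2 ℝ ℝ ℝ).comp (WithLp.sndL 2 ℝ ℝ (WithLp 2 (ℝ × ℝ))) :
      WithLp 2 (ℝ × WithLp 2 (ℝ × ℝ)) →L[ℝ] ℝ)) := by
  ext x
  split_ifs with h <;> simp [ControlProblem.fTilde, chainProblem, h, mul_add]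

theorem RTilde_eq {p : ℝ → ℝ} [IsProbabilityMeasure (densityLaw p)] (t : ℕ) :
    (fun x : WithLp 2 (ℝ × ℝ) => (chainProblem T L).RTilde p t x.fst x.snd) =
    ((if t + 1 = T then WithLp.sndL 2 ℝ ℝ ℝ else 0 : WithLp 2 (ℝ × ℝ) →L[ℝ] ℝ)) := by
  ext x
  split_ifs with h <;> simp [ControlProblem.RTilde, chainProblem, h]

theorem norm_smul_fstL_le (x : WithLp 2 (ℝ × ℝ)) :
    ‖((L : ℝ) • WithLp.fstL 2 ℝ ℝ ℝ : WithLp 2 (ℝ × ℝ) →L[ℝ] ℝ) x‖ ≤ L * ‖x‖ := by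
  simpa [abs_mul] using mul_le_mul_of_nonneg_left (WithLp.norm_fst_le (p := 2) ℝ x) L.2

theorem norm_smul_sndL_le (x : WithLp 2 (ℝ × ℝ)) :
    ‖((L : ℝ) • WithLp.sndL 2 ℝ ℝ ℝ : WithLp 2 (ℝ × ℝ) →L[ℝ] ℝ) x‖ ≤ L * ‖x‖ := by
  simpa [abs_mul] using mul_le_mul_of_nonneg_left (WithLp.norm_snd_le (p := 2) ℝ x) L.2

theorem barLipschitzOn_fJoint (hL : 1 ≤ L) (t : ℕ) :
    BarLipschitzOn L ((chainProblem T L).fJoint t) (chainProblem T L).stateAction := by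
  rw [stateAction_eq, fJoint_eq]
  refine ContinuousLinearMap.barLipschitzOn _ hL fun x => ?_
  split_ifs
  · exact norm_smul_sndL_le L x
  · exact norm_smul_fstL_le L x

theorem barLipschitzOn_fPol (hL : 1 ≤ L) (t : ℕ) :
    BarLipschitzOn L ((chainProblem T L).fPol t) (chainProblem T L).paramState := by
  rw [paramState_eq, fPol_eq]
  refine ContinuousLinearMap.barLipschitzOn _ hL fun x => ?_
  split_ifs
  · exact norm_smul_fstL_le L x
  · exact norm_smul_sndL_le L x

/-- The transition at time `1` attains the Lipschitz constant. -/
theorem isLeast_barLipschitzOn_fPol (hT : 2 ≤ T) (hL : 1 ≤ L) :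
    IsLeast {L' : ℝ≥0 | ∀ t < T, BarLipschitzOn L' ((chainProblem T L).fPol t)
      (chainProblem T L).paramState} L := by
  refine ⟨fun t _ => barLipschitzOn_fPol T L hL t, fun L' hL' => ?_⟩
  have h := (hL' 1 (by omega)).2.1
  rw [paramState_eq, fPol_eq] at h
  have h2 := h.dist_le_mul (WithLp.toLp 2 ((0 : ℝ), (1 : ℝ))) (Set.mem_univ _)
    (WithLp.toLp 2 ((0 : ℝ), (0 : ℝ))) (Set.mem_univ _)
  have h3 := h2.trans (mul_le_mul_of_nonneg_left (dist_toLp_le _ _ _ _) L'.2)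
  simpa using h3

theorem lipschitzOnWith_RJoint (t : ℕ) :
    LipschitzOnWith 1 ((chainProblem T L).RJoint t) (chainProblem T L).stateAction := by
  rw [stateAction_eq, RJoint_eq]
  refine ContinuousLinearMap.lipschitzOnWith_of_le _ fun x => ?_
  split_ifs
  · simpa using norm_smul_fstL_le 1 x
  · simp

theorem lipschitzOnWith_polJoint :
    LipschitzOnWith 1 (chainProblem T L).polJoint (chainProblem T L).paramState := by
  rw [paramState_eq, polJoint_eq]
  exact ContinuousLinearMap.lipschitzOnWith_of_le _ fun x => by
    simpa using norm_smul_fstL_le 1 x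

theorem regular (p : ℝ → ℝ) [IsProbabilityMeasure (densityLaw p)] :
    (chainProblem T L).Regular p where
  measurableSet_states := MeasurableSet.univ
  uniqueDiff_states := uniqueDiffOn_univ
  isOpen_params := isOpen_univ
  s₀_mem := Set.mem_univ _
  isProbabilityMeasure_noise _ _ := by unfold chainProblem; infer_instance
  step_mem _ _ _ _ _ := ae_of_all _ fun _ => Set.mem_univ _
  measurable_f t _ := by
    rcases eq_or_ne t 0 with h | h <;> simp only [chainProblem, h, Function.uncurry_def] <;>
      simp only [if_true, if_false] <;> fun_prop
  measurable_R t _ := by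
    by_cases h : t + 1 = T <;> simp only [chainProblem, h, Function.uncurry_def] <;>
      simp only [if_true, if_false] <;> fun_prop
  measurable_pol _ _ := measurable_const
  smooth_f t _ := by
    rw [stateAction_eq, fJoint_eq]; exact ContinuousLinearMap.smoothLipschitzOn _
  smooth_R t _ := by
    rw [stateAction_eq, RJoint_eq]; exact ContinuousLinearMap.smoothLipschitzOn _
  smooth_pol := by
    rw [paramState_eq, polJoint_eq]; exact ContinuousLinearMap.smoothLipschitzOn _
  smooth_fPol t _ := by
    rw [paramState_eq, fPol_eq]; exact ContinuousLinearMap.smoothLipschitzOn _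
  smooth_RPol t _ := by
    rw [paramState_eq, RPol_eq]; exact ContinuousLinearMap.smoothLipschitzOn _
  smooth_fTilde t _ := by
    rw [paramStateAction_eq, fTilde_eq]; exact ContinuousLinearMap.smoothLipschitzOn _
  smooth_RTilde t _ := by
    rw [paramState_eq, RTilde_eq]; exact ContinuousLinearMap.smoothLipschitzOn _

variable {T L} {p : ℝ → ℝ}

theorem ae_noise_eq_zero [IsProbabilityMeasure (densityLaw p)] :
    ∀ᵐ ω ∂((chainProblem T L).rolloutLaw p), ∀ t, ((chainProblem T L).noiseAt ω t).2 = 0 := by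
  rw [ae_all_iff]
  intro t
  unfold ControlProblem.noiseAt
  split_ifs with h
  · have h1 : ∀ᵐ z ∂(Measure.dirac (0 : ℝ)), z = 0 := by simp [ae_dirac_eq]
    have h2 := (Measure.quasiMeasurePreserving_snd (μ := densityLaw p)
      (ν := Measure.dirac (0 : ℝ))).ae h1
    have hp : ∀ t : Fin T, IsProbabilityMeasure
      ((densityLaw p).prod ((chainProblem T L).noise t)) := fun t => by
        unfold chainProblem; infer_instance
    exact (measurePreserving_eval (fun t : Fin T =>
      (densityLaw p).prod ((chainProblem T L).noise t)) ⟨t, h⟩).quasiMeasurePreserving.ae h2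
  · exact ae_of_all _ fun _ => rfl

theorem state_succ_eq {θ : ℝ} {ω : (chainProblem T L).RolloutNoise}
    (hω : ∀ t, ((chainProblem T L).noiseAt ω t).2 = 0) (t : ℕ) :
    (chainProblem T L).state θ ω (t + 1) =
      L ^ (t + 1) * (θ + ((chainProblem T L).noiseAt ω 0).1) := by
  induction t with
  | zero =>
    rw [ControlProblem.state, hω]
    simp [chainProblem]
  | succ t ih =>
    rw [ControlProblem.state, hω, ih]
    simp only [chainProblem]
    rw [if_neg (by omega)]
    ring

theorem valueToGo_eq [IsProbabilityMeasure (densityLaw p)] (θ : ℝ) (k : ℕ) :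
    ∀ t, 1 ≤ t → t + (k + 1) = T → ∀ s,
      (chainProblem T L).valueToGo p θ (k + 1) t s = L ^ k * s := by
  induction k with
  | zero =>
    intro t _ htk s
    simp [ControlProblem.valueToGo, ControlProblem.qStep, chainProblem, htk]
  | succ k ih =>
    intro t ht htk s
    rw [ControlProblem.valueToGo]
    have e : ∀ ξ, (chainProblem T L).qStep ((chainProblem T L).valueToGo p θ (k + 1) (t + 1)) t s
        ((chainProblem T L).pol θ s + ξ) = L ^ (k + 1) * s := fun ξ => by
      unfold ControlProblem.qStep
      simp only [ih (t + 1) (by omega) (by omega)]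
      simp only [chainProblem]
      rw [if_neg (by omega), if_neg (by omega), integral_dirac]
      ring
    simp only [e]
    simp

theorem value_succ_eq [IsProbabilityMeasure (densityLaw p)] (θ : ℝ) {t : ℕ} (ht : t + 1 < T)
    (s : ℝ) : (chainProblem T L).value p θ (t + 1) s = L ^ (T - 1 - (t + 1)) * s := by
  unfold ControlProblem.value
  have e : (chainProblem T L).T - (t + 1) = (T - 1 - (t + 1)) + 1 := by
    change T - (t + 1) = _
    omega
  rw [e]
  exact valueToGo_eq θ _ _ (by omega) (by omega) s

theorem value_zero_eq [IsProbabilityMeasure (densityLaw p)] (hT : 2 ≤ T)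
    (hi : Integrable (fun ξ => ξ) (densityLaw p)) (h0 : ∫ ξ, ξ ∂(densityLaw p) = 0) (θ s : ℝ) :
    (chainProblem T L).value p θ 0 s = L ^ (T - 1) * θ := by
  obtain ⟨k, rfl⟩ := Nat.exists_eq_add_of_le' hT
  have e : ∀ ξ, (chainProblem (k + 2) L).qStep
      ((chainProblem (k + 2) L).valueToGo p θ (k + 1) (0 + 1)) 0 s
        ((chainProblem (k + 2) L).pol θ s + ξ) = L ^ (k + 1) * (θ + ξ) := fun ξ => by
    unfold ControlProblem.qStep
    simp only [valueToGo_eq (T := k + 2) (L := L) (p := p) θ k (0 + 1) le_rfl (by omega)]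
    simp only [chainProblem]
    rw [if_neg (by omega), integral_dirac]
    simp only [if_true]
    ring
  change (chainProblem (k + 2) L).valueToGo p θ (k + 1 + 1) 0 s = _
  rw [ControlProblem.valueToGo]
  simp only [e]
  rw [integral_const_mul, integral_add (integrable_const _) hi, h0]
  simp

theorem sum_reward_eq {θ : ℝ} {ω : (chainProblem T L).RolloutNoise} (hT : 2 ≤ T)
    (hω : ∀ t, ((chainProblem T L).noiseAt ω t).2 = 0) {t : ℕ} (ht : t < T) :
    (chainProblem T L).qHat θ ω t = L ^ (T - 1) * (θ + ((chainProblem T L).noiseAt ω 0).1) := by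
  unfold ControlProblem.qHat
  rw [Finset.sum_eq_single_of_mem (T - 1) (Finset.mem_Ico.2 ⟨by omega, ?_⟩) fun i _ hi => ?_]
  · have e := state_succ_eq (θ := θ) hω (T - 2)
    rw [show T - 2 + 1 = T - 1 by omega] at e
    have e2 : (chainProblem T L).R (T - 1) ((chainProblem T L).state θ ω (T - 1))
      ((chainProblem T L).action θ ω (T - 1)) = (chainProblem T L).state θ ω (T - 1) := by
      simp only [chainProblem]
      rw [if_pos (by omega)]
    rw [e2, e]
  · change T - 1 < T; omega
  · simp only [chainProblem]
    rw [if_neg (by omega)]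

theorem measurePreserving_noiseAt_zero [IsProbabilityMeasure (densityLaw p)] (hT : 2 ≤ T) :
    MeasurePreserving (fun ω => ((chainProblem T L).noiseAt ω 0).1)
      ((chainProblem T L).rolloutLaw p) (densityLaw p) := by
  have hp : ∀ t : Fin T, IsProbabilityMeasure
      ((densityLaw p).prod ((chainProblem T L).noise t)) := fun t => by
        unfold chainProblem; infer_instance
  have hd : IsProbabilityMeasure ((chainProblem T L).noise 0) := by
    unfold chainProblem; infer_instance
  have h0 : 0 < T := by omega
  have e : ∀ ω : (chainProblem T L).RolloutNoise, (chainProblem T L).noiseAt ω 0 = ω ⟨0, h0⟩ :=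
    fun ω => dif_pos h0
  simp only [e]
  have h1 := measurePreserving_eval (fun t : Fin T =>
      (densityLaw p).prod ((chainProblem T L).noise t)) ⟨0, h0⟩
  have h2 : MeasurePreserving Prod.fst ((densityLaw p).prod ((chainProblem T L).noise 0))
    (densityLaw p) := measurePreserving_fst
  exact h2.comp h1

theorem J_eq [IsProbabilityMeasure (densityLaw p)] (hT : 2 ≤ T)
    (hi : Integrable (fun ξ => ξ) (densityLaw p)) (h0 : ∫ ξ, ξ ∂(densityLaw p) = 0) (θ : ℝ) :
    (chainProblem T L).J p θ = L ^ (T - 1) * θ := by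
  have hmp := measurePreserving_noiseAt_zero (L := L) (p := p) hT
  have e : (chainProblem T L).J p θ = ∫ ω, L ^ (T - 1) *
      (θ + ((chainProblem T L).noiseAt ω 0).1) ∂((chainProblem T L).rolloutLaw p) := by
    refine integral_congr_ae ?_
    filter_upwards [ae_noise_eq_zero] with ω hω
    have := sum_reward_eq (θ := θ) hT hω (by omega : 0 < T)
    unfold ControlProblem.qHat at this
    rwa [Nat.Ico_zero_eq_range] at this
  have e2 : ∫ x, (L : ℝ) ^ (T - 1) * (θ + x) ∂(densityLaw p) = ∫ ω, (L : ℝ) ^ (T - 1) *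
      (θ + ((chainProblem T L).noiseAt ω 0).1) ∂((chainProblem T L).rolloutLaw p) := by
    rw [← hmp.map_eq]
    exact integral_map hmp.measurable.aemeasurable (Measurable.aestronglyMeasurable (by fun_prop))
  rw [e, ← e2, integral_const_mul, integral_add (integrable_const _) hi, h0]
  simp

theorem score_eq (θ s ξ : ℝ) : (chainProblem T L).score p θ s (θ + ξ) =
    -deriv (fun x => Real.log (p x)) ξ := by
  unfold ControlProblem.score
  rw [gradient_eq_deriv']
  change deriv (fun θ' => (fun x => Real.log (p x)) (θ + ξ - θ')) θ = _
  rw [deriv_comp_const_sub (f := fun x => Real.log (p x))]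
  simp

/-- After the first action the value function predicts the reward exactly. -/
theorem pgEstimate_eq [IsProbabilityMeasure (densityLaw p)] (hT : 2 ≤ T)
    (hi : Integrable (fun ξ => ξ) (densityLaw p)) (h0 : ∫ ξ, ξ ∂(densityLaw p) = 0) (θ : ℝ)
    {ω : (chainProblem T L).RolloutNoise} (hω : ∀ t, ((chainProblem T L).noiseAt ω t).2 = 0) :
    (chainProblem T L).pgEstimate p θ ω =
      -L ^ (T - 1) * noiseScore p ((chainProblem T L).noiseAt ω 0).1 := by
  unfold ControlProblem.pgEstimate
  have h0T : 0 ∈ Finset.range (chainProblem T L).T := Finset.mem_range.2 (by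
    change 0 < T; omega)
  rw [Finset.sum_eq_single_of_mem 0 h0T fun t ht ht0 => ?_]
  · have e1 : (chainProblem T L).action θ ω 0 = θ + ((chainProblem T L).noiseAt ω 0).1 := rfl
    rw [sum_reward_eq hT hω (by omega), value_zero_eq hT hi h0, e1, score_eq, noiseScore,
      smul_eq_mul]
    ring
  · obtain ⟨t, rfl⟩ := Nat.exists_eq_succ_of_ne_zero ht0
    have ht' : t + 1 < T := Finset.mem_range.1 ht
    rw [sum_reward_eq hT hω ht', Nat.succ_eq_add_one, value_succ_eq θ ht', state_succ_eq hω,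
      ← mul_assoc, ← pow_add, show T - 1 - (t + 1) + (t + 1) = T - 1 by omega, sub_self, zero_smul]

/-- The error of the estimate is that of the noise score of the first action noise, scaled by the
gain of the chain. -/
theorem nPG_eq [IsProbabilityMeasure (densityLaw p)] (hT : 2 ≤ T) (hL : 1 ≤ L)
    (hi : Integrable (fun ξ => ξ) (densityLaw p)) (h0 : ∫ ξ, ξ ∂(densityLaw p) = 0)
    (hs : ∫ ξ, noiseScore p ξ ∂(densityLaw p) = -1) (θ ε δ : ℝ) :
    (chainProblem T L).nPG p θ ε δ = nNoise p (ε / (L : ℝ) ^ (T - 1)) δ := by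
  have hL0 : (0 : ℝ) < (L : ℝ) ^ (T - 1) := pow_pos (lt_of_lt_of_le one_pos hL) _
  have hpr : IsProbabilityMeasure ((chainProblem T L).rolloutLaw p) := by
    have hp : ∀ t : Fin (chainProblem T L).T, IsProbabilityMeasure
      ((densityLaw p).prod ((chainProblem T L).noise t)) := fun t => by
        unfold chainProblem; infer_instance
    unfold ControlProblem.rolloutLaw
    infer_instance
  have hg : gradient ((chainProblem T L).J p) θ = L ^ (T - 1) := by
    rw [gradient_eq_deriv', funext fun θ' => J_eq (L := L) hT hi h0 θ',
      deriv_const_mul _ (by fun_prop)]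
    simp
  have hm : Measurable (noiseScore p) := by
    unfold noiseScore
    exact measurable_id.mul (measurable_deriv _)
  have := sampleComplexity_eq_of_ae_eq_smul_comp
    (measurePreserving_noiseAt_zero (L := L) (p := p) hT)
    (X := fun ω => (chainProblem T L).pgEstimate p θ ω - gradient ((chainProblem T L).J p) θ)
    (Y := fun ξ => noiseScore p ξ - ∫ x, noiseScore p x ∂(densityLaw p)) (hm.sub_const _)
    (c := -L ^ (T - 1)) (by simpa using hL0.ne') (by
      filter_upwards [ae_noise_eq_zero] with ω hω
      rw [pgEstimate_eq hT hi h0 θ hω, hg, hs, smul_eq_mul]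
      ring) ε δ
  rw [abs_neg, abs_of_pos hL0] at this
  exact this

end chainProblem

/-- Integration by parts. -/
theorem integral_noiseScore {p : ℝ → ℝ} (hp0 : ∀ ξ, 0 ≤ p ξ)
    (hp : IsProbabilityMeasure (densityLaw p)) (hd : Differentiable ℝ p)
    (htop : Tendsto (fun ξ => ξ * p ξ) atTop (𝓝 0))
    (hbot : Tendsto (fun ξ => ξ * p ξ) atBot (𝓝 0))
    (hi : Integrable (noiseScore p) (densityLaw p)) :
    ∫ ξ, noiseScore p ξ ∂(densityLaw p) = -1 := by
  have hpm : Measurable fun ξ => ENNReal.ofReal (p ξ) := hd.continuous.measurable.ennreal_ofReal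
  have hlt : ∀ᵐ ξ ∂(volume : Measure ℝ), ENNReal.ofReal (p ξ) < ⊤ := ae_of_all _ fun _ => by simp
  have hmass : ∫⁻ ξ, ENNReal.ofReal (p ξ) = 1 := by
    have := hp.measure_univ
    rwa [densityLaw, withDensity_apply _ MeasurableSet.univ, Measure.restrict_univ] at this
  have hpi : Integrable p := by
    refine ⟨hd.continuous.aestronglyMeasurable, ?_⟩
    rw [hasFiniteIntegral_iff_ofReal (ae_of_all _ hp0), hmass]
    simp
  have hp1 : ∫ ξ, p ξ = 1 := by
    rw [integral_eq_lintegral_of_nonneg_ae (ae_of_all _ hp0) hd.continuous.aestronglyMeasurable,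
      hmass]
    simp
  have e : ∀ ξ, (ENNReal.ofReal (p ξ)).toReal • noiseScore p ξ = ξ * deriv p ξ := fun ξ => by
    rw [ENNReal.toReal_ofReal (hp0 ξ), noiseScore, smul_eq_mul]
    rcases eq_or_ne (p ξ) 0 with h | h
    · -- a zero of a nonnegative density is a minimum
      have hmin : IsLocalMin p ξ := Eventually.of_forall fun x => by rw [h]; exact hp0 x
      rw [hmin.deriv_eq_zero, h]; simp
    · have := deriv.log (hd ξ) h
      rw [this]; field_simp
  rw [densityLaw] at hi ⊢
  rw [integral_withDensity_eq_integral_toReal_smul hpm hlt]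
  have hi2 := (integrable_withDensity_iff_integrable_smul' hpm hlt).1 hi
  simp only [e] at hi2 ⊢
  have hder : ∀ ξ, HasDerivAt (fun ξ => ξ * p ξ) (p ξ + ξ * deriv p ξ) ξ := fun ξ => by
    exact ((hasDerivAt_id ξ).mul (hd ξ).hasDerivAt).congr_deriv (by simp)
  have hI := integral_of_hasDerivAt_of_tendsto hder (hpi.add hi2) hbot htop
  rw [integral_add hpi hi2, hp1] at hI
  linarith

/-! ### Gaussian action noise on the line -/

section GaussianLine

variable {σ : ℝ}

theorem integrable_pow_gaussianDensity (hσ : 0 < σ) (k : ℕ) :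
    Integrable (fun ξ : ℝ => ξ ^ k) (densityLaw (gaussianDensity ℝ σ)) := by
  have h := (hasSubgaussianNorm_gaussianDensity (V := ℝ) le_rfl (by simp) hσ).integrable_norm_pow k
  exact h.mono' (by fun_prop) (ae_of_all _ fun ξ => by simp)

theorem integral_id_gaussianDensity (hσ : 0 < σ) :
    ∫ ξ, ξ ∂(densityLaw (gaussianDensity ℝ σ)) = 0 := by
  rw [integral_densityLaw_gaussianDensity hσ]
  have h := integral_neg_eq_self (fun ξ : ℝ => gaussianDensity ℝ σ ξ • ξ) volume
  have e : ∀ ξ : ℝ, gaussianDensity ℝ σ (-ξ) • -ξ = -(gaussianDensity ℝ σ ξ • ξ) := fun ξ => by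
    simp [gaussianDensity]
  simp only [e, integral_neg] at h
  linarith

theorem differentiable_gaussianDensity (σ : ℝ) : Differentiable ℝ (gaussianDensity ℝ σ) := by
  unfold gaussianDensity
  simp only [Real.norm_eq_abs, sq_abs]
  fun_prop

theorem tendsto_mul_gaussianDensity (hσ : 0 < σ) :
    Tendsto (fun ξ => ξ * gaussianDensity ℝ σ ξ) (cocompact ℝ) (𝓝 0) := by
  have h := (tendsto_rpow_abs_mul_exp_neg_mul_sq_cocompact (a := 1 / (2 * σ ^ 2)) (by positivity)
    1).const_mul ((2 * Real.pi * σ ^ 2) ^ (-(Module.finrank ℝ ℝ : ℝ) / 2))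
  rw [mul_zero] at h
  refine squeeze_zero_norm (fun ξ => le_of_eq ?_) h
  rw [Real.norm_eq_abs, abs_mul, abs_of_pos (gaussianDensity_pos hσ ξ), gaussianDensity,
    Real.rpow_one, Real.norm_eq_abs, sq_abs,
    show -(1 / (2 * σ ^ 2)) * ξ ^ 2 = -ξ ^ 2 / (2 * σ ^ 2) by ring]
  ring

theorem noiseScore_gaussianDensity (hσ : 0 < σ) (ξ : ℝ) :
    noiseScore (gaussianDensity ℝ σ) ξ = -ξ ^ 2 / σ ^ 2 := by
  unfold noiseScore
  simp only [log_gaussianDensity hσ, Real.norm_eq_abs, sq_abs]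
  have h : HasDerivAt (fun x : ℝ => -x ^ 2 / (2 * σ ^ 2)) (-(2 * ξ) / (2 * σ ^ 2)) ξ := by
    simpa using ((hasDerivAt_pow 2 ξ).neg.div_const (2 * σ ^ 2))
  rw [(h.const_add _).deriv]
  field_simp

theorem integrable_noiseScore_gaussianDensity (hσ : 0 < σ) :
    Integrable (noiseScore (gaussianDensity ℝ σ)) (densityLaw (gaussianDensity ℝ σ)) := by
  rw [funext (noiseScore_gaussianDensity hσ)]
  exact (integrable_pow_gaussianDensity hσ 2).neg.div_const _

theorem integral_noiseScore_gaussianDensity (hσ : 0 < σ) :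
    ∫ ξ, noiseScore (gaussianDensity ℝ σ) ξ ∂(densityLaw (gaussianDensity ℝ σ)) = -1 :=
  integral_noiseScore (fun ξ => (gaussianDensity_pos hσ ξ).le)
    (isProbabilityMeasure_densityLaw_gaussianDensity hσ) (differentiable_gaussianDensity σ)
    ((tendsto_mul_gaussianDensity hσ).mono_left atTop_le_cocompact)
    ((tendsto_mul_gaussianDensity hσ).mono_left atBot_le_cocompact)
    (integrable_noiseScore_gaussianDensity hσ)

theorem lintegral_exp_mul_one_sub_sq (hσ : 0 < σ) {t : ℝ} (ht : 0 < t) :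
    ∫⁻ ξ, ENNReal.ofReal (Real.exp (t * (1 - ξ ^ 2 / σ ^ 2))) ∂(densityLaw (gaussianDensity ℝ σ)) =
      ENNReal.ofReal (Real.exp t * (1 / (1 + 2 * t)) ^ (1 / 2 : ℝ)) := by
  have e : ∀ ξ : ℝ, ENNReal.ofReal (Real.exp (t * (1 - ξ ^ 2 / σ ^ 2))) =
      ENNReal.ofReal (Real.exp t) * ENNReal.ofReal (Real.exp (-(t / σ ^ 2) * ‖ξ‖ ^ 2)) :=
    fun ξ => by
    rw [← ENNReal.ofReal_mul (Real.exp_pos _).le, ← Real.exp_add, Real.norm_eq_abs, sq_abs]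
    congr 2
    ring
  have e2 : 1 - 2 * σ ^ 2 * -(t / σ ^ 2) = 1 + 2 * t := by field_simp; ring
  rw [lintegral_congr e, lintegral_const_mul _ (by fun_prop), lintegral_exp_sq_gaussianDensity hσ
    (by linarith), e2, ← ENNReal.ofReal_mul (Real.exp_pos _).le]
  simp

theorem integrable_exp_mul_one_sub_sq (hσ : 0 < σ) {t : ℝ} (ht : 0 < t) :
    Integrable (fun ξ : ℝ => Real.exp (t * (1 - ξ ^ 2 / σ ^ 2)))
      (densityLaw (gaussianDensity ℝ σ)) := by
  refine ⟨by fun_prop, ?_⟩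
  rw [hasFiniteIntegral_iff_ofReal (ae_of_all _ fun _ => (Real.exp_pos _).le),
    lintegral_exp_mul_one_sub_sq hσ ht]
  simp

theorem integral_exp_mul_one_sub_sq (hσ : 0 < σ) {t : ℝ} (ht : 0 < t) :
    ∫ ξ, Real.exp (t * (1 - ξ ^ 2 / σ ^ 2)) ∂(densityLaw (gaussianDensity ℝ σ)) =
      Real.exp t * (1 / (1 + 2 * t)) ^ (1 / 2 : ℝ) := by
  rw [integral_eq_lintegral_of_nonneg_ae (ae_of_all _ fun _ => (Real.exp_pos _).le) (by fun_prop),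
    lintegral_exp_mul_one_sub_sq hσ ht, ENNReal.toReal_ofReal (by positivity)]

end GaussianLine

/-! ### Anti-concentration of the empirical mean -/

/-- A lower bound of the Laplace transform of the centred noise score, see
`integral_exp_mul_one_sub_sq`. -/
theorem exp_sq_div_three_le {t : ℝ} (ht : 0 ≤ t) (ht1 : t ≤ 1) :
    Real.exp (t ^ 2 / 3) ≤ Real.exp t * (1 / (1 + 2 * t)) ^ (1 / 2 : ℝ) := by
  have hv : 0 ≤ 2 * t - 2 * t ^ 2 / 3 := by nlinarith
  have h1 : 1 + 2 * t ≤ Real.exp (2 * t - 2 * t ^ 2 / 3) := by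
    refine le_trans ?_ (Real.quadratic_le_exp_of_nonneg hv)
    have h2 : (2 / 3 : ℝ) ^ 2 ≤ (1 - t / 3) ^ 2 := pow_le_pow_left₀ (by norm_num) (by linarith) 2
    have h3 := mul_le_mul_of_nonneg_left h2 (sq_nonneg t)
    nlinarith [sq_nonneg t]
  have h4 : Real.exp (-(t - t ^ 2 / 3)) ≤ (1 / (1 + 2 * t)) ^ (1 / 2 : ℝ) := by
    rw [one_div, Real.inv_rpow (by positivity), Real.exp_neg]
    refine inv_anti₀ (by positivity) ?_
    calc (1 + 2 * t) ^ (1 / 2 : ℝ) ≤ Real.exp (2 * t - 2 * t ^ 2 / 3) ^ (1 / 2 : ℝ) :=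
          Real.rpow_le_rpow (by positivity) h1 (by norm_num)
      _ = Real.exp (t - t ^ 2 / 3) := by rw [← Real.exp_mul]; ring_nf
  calc Real.exp (t ^ 2 / 3) = Real.exp t * Real.exp (-(t - t ^ 2 / 3)) := by
        rw [← Real.exp_add]; ring_nf
    _ ≤ _ := by gcongr

/-- An upper bound of the Laplace transform of the centred noise score, see
`integral_exp_mul_one_sub_sq`. -/
theorem exp_mul_rpow_le_exp_sq {t : ℝ} (ht : 0 ≤ t) :
    Real.exp t * (1 / (1 + 2 * t)) ^ (1 / 2 : ℝ) ≤ Real.exp (t ^ 2) := by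
  have h1 := Real.le_log_one_add_of_nonneg (x := 2 * t) (by positivity)
  have h2 : t - t ^ 2 ≤ 2 * t / (2 * t + 2) := by
    rw [le_div_iff₀ (by positivity)]
    nlinarith [pow_nonneg ht 3]
  have h3 : 2 * (2 * t) / (2 * t + 2) = 2 * (2 * t / (2 * t + 2)) := by ring
  rw [Real.rpow_def_of_pos (by positivity), one_div, Real.log_inv, ← Real.exp_add,
    Real.exp_le_exp]
  linarith

/-- A sum of independent copies of `Y` is at least of order `√n` with probability bounded below,
provided that the Laplace transform of `Y` at `1 / √n` and `2 / √n` behaves like that of a centred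
variable of variance of order one. -/
theorem le_measureReal_abs_sum {Ω : Type*} [MeasurableSpace Ω] {ν : Measure Ω}
    [IsProbabilityMeasure ν] {Y : Ω → ℝ} (hY : Measurable Y) {n : ℕ} {t : ℝ} (ht : 0 < t)
    (h1 : Integrable (fun x => Real.exp (t * Y x)) ν)
    (h2 : Integrable (fun x => Real.exp (2 * t * Y x)) ν)
    (hm1 : Real.exp (1 / 3) ≤ (∫ x, Real.exp (t * Y x) ∂ν) ^ n)
    (hm2 : (∫ x, Real.exp (2 * t * Y x) ∂ν) ^ n ≤ Real.exp 4) :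
    Real.exp (-4) / 36 ≤
      (Measure.pi fun _ : Fin n => ν).real {x | 1 / (6 * t) ≤ |∑ i, Y (x i)|} := by
  set μ := Measure.pi fun _ : Fin n => ν
  set E : Set (Fin n → Ω) := {x | 1 / (6 * t) ≤ |∑ i, Y (x i)|} with hE
  have hEm : MeasurableSet E := measurableSet_le measurable_const
    (Finset.measurable_fun_sum _ fun i _ => hY.comp (measurable_pi_apply i)).abs
  set κ : ℝ := Real.exp (-4) / 6 with hκ
  have hκ0 : 0 < κ := by positivity
  have e1 : ∀ (r : ℝ) (x : Fin n → Ω), ∏ i, Real.exp (r * Y (x i)) =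
      Real.exp (r * ∑ i, Y (x i)) := fun r x => by
    rw [← Real.exp_sum, Finset.mul_sum]
  have i1 : Integrable (fun x : Fin n → Ω => Real.exp (t * ∑ i, Y (x i))) μ := by
    simpa only [e1] using Integrable.fintype_prod (ι := Fin n) (μ := fun _ => ν) fun _ => h1
  have i2 : Integrable (fun x : Fin n → Ω => Real.exp (2 * t * ∑ i, Y (x i))) μ := by
    simpa only [e1] using Integrable.fintype_prod (ι := Fin n) (μ := fun _ => ν) fun _ => h2
  have m1 : ∫ x, Real.exp (t * ∑ i, Y (x i)) ∂μ = (∫ x, Real.exp (t * Y x) ∂ν) ^ n := by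
    simpa only [e1, Fintype.card_fin] using
      integral_fintype_prod_eq_pow (ι := Fin n) (μ := ν) fun x => Real.exp (t * Y x)
  have m2 : ∫ x, Real.exp (2 * t * ∑ i, Y (x i)) ∂μ = (∫ x, Real.exp (2 * t * Y x) ∂ν) ^ n := by
    simpa only [e1, Fintype.card_fin] using
      integral_fintype_prod_eq_pow (ι := Fin n) (μ := ν) fun x => Real.exp (2 * t * Y x)
  have i3 : Integrable (fun x => E.indicator 1 x / (2 * κ)) μ :=
    ((integrable_const (1 : ℝ)).indicator hEm).div_const _
  have hpt : ∀ x : Fin n → Ω, Real.exp (t * ∑ i, Y (x i)) ≤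
      Real.exp (1 / 6) + (κ / 2 * Real.exp (2 * t * ∑ i, Y (x i)) +
        E.indicator 1 x / (2 * κ)) := fun x => by
    set S := ∑ i, Y (x i) with hS
    have e2 : Real.exp (2 * t * S) = Real.exp (t * S) ^ 2 := by
      rw [← Real.exp_nat_mul]; push_cast; ring_nf
    by_cases hx : x ∈ E
    · have h3 : Real.exp (t * S) ≤ κ / 2 * Real.exp (t * S) ^ 2 + 1 / (2 * κ) := by
        have h5 : κ / 2 * Real.exp (t * S) ^ 2 + 1 / (2 * κ) - Real.exp (t * S) =
            (κ * Real.exp (t * S) - 1) ^ 2 / (2 * κ) := by field_simp; ring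
        have h6 : 0 ≤ (κ * Real.exp (t * S) - 1) ^ 2 / (2 * κ) := by positivity
        linarith
      rw [Set.indicator_of_mem hx, Pi.one_apply, e2]
      linarith [Real.exp_pos (1 / 6 : ℝ)]
    · rw [Set.indicator_of_notMem hx, zero_div, add_zero]
      have h7 : |S| < 1 / (6 * t) := not_le.1 hx
      have h8 : t * S ≤ 1 / 6 := by
        have := (le_abs_self S).trans h7.le
        rw [le_div_iff₀ (by positivity)] at this
        linarith
      have := Real.exp_le_exp.2 h8
      have : 0 ≤ κ / 2 * Real.exp (2 * t * S) := by positivity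
      linarith
  have i4 : Integrable (fun x => κ / 2 * Real.exp (2 * t * ∑ i, Y (x i)) +
      E.indicator 1 x / (2 * κ)) μ := (i2.const_mul (κ / 2)).add i3
  have hint := integral_mono i1 ((integrable_const _).add i4) hpt
  have hcalc : ∫ x, (Real.exp (1 / 6) + (κ / 2 * Real.exp (2 * t * ∑ i, Y (x i)) +
        E.indicator 1 x / (2 * κ))) ∂μ = Real.exp (1 / 6) + (κ / 2 *
          (∫ x, Real.exp (2 * t * Y x) ∂ν) ^ n + μ.real E / (2 * κ)) := by
    rw [integral_add (integrable_const _) i4,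
      integral_add (i2.const_mul _) i3, integral_const_mul, m2, integral_div,
      integral_indicator_one hEm]
    simp
  have hint' : (∫ x, Real.exp (t * Y x) ∂ν) ^ n ≤ Real.exp (1 / 6) + (κ / 2 *
      (∫ x, Real.exp (2 * t * Y x) ∂ν) ^ n + μ.real E / (2 * κ)) := by
    rw [← m1, ← hcalc]; exact hint
  have h9 : κ / 2 * (∫ x, Real.exp (2 * t * Y x) ∂ν) ^ n ≤ 1 / 12 := by
    calc κ / 2 * (∫ x, Real.exp (2 * t * Y x) ∂ν) ^ n ≤ κ / 2 * Real.exp 4 := by gcongr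
      _ = 1 / 12 := by
        rw [hκ, Real.exp_neg]; field_simp; norm_num
  have h10 : Real.exp (1 / 6) + 1 / 6 ≤ Real.exp (1 / 3) := by
    have a : Real.exp (1 / 3) = Real.exp (1 / 6) * Real.exp (1 / 6) := by
      rw [← Real.exp_add]; norm_num
    have b := Real.add_one_le_exp (1 / 6 : ℝ)
    rw [a]; nlinarith
  have h11 : 1 / 12 ≤ μ.real E / (2 * κ) := by linarith
  rw [le_div_iff₀ (by positivity)] at h11
  calc Real.exp (-4) / 36 = 1 / 12 * (2 * κ) := by rw [hκ]; ring
    _ ≤ _ := h11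

/-- The empirical mean of `n` copies of the centred Gaussian noise score is at least of order
`1 / √n` with probability bounded below. -/
theorem le_measureReal_gaussian_noiseScore {σ : ℝ} (hσ : 0 < σ) {n : ℕ} (hn : 1 ≤ n) :
    Real.exp (-4) / 36 ≤ (Measure.pi fun _ : Fin n => densityLaw (gaussianDensity ℝ σ)).real
      {x | √n / 6 ≤ |∑ i, (1 - x i ^ 2 / σ ^ 2)|} := by
  have := isProbabilityMeasure_densityLaw_gaussianDensity (V := ℝ) hσ
  have hn0 : (1 : ℝ) ≤ n := by exact_mod_cast hn
  have hs : 1 ≤ √(n : ℝ) := Real.one_le_sqrt.2 hn0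
  have hs2 : √(n : ℝ) ^ 2 = n := Real.sq_sqrt (by positivity)
  set t : ℝ := 1 / √n with ht
  have ht0 : 0 < t := by positivity
  have ht1 : t ≤ 1 := by rw [ht, div_le_one (by positivity)]; exact hs
  have hnt : n * t ^ 2 = 1 := by rw [ht, div_pow, hs2]; field_simp
  have key := le_measureReal_abs_sum (ν := densityLaw (gaussianDensity ℝ σ))
    (Y := fun ξ => 1 - ξ ^ 2 / σ ^ 2) (by fun_prop) (n := n) ht0
    (integrable_exp_mul_one_sub_sq hσ ht0) (integrable_exp_mul_one_sub_sq hσ (by positivity)) ?_ ?_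
  · have e : 1 / (6 * t) = √n / 6 := by rw [ht]; field_simp
    rwa [e] at key
  · rw [integral_exp_mul_one_sub_sq hσ ht0]
    calc Real.exp (1 / 3) = Real.exp (t ^ 2 / 3) ^ n := by
          rw [← Real.exp_nat_mul]; congr 1; linear_combination -(1 / 3 : ℝ) * hnt
      _ ≤ _ := pow_le_pow_left₀ (Real.exp_pos _).le (exp_sq_div_three_le ht0.le ht1) n
  · rw [integral_exp_mul_one_sub_sq hσ (by positivity)]
    calc _ ≤ Real.exp ((2 * t) ^ 2) ^ n :=
          pow_le_pow_left₀ (by positivity) (exp_mul_rpow_le_exp_sq (by positivity)) n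
      _ = Real.exp 4 := by
          rw [← Real.exp_nat_mul]; congr 1; linear_combination 4 * hnt

/-- A sample size `n` below the order of `1 / η²` is admissible only if `δ` exceeds the constant of
`le_measureReal_gaussian_noiseScore`. -/
theorem le_sqrtENat_nNoise_gaussianDensity {σ η δ b : ℝ} (hσ : 0 < σ) (hδ : 0 < δ)
    (hbη : b ^ 2 ≤ 1 / (36 * η ^ 2)) (hη : 0 < η)
    (hbδ : b ^ 2 ≤ Real.exp (-4) / 36 / δ) :
    ENNReal.ofReal b ≤ sqrtENat (nNoise (gaussianDensity ℝ σ) η δ) := by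
  have := isProbabilityMeasure_densityLaw_gaussianDensity (V := ℝ) hσ
  have h1 : ((⌈b ^ 2⌉₊ : ℕ) : ℕ∞) ≤ nNoise (gaussianDensity ℝ σ) η δ := by
    refine le_iInf₂ fun n hn => ?_
    obtain ⟨hn1, hn2⟩ := hn
    have hn0 : (1 : ℝ) ≤ n := by exact_mod_cast hn1
    refine Nat.cast_le.2 (Nat.ceil_le.2 ?_)
    rw [integral_noiseScore_gaussianDensity hσ] at hn2
    have e : ∀ x : Fin n → ℝ, ‖(n : ℝ)⁻¹ • ∑ i, (noiseScore (gaussianDensity ℝ σ) (x i) - -1)‖ =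
        |∑ i, (1 - x i ^ 2 / σ ^ 2)| / n := fun x => by
      rw [norm_smul, Real.norm_eq_abs, Real.norm_eq_abs, abs_of_pos (by positivity), div_eq_inv_mul]
      congr 2
      refine Finset.sum_congr rfl fun i _ => ?_
      rw [noiseScore_gaussianDensity hσ]; ring
    simp only [e] at hn2
    by_cases hc : n * η ≤ √n / 6
    · have h2 : Real.exp (-4) / 36 ≤ δ := by
        refine (le_measureReal_gaussian_noiseScore hσ hn1).trans ?_
        refine ENNReal.toReal_le_of_le_ofReal hδ.le (le_trans (measure_mono fun x hx => ?_) hn2)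
        rw [Set.mem_ofPred_eq] at hx ⊢
        rw [le_div_iff₀ (by positivity)]
        linarith
      have h3 : Real.exp (-4) / 36 / δ ≤ 1 := by rw [div_le_one hδ]; exact h2
      linarith
    · -- here `√n > 1 / (6 η)`
      have hs2 : √(n : ℝ) ^ 2 = n := Real.sq_sqrt (by positivity)
      have hs0 : 0 < √(n : ℝ) := Real.sqrt_pos.2 (by positivity)
      have h4 : 1 ≤ 6 * η * √n := by
        have h5 : √(n : ℝ) ≤ 6 * η * √n * √n := by nlinarith
        by_contra h6
        nlinarith
      have h7 : 1 / (36 * η ^ 2) ≤ n := by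
        rw [div_le_iff₀ (by positivity)]
        have := pow_le_pow_left₀ zero_le_one h4 2
        nlinarith
      linarith
  refine le_trans ?_ (sqrtENat_mono h1)
  rw [sqrtENat_natCast]
  exact ENNReal.ofReal_le_ofReal (Real.le_sqrt_of_sq_le (Nat.le_ceil _))

theorem sq_exp_mul_min_le {x y : ℝ} (hx : 0 ≤ x) (hy : 0 ≤ y) :
    (Real.exp (-2) / 6 * min x y) ^ 2 ≤ Real.exp (-4) / 36 * x ^ 2 ∧
      (Real.exp (-2) / 6 * min x y) ^ 2 ≤ Real.exp (-4) / 36 * y ^ 2 := by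
  have e : (Real.exp (-2) / 6 * min x y) ^ 2 = Real.exp (-4) / 36 * min x y ^ 2 := by
    rw [mul_pow, div_pow, ← Real.exp_nat_mul]; norm_num
  have h0 : 0 ≤ min x y := le_min hx hy
  rw [e]
  exact ⟨by gcongr; exact min_le_left _ _, by gcongr; exact min_le_right _ _⟩

/-- The gain of the chain exceeds `ε`, so that `1 / η ≥ L` for the rescaled accuracy
`η = ε / L ^ (T - 1)`. This turns the rate `1 / η²` into `L / η = L ^ T / ε`. -/
theorem chainProblem.le_sqrtENat_nPG {T : ℕ} {L : ℝ≥0} (hT : 2 ≤ T) (hL : 1 ≤ L) {σ : ℝ}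
    (hσ : 0 < σ) (θ : ℝ) {ε δ : ℝ} (hε : 0 < ε) (hεL : ε ≤ (L : ℝ) ^ (T - 2)) (hδ : 0 < δ) :
    ENNReal.ofReal (Real.exp (-2) / 6 * min ((L : ℝ) ^ ((T : ℝ) / 2) / ε ^ (1 / 2 : ℝ))
      (1 / δ ^ (1 / 2 : ℝ))) ≤
      sqrtENat ((chainProblem T L).nPG (gaussianDensity ℝ σ) θ ε δ) := by
  have := isProbabilityMeasure_densityLaw_gaussianDensity (V := ℝ) hσ
  have hL1 : (1 : ℝ) ≤ L := hL
  have hL0 : (0 : ℝ) < L := lt_of_lt_of_le one_pos hL1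
  rw [chainProblem.nPG_eq hT hL (by simpa using integrable_pow_gaussianDensity hσ 1)
    (integral_id_gaussianDensity hσ) (integral_noiseScore_gaussianDensity hσ)]
  have hsx : ((L : ℝ) ^ ((T : ℝ) / 2) / ε ^ (1 / 2 : ℝ)) ^ 2 = (L : ℝ) ^ T / ε := by
    rw [div_pow, ← Real.rpow_natCast, ← Real.rpow_natCast, ← Real.rpow_mul hL0.le,
      ← Real.rpow_mul hε.le]
    norm_num
  have hsy : (1 / δ ^ (1 / 2 : ℝ)) ^ 2 = 1 / δ := by
    rw [div_pow, one_pow, ← Real.rpow_natCast, ← Real.rpow_mul hδ.le]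
    norm_num
  obtain ⟨hx, hy⟩ := sq_exp_mul_min_le (x := (L : ℝ) ^ ((T : ℝ) / 2) / ε ^ (1 / 2 : ℝ))
    (y := 1 / δ ^ (1 / 2 : ℝ)) (by positivity) (by positivity)
  rw [hsx] at hx
  rw [hsy] at hy
  refine le_sqrtENat_nNoise_gaussianDensity hσ hδ (hx.trans ?_) (by positivity)
    (hy.trans_eq (by ring))
  obtain ⟨k, rfl⟩ := Nat.exists_eq_add_of_le' hT
  rw [show k + 2 - 2 = k by omega] at hεL
  rw [show k + 2 - 1 = k + 1 by omega]
  have hexp : Real.exp (-4) ≤ 1 := Real.exp_le_one_iff.2 (by norm_num)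
  calc Real.exp (-4) / 36 * ((L : ℝ) ^ (k + 2) / ε) ≤ 1 / 36 * ((L : ℝ) ^ (k + 2) / ε) := by
        gcongr
    _ ≤ 1 / 36 * (((L : ℝ) ^ (k + 2) / ε) * ((L : ℝ) ^ k / ε)) := by
        gcongr
        exact le_mul_of_one_le_right (by positivity) ((one_le_div hε).2 hεL)
    _ = 1 / (36 * (ε / (L : ℝ) ^ (k + 1)) ^ 2) := by
        field_simp
        ring

theorem chainProblem.differentiableAt_J {T : ℕ} {L : ℝ≥0} {p : ℝ → ℝ}
    [IsProbabilityMeasure (densityLaw p)] (hT : 2 ≤ T)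
    (hi : Integrable (fun ξ => ξ) (densityLaw p)) (h0 : ∫ ξ, ξ ∂(densityLaw p) = 0) (θ : ℝ) :
    DifferentiableAt ℝ ((chainProblem T L).J p) θ := by
  rw [funext (chainProblem.J_eq hT hi h0)]
  fun_prop

theorem theorem4 :
    -- upper bound
    (∃ C : ℝ, 0 < C ∧
      ∀ (dS dA dΘ : ℕ)
        (P : ControlProblem (EuclideanSpace ℝ (Fin dS)) (EuclideanSpace ℝ (Fin dA))
          (EuclideanSpace ℝ (Fin dΘ)))
        (σ : ℝ≥0) (p : EuclideanSpace ℝ (Fin dA) → ℝ),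
        0 < σ → p = gaussianDensity (EuclideanSpace ℝ (Fin dA)) σ → P.Regular p →
        (∀ t < P.T, IsSubGaussianVector σ (P.noise t)) →
        ∀ θ ∈ P.params, ∀ LR LRt Lf Lπ Lft : ℝ≥0,
          (∀ t < P.T, LipschitzOnWith LR (P.RJoint t) P.stateAction) →
          (∀ t < P.T, LipschitzOnWith LRt (P.RTilde p t θ) P.states) →
          (∀ t < P.T, BarLipschitzOn Lf (P.fJoint t) P.stateAction) →
          LipschitzOnWith Lπ P.polJoint P.paramState →
          (∀ t < P.T, BarLipschitzOn Lft (P.fTilde t θ) P.stateAction) →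
          DifferentiableAt ℝ (P.J p) θ ∧
          ∀ K : ℝ, K = (P.T : ℝ) ^ 6 * (LR + LRt) * Lf * Lπ * Lft ^ P.T * (max dS dA : ℝ) ^ 4 →
          ∀ ε δ : ℝ, 0 < ε → ε ≤ K → 0 < δ → δ < 1 →
            sqrtENat (P.nPG p θ ε δ) ≤
              ENNReal.ofReal (C * (K / ε) * (1 + Real.log P.T) *
                (1 + Real.log (max dS dA : ℝ)) ^ (3 / 2 : ℝ) *
                (1 + Real.log (1 / δ)) ^ (1 / 2 : ℝ))) ∧
    -- lower bounds
    (∃ c : ℝ, 0 < c ∧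
      ∀ (T : ℕ) (L : ℝ≥0), 2 ≤ T → 1 ≤ L →
        ∃ (P : ControlProblem ℝ ℝ ℝ) (θ : ℝ), P.T = T ∧ θ ∈ P.params ∧
          (∀ t < T, P.noise t = Measure.dirac 0) ∧
          IsLeast {L' : ℝ≥0 | ∀ t < T, BarLipschitzOn L' (P.fPol t) P.paramState} L ∧
          (∀ t < T, BarLipschitzOn L (P.fJoint t) P.stateAction) ∧
          (∀ t < T, LipschitzOnWith 1 (P.RJoint t) P.stateAction) ∧
          LipschitzOnWith 1 P.polJoint P.paramState ∧
          -- arbitrary differentiable action-noise density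
          (∀ p : ℝ → ℝ, (∀ ξ, 0 ≤ p ξ) → IsProbabilityMeasure (densityLaw p) →
            Differentiable ℝ p →
            Tendsto (fun ξ => ξ * p ξ) atTop (𝓝 0) → Tendsto (fun ξ => ξ * p ξ) atBot (𝓝 0) →
            Integrable (fun ξ => ξ) (densityLaw p) → ∫ ξ, ξ ∂(densityLaw p) = 0 →
            Integrable (noiseScore p) (densityLaw p) →
            P.Regular p ∧ DifferentiableAt ℝ (P.J p) θ ∧
            ∀ ε δ : ℝ, 0 < ε → 0 < δ → δ < 1 →
              sqrtENat (nNoise p (ε / (L : ℝ) ^ (T - 2)) δ) ≤ sqrtENat (P.nPG p θ ε δ)) ∧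
          -- Gaussian action noise of any variance
          (∀ (σ : ℝ) (p : ℝ → ℝ), 0 < σ → p = gaussianDensity ℝ σ →
            P.Regular p ∧ DifferentiableAt ℝ (P.J p) θ ∧
            ∀ ε δ : ℝ, 0 < ε → ε ≤ (L : ℝ) ^ (T - 2) → 0 < δ → δ < 1 →
              ENNReal.ofReal (c * min ((L : ℝ) ^ ((T : ℝ) / 2) / ε ^ (1 / 2 : ℝ))
                (1 / δ ^ (1 / 2 : ℝ))) ≤ sqrtENat (P.nPG p θ ε δ))) := by
  constructor
  · refine ⟨upperConst, upperConst_pos, ?_⟩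
    rintro dS dA dΘ P σ p hσ rfl hreg hsub θ hθ LR LRt Lf Lπ Lft hLR hLRt hLf hLπ hLft
    exact P.sqrtENat_nPG_le hσ hreg hsub hθ hLR hLRt hLf hLπ hLft
  · refine ⟨Real.exp (-2) / 6, by positivity, fun T L hT hL => ?_⟩
    refine ⟨chainProblem T L, 0, rfl, Set.mem_univ _, fun _ _ => rfl,
      chainProblem.isLeast_barLipschitzOn_fPol T L hT hL,
      fun t _ => chainProblem.barLipschitzOn_fJoint T L hL t,
      fun t _ => chainProblem.lipschitzOnWith_RJoint T L t,
      chainProblem.lipschitzOnWith_polJoint T L, ?_, ?_⟩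
    · intro p hp0 hp hd htop hbot hi h0 hs
      refine ⟨chainProblem.regular T L p, chainProblem.differentiableAt_J hT hi h0 0,
        fun ε δ hε _ _ => sqrtENat_mono ?_⟩
      rw [chainProblem.nPG_eq hT hL hi h0 (integral_noiseScore hp0 hp hd htop hbot hs)]
      have hL1 : (1 : ℝ) ≤ L := hL
      refine sampleComplexity_anti _ _ ?_ δ
      exact div_le_div_of_nonneg_left hε.le (by positivity) (pow_le_pow_right₀ hL1 (by omega))
    · rintro σ p hσ rfl
      have := isProbabilityMeasure_densityLaw_gaussianDensity (V := ℝ) hσ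
      exact ⟨chainProblem.regular T L _, chainProblem.differentiableAt_J hT
        (by simpa using integrable_pow_gaussianDensity hσ 1) (integral_id_gaussianDensity hσ) 0,
        fun ε δ hε hεL hδ _ => chainProblem.le_sqrtENat_nPG hT hL hσ 0 hε hεL hδ⟩
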